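/- Let $\Omega$ be the set of infinite binary sequences, $S$ the set of finite binary strings, and $\Delta(s)\subseteq\Omega$ the set of sequences extending $s\in S$. Let $P$ be a computable probability on $X\times Y$, $X=Y=\Omega$ (the numbers $P(\Delta(s)\times\Delta(t))$ can be computed to any precision, uniformly in $s,t$), with marginals $P_X,P_Y$. For $t\in S$ with $P_Y(\Delta(t))>0$ let $P(\cdot\mid t)$ be the conditional law of the first coordinate given that the second lies in $\Delta(t)$; define $P_{Y|X}(\cdot\mid s)$ symmetrically. For $y^\infty\in\Omega$, $P(\cdot\mid y^\infty)$ denotes the probability on $\Omega$ with $P(\Delta(s)\mid y^\infty)=\lim_{t\to y^\infty}P(\Delta(s)\mid t)$ for all $s\in S$, the limit being along the prefixes $t$ of $y^\infty$ (when it exists). For a probability $\mu$ (not necessarily computable) on $\Omega$, $\mathcal R^{\mu}$ is the set of Hippocratic random sequences for $\mu$, i.e. those that lie in no effective null set; an effective null set is a set contained in $\bigcap_n U_n$ for some uniformly recursively enumerable sequence of open sets $U_n$ (unions of cylinders), enumerated without access to $\mu$, with $\mu(U_n)\le 2^{-n}$. $\mathcal R^{\mu,y^\infty}$ is the same with the enumeration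 relative to the oracle $y^\infty$. Likewise $\mathcal R^P\subseteq X\times Y$, using sets $\Delta(s)\times\Delta(t)$. For computable measures these are the Martin-Löf random points. Put $\mathcal R^P_{y^\infty}=\{x^\infty\mid (x^\infty,y^\infty)\in\mathcal R^P\}$. Assume that at least one of the following conditions holds. 1. $P(\cdot\mid s)\perp P(\cdot\mid t)$ for all $s,t\in S$ with $P_Y(\Delta(s)),P_Y(\Delta(t))>0$ and $\Delta(s)\cap\Delta(t)=\emptyset$. 2. $\mathcal R^{P(\cdot\mid s)}\cap\mathcal R^{P(\cdot\mid t)}=\emptyset$ for all such $s,t$. 3. For every $(x^\infty,y^\infty)\in\mathcal R^P$, $P_{Y|X}(\cdot\mid s)$ converges weakly to the point mass at $y^\infty$ as $s\to x^\infty$ along prefixes. 4. $\mathcal R^P_{y^\infty}\cap\mathcal R^P_{z^\infty}=\emptyset$ whenever $y^\infty\neq z^\infty$. 5. There is a function $f:X\to Y$ with $f(x^\infty)=y^\infty$ for all $(x^\infty,y^\infty)\in\mathcal R^P$. 6. There are a measurable $f:X\to Y$ and a measurable $Y'\subseteq Y$ with $P_Y(Y')=1$ such that for every $y^\infty\in Y'$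 the probability $P(\cdot\mid y^\infty)$ exists and $f=y^\infty$ holds $P(\cdot\mid y^\infty)$-almost surely. Then for every $y^\infty\in\mathcal R^{P_Y}$ the probability $P(\cdot\mid y^\infty)$ exists and $$\mathcal R^P_{y^\infty}\supseteq\mathcal R^{P(\cdot\mid y^\infty)}.$$ If moreover, for such a $y^\infty$, $P(\cdot\mid y^\infty)$ is computable with oracle $y^\infty$, then $$\mathcal R^P_{y^\infty}=\mathcal R^{P(\cdot\mid y^\infty)}=\mathcal R^{P(\cdot\mid y^\infty),y^\infty}.$$ -/

import Mathlib

open MeasureTheory ProbabilityTheory Filter Topology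
open scoped ENNReal BoundedContinuousFunction

/-- The space `Ω` of infinite binary sequences, with the product topology and the product
(equivalently Borel) σ-algebra. -/
abbrev Cantor : Type := ℕ → Bool

/-- `Δ(s)`: the set of infinite sequences that extend the finite string `s`. -/
def cyl (s : List Bool) : Set Cantor := {x | ∀ (i : ℕ) (h : i < s.length), x i = s[i]}

/-- The rectangle `Δ(s) × Δ(t)` in `Ω × Ω`. -/
def rect (p : List Bool × List Bool) : Set (Cantor × Cantor) := cyl p.1 ×ˢ cyl p.2

/-- The prefix of length `m` of the infinite sequence `y`. -/
def pre (y : Cantor) (m : ℕ) : List Bool := (List.range m).map y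

/-- The oracle given by the infinite sequence `y`. -/
def oracle (y : Cantor) : Set (ℕ →. ℕ) := {fun n => Part.some (y n).toNat}

section Effective

/-- `W` is recursively enumerable relative to the oracles in `O`. For `O = ∅` this is Mathlib's
`REPred`, see `isREIn_empty`. -/
def IsREIn {ι : Type*} [Primcodable ι] (O : Set (ℕ →. ℕ)) (W : Set ι) : Prop :=
  RecursiveIn O fun i => Part.assert (i ∈ W) fun _ => Part.some ()

theorem isREIn_empty {ι : Type*} [Primcodable ι] (W : Set ι) :
    IsREIn ∅ W ↔ REPred (fun i => i ∈ W) :=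
  recursiveIn_empty_iff

/-- The finite measure `μ` is computable relative to the oracles in `O`: the measures of the basic
sets `B i` can be computed to any precision `2⁻ᵏ`, uniformly in `i` and `k`. -/
def IsComputableMeasure {ι α : Type*} [Primcodable ι] [MeasurableSpace α]
    (O : Set (ℕ →. ℕ)) (B : ι → Set α) (μ : Measure α) : Prop :=
  ∃ f : ι × ℕ → ℕ, ComputableIn O f ∧
    ∀ i k, |μ.real (B i) - (f (i, k) : ℝ) / 2 ^ k| ≤ 1 / 2 ^ k

/-- The `n`-th open set of a test, the union of the basic sets that are enumerated at level `n`. -/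
def level {ι α : Type*} (B : ι → Set α) (W : Set (ℕ × ι)) (n : ℕ) : Set α :=
  ⋃ i ∈ {i | (n, i) ∈ W}, B i

/-- `N` is an effective null set for `μ` relative to the oracles in `O`: it is covered by a
sequence of open sets, uniformly enumerable relative to `O`, the `n`-th of which has
`μ`-measure at most `2⁻ⁿ`. Only `O` may be consulted in the enumeration; `μ` itself is not
available as an oracle and need not be computable. -/
def IsEffectiveNull {ι α : Type*} [Primcodable ι] [MeasurableSpace α]
    (O : Set (ℕ →. ℕ)) (B : ι → Set α) (μ : Measure α) (N : Set α) : Prop :=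
  ∃ W : Set (ℕ × ι), IsREIn O W ∧ (∀ n, μ (level B W n) ≤ ((2 : ℝ≥0∞) ^ n)⁻¹) ∧
    ∀ n, N ⊆ level B W n

/-- The Hippocratic random points for `μ` relative to the oracles in `O`: the complement of the
union of all effective null sets. For `O = ∅` and computable `μ` these are the Martin-Löf
random points. -/
def randomSet {ι α : Type*} [Primcodable ι] [MeasurableSpace α]
    (O : Set (ℕ →. ℕ)) (B : ι → Set α) (μ : Measure α) : Set α :=
  (⋃₀ {N | IsEffectiveNull O B μ N})ᶜ

end Effective

/-- `R^μ` for a measure `μ` on `Ω`. -/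
def hippocratic (μ : Measure Cantor) : Set Cantor := randomSet ∅ cyl μ

/-- `R^{μ,y}` for a measure `μ` on `Ω` and an oracle `y`. -/
def hippocraticIn (y : Cantor) (μ : Measure Cantor) : Set Cantor := randomSet (oracle y) cyl μ

/-- `R^P` for a measure `P` on `Ω × Ω`. -/
def hippocratic₂ (P : Measure (Cantor × Cantor)) : Set (Cantor × Cantor) := randomSet ∅ rect P

/-- The section `R^P_y = {x | (x, y) ∈ R^P}`. -/
def randomSection (P : Measure (Cantor × Cantor)) (y : Cantor) : Set Cantor :=
  {x | (x, y) ∈ hippocratic₂ P}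

/-- `P(· | t)`, the law of the first coordinate given that the second one lies in `Δ(t)`.
(Meaningful when `P_Y(Δ(t)) > 0`, and the zero measure otherwise.) -/
noncomputable def condX (P : Measure (Cantor × Cantor)) (t : List Bool) : Measure Cantor :=
  (P[|Prod.snd ⁻¹' cyl t]).map Prod.fst

/-- `P_{Y|X}(· | s)`, the law of the second coordinate given that the first one lies in `Δ(s)`.
(Meaningful when `P_X(Δ(s)) > 0`, and the zero measure otherwise.) -/
noncomputable def condY (P : Measure (Cantor × Cantor)) (s : List Bool) : Measure Cantor :=
  (P[|Prod.fst ⁻¹' cyl s]).map Prod.snd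

/-- `ν` is the conditional probability `P(· | y)` at the infinite sequence `y`: the probability
measure with `ν(Δ(s)) = lim P(s | t)` as the prefix `t` of `y` grows, for every `s`. It is unique
if it exists, see `IsCondProbAt.unique`; it does not exist if some prefix `t` of `y` has
`P_Y(Δ(t)) = 0`. -/
def IsCondProbAt (P : Measure (Cantor × Cantor)) (y : Cantor) (ν : Measure Cantor) : Prop :=
  IsProbabilityMeasure ν ∧
    ∀ s : List Bool, Tendsto (fun m => condX P (pre y m) (cyl s)) atTop (𝓝 (ν (cyl s)))

theorem measurableSet_cyl (s : List Bool) : MeasurableSet (cyl s) := by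
  have : cyl s = ⋂ (i : ℕ) (h : i < s.length), (fun x : Cantor => x i) ⁻¹' {s[i]} := by
    ext x; simp [cyl]
  rw [this]
  exact MeasurableSet.iInter fun i => MeasurableSet.iInter fun _ =>
    measurable_pi_apply i (measurableSet_singleton _)

theorem isPiSystem_cyl : IsPiSystem (Set.range cyl) := by
  rintro _ ⟨s, rfl⟩ _ ⟨t, rfl⟩ ⟨z, hzs, hzt⟩
  have key : ∀ s t : List Bool, s.length ≤ t.length → z ∈ cyl s → z ∈ cyl t → cyl t ⊆ cyl s := by
    intro s t hl hs ht x hx i hi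
    rw [hx i (hi.trans_le hl), ← ht i (hi.trans_le hl), hs i hi]
  rcases le_total s.length t.length with h | h
  · exact ⟨t, (Set.inter_eq_right.2 (key s t h hzs hzt)).symm⟩
  · exact ⟨s, (Set.inter_eq_left.2 (key t s h hzt hzs)).symm⟩

theorem generateFrom_cyl :
    (inferInstance : MeasurableSpace Cantor) = MeasurableSpace.generateFrom (Set.range cyl) := by
  apply le_antisymm
  · refine iSup_le fun i => ?_
    rw [MeasurableSpace.comap_le_iff_le_map]
    intro A _
    change MeasurableSet[MeasurableSpace.generateFrom (Set.range cyl)] ((fun x : Cantor => x i) ⁻¹' A)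
    have : (fun x : Cantor => x i) ⁻¹' A
        = ⋃ s ∈ {s : List Bool | ∃ h : i < s.length, s[i] ∈ A}, cyl s := by
      ext x
      simp only [Set.mem_preimage, Set.mem_iUnion, Set.mem_ofPred_eq, exists_prop]
      constructor
      · intro hx
        exact ⟨pre x (i + 1), ⟨by simp [pre], by simpa [pre] using hx⟩, fun j hj => by simp [pre]⟩
      · rintro ⟨s, ⟨h, hA⟩, hx⟩
        rw [hx i h]; exact hA
    rw [this]
    exact MeasurableSet.biUnion (Set.to_countable _) fun s _ =>
      MeasurableSpace.measurableSet_generateFrom ⟨s, rfl⟩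
  · refine MeasurableSpace.generateFrom_le ?_
    rintro _ ⟨s, rfl⟩
    exact measurableSet_cyl s

theorem IsCondProbAt.unique {P : Measure (Cantor × Cantor)} {y : Cantor} {ν ν' : Measure Cantor}
    (h : IsCondProbAt P y ν) (h' : IsCondProbAt P y ν') : ν = ν' := by
  have := h.1
  have := h'.1
  refine ext_of_generate_finite _ generateFrom_cyl isPiSystem_cyl ?_ (by simp)
  rintro _ ⟨s, rfl⟩
  exact tendsto_nhds_unique (h.2 s) (h'.2 s)

/-- Conditional probabilities given disjoint cylinders are mutually singular. -/
def SingCylinders (P : Measure (Cantor × Cantor)) : Prop :=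
  ∀ s t : List Bool, P.snd (cyl s) ≠ 0 → P.snd (cyl t) ≠ 0 → Disjoint (cyl s) (cyl t) →
    condX P s ⟂ₘ condX P t

/-- Conditional probabilities given disjoint cylinders have no common
random sequence. -/
def DisjointRandomCylinders (P : Measure (Cantor × Cantor)) : Prop :=
  ∀ s t : List Bool, P.snd (cyl s) ≠ 0 → P.snd (cyl t) ≠ 0 → Disjoint (cyl s) (cyl t) →
    hippocratic (condX P s) ∩ hippocratic (condX P t) = ∅

/-- Consistency of the posterior. For every random pair `(x, y)`, the measures
`P_{Y|X}(· | s)` converge weakly to the point mass at `y` as the prefix `s` of `x` grows. -/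
def PosteriorConsistent (P : Measure (Cantor × Cantor)) : Prop :=
  ∀ x y : Cantor, (x, y) ∈ hippocratic₂ P → ∀ g : Cantor →ᵇ ℝ,
    Tendsto (fun n => ∫ z, g z ∂(condY P (pre x n))) atTop
      (𝓝 (∫ z, g z ∂(Measure.dirac y)))

/-- The sections of `R^P` at distinct points are disjoint. -/
def DisjointSections (P : Measure (Cantor × Cantor)) : Prop :=
  ∀ y z : Cantor, y ≠ z → randomSection P y ∩ randomSection P z = ∅

/-- On random pairs, the second coordinate is a function of the first. -/
def RandomEstimator (P : Measure (Cantor × Cantor)) : Prop :=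
  ∃ f : Cantor → Cantor, ∀ x y : Cantor, (x, y) ∈ hippocratic₂ P → f x = y

/-- There is a (measurable) `f` with `f = y` almost surely for `P(· | y)`,
for `P_Y`-almost all `y`. -/
def AlmostSureEstimator (P : Measure (Cantor × Cantor)) : Prop :=
  ∃ f : Cantor → Cantor, Measurable f ∧ ∃ Y' : Set Cantor, MeasurableSet Y' ∧ P.snd Y' = 1 ∧
    ∀ y ∈ Y', ∃ ν : Measure Cantor, IsCondProbAt P y ν ∧ ∀ᵐ x ∂ν, f x = y

/-! All six conditions imply the first one, `SingCylinders`. If the random sets of `P(· | s)` and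
`P(· | t)` are disjoint, they separate the two measures, since each has full measure. Consistency of
the posterior and the existence of an estimator on random pairs each make the sections of `R^P`
disjoint; in that case the random pairs over disjoint cylinders have disjoint projections, which a
universal test turns into σ-compact sets of full measure. An almost sure estimator `f` separates
through the sets `f⁻¹(Δ(t))`, by disintegration.

Existence of `P(· | y)` is effective martingale convergence. If `P(Δ(s) | t)` oscillated along `y`,
then `y` would complete arbitrarily many upcrossings of a rational interval, an event that is
enumerable and has geometrically decreasing measure (`measure_upcrossing_le`,
`not_frequently_upcrossing`). Compactness of the space of probabilities gives the limit measure.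

For the inclusion `⊇`, let `x` be random for `P(· | y)`. An effective Markov inequality shows that
`x` is random for `P(· | t)` for every prefix `t` of `y` (`hippocratic_subset_condX`); the empty
prefix makes `x` random for `P_X`. By compactness of `Y` and a universal test, `x` is the first
coordinate of some random pair `(x, z)` (`exists_mem_hippocratic₂`). If `z ≠ y`, take disjoint
prefixes of both. Then `x` is random for both conditional probabilities, which is impossible:
separating clopen sets for two singular ones can be found by search, and they form tests that no
point escapes on both sides (`hippocratic_inter_eq_empty`).

For the inclusion `⊆`, a test for `P(· | y)` with oracle `y` has to become a test on pairs without
an oracle. By the use principle (`RecursiveIn.exists_primrec_prefix`), finite prefixes of `y`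
determine both the enumeration and the approximations to the measure. Run on an arbitrary second
coordinate `z`, the same procedure is trimmed: a cylinder `Δ(u)` is accepted only if the measures
claimed for the cylinders so far have a small sum and the claim for `Δ(u)` really bounds `P(Δ(u) |
t)`. The bound on the sum holds for every `z`, so integration over `z` bounds the measure
(`measure_trimmedTest_le`). Along the true `y` the claims are correct and nothing is lost
(`mem_level_trimmedTest`). -/

/-! ### Closure properties of enumerable sets. -/

section Computability

variable {α β γ ι : Type*} [Primcodable α] [Primcodable β] [Primcodable γ] [Primcodable ι]

/-- A recursively enumerable predicate is the union of an increasing sequence of primitive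
recursive predicates. -/
theorem REPred.exists_primrec_stage {p : α → Prop} (hp : REPred p) :
    ∃ q : ℕ → α → Prop, PrimrecPred (fun x : ℕ × α => q x.1 x.2) ∧
      (∀ k k' a, k ≤ k' → q k a → q k' a) ∧ (∀ k a, q k a → Encodable.encode a < k) ∧
      ∀ a, p a ↔ ∃ k, q k a := by
  obtain ⟨c, hc⟩ := Nat.Partrec.Code.exists_code.1 hp
  refine ⟨fun k a => (Nat.Partrec.Code.evaln k c (Encodable.encode a)).isSome = true, ?_, ?_, ?_, ?_⟩
  · have : Primrec fun x : ℕ × α =>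
        (Nat.Partrec.Code.evaln x.1 c (Encodable.encode x.2)).isSome :=
      Primrec.option_isSome.comp (Nat.Partrec.Code.primrec_evaln.comp
        ((Primrec.fst.pair (Primrec.const c)).pair (Primrec.encode.comp Primrec.snd)))
    exact Primrec.primrecPred (by simpa using this)
  · intro k k' a hk h
    obtain ⟨v, hv⟩ := Option.isSome_iff_exists.1 h
    exact Option.isSome_iff_exists.2 ⟨v, Nat.Partrec.Code.evaln_mono hk hv⟩
  · intro k a h
    obtain ⟨v, hv⟩ := Option.isSome_iff_exists.1 h
    exact Nat.Partrec.Code.evaln_bound hv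
  · intro a
    have key : p a ↔ ∃ v, v ∈ Nat.Partrec.Code.eval c (Encodable.encode a) := by
      rw [hc]; simp
    rw [key]
    simp only [Nat.Partrec.Code.evaln_complete, Option.isSome_iff_exists]
    exact exists_comm

theorem REPred.of_exists_nat {q : α → ℕ → Prop} (hq : ComputablePred fun x : α × ℕ => q x.1 x.2) :
    REPred fun a => ∃ n, q a n := by
  classical
  have h : Partrec (fun x ↦ Nat.rfind fun n => Part.some (decide (q x n))) :=
    Partrec.rfind (Computable.partrec hq.decide)
  refine h.dom_re.of_eq fun a => Nat.rfind_dom.trans ⟨?_, ?_⟩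
  · rintro ⟨n, hn, -⟩
    exact ⟨n, by simpa using hn⟩
  · rintro ⟨n, hn⟩
    exact ⟨n, by simpa using hn, fun _ => trivial⟩

theorem REPred.comp' {p : β → Prop} (hp : REPred p) {f : α → β} (hf : Computable f) :
    REPred fun a => p (f a) :=
  Partrec.comp hp hf

theorem REPred.exists' {p : α × β → Prop} (hp : REPred p) : REPred fun a => ∃ b, p (a, b) := by
  obtain ⟨q, hq, -, hb, h⟩ := hp.exists_primrec_stage
  have : PrimrecPred fun x : α × ℕ =>
      ∃ b ∈ (List.range x.2).filterMap (Encodable.decode (α := β)), q x.2 (x.1, b) := by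
    have hR : PrimrecRel fun (b : β) (x : α × ℕ) => q x.2 (x.1, b) :=
      PrimrecPred.primrecRel (p := fun y : β × (α × ℕ) => q y.2.2 (y.2.1, y.1))
        (hq.comp (f := fun y : β × (α × ℕ) => (y.2.2, (y.2.1, y.1)))
          ((Primrec.snd.comp Primrec.snd).pair ((Primrec.fst.comp Primrec.snd).pair Primrec.fst)))
    exact PrimrecRel.comp hR.exists_mem_list
      (Primrec.listFilterMap (Primrec.list_range.comp Primrec.snd)
        (Primrec.decode.comp Primrec.snd).to₂) Primrec.id
  refine (REPred.of_exists_nat (q := fun a n => ∃ b ∈ (List.range n).filterMap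
    (Encodable.decode (α := β)), q n (a, b)) this.computablePred).of_eq fun a => ?_
  simp only [h]
  constructor
  · rintro ⟨n, b, -, hb⟩; exact ⟨b, n, hb⟩
  · rintro ⟨b, n, hn⟩
    refine ⟨n, b, ?_, hn⟩
    -- A stage accepts only inputs whose code is below it, so the witness occurs among the codes
    -- below `n`.
    have := hb _ _ hn
    simp only [List.mem_filterMap, List.mem_range]
    refine ⟨Encodable.encode b, ?_, Encodable.encodek b⟩
    refine lt_of_le_of_lt ?_ this
    simpa using Nat.right_le_pair (Encodable.encode a) (Encodable.encode b)

theorem REPred.and' {p q : α → Prop} (hp : REPred p) (hq : REPred q) :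
    REPred fun a => p a ∧ q a := by
  obtain ⟨p', hp', mp, -, ep⟩ := hp.exists_primrec_stage
  obtain ⟨q', hq', mq, -, eq⟩ := hq.exists_primrec_stage
  have hsw : Primrec fun x : α × ℕ => (x.2, x.1) := Primrec.snd.pair Primrec.fst
  refine (REPred.of_exists_nat (q := fun a n => p' n a ∧ q' n a)
    ((hp'.comp hsw).and (hq'.comp hsw)).computablePred).of_eq fun a => ?_
  rw [ep, eq]
  constructor
  · rintro ⟨n, h1, h2⟩; exact ⟨⟨n, h1⟩, ⟨n, h2⟩⟩
  · rintro ⟨⟨n, h1⟩, ⟨m, h2⟩⟩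
    exact ⟨max n m, mp _ _ _ (le_max_left _ _) h1, mq _ _ _ (le_max_right _ _) h2⟩

/-- A uniformly enumerable family of sets is uniformly the union of an increasing sequence of
finite lists. -/
theorem REPred.exists_primrec_list {p : γ × ι → Prop} (hp : REPred p) :
    ∃ L : γ → ℕ → List ι, Primrec₂ L ∧ (∀ g k k', k ≤ k' → L g k ⊆ L g k') ∧
      ∀ g i, p (g, i) ↔ ∃ k, i ∈ L g k := by
  obtain ⟨q, hq, mq, bq, eq⟩ := hp.exists_primrec_stage
  classical
  have hR : PrimrecRel fun (i : ι) (x : γ × ℕ) => q x.2 (x.1, i) :=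
    PrimrecPred.primrecRel (p := fun y : ι × (γ × ℕ) => q y.2.2 (y.2.1, y.1))
      (hq.comp (f := fun y : ι × (γ × ℕ) => (y.2.2, (y.2.1, y.1)))
        ((Primrec.snd.comp Primrec.snd).pair ((Primrec.fst.comp Primrec.snd).pair Primrec.fst)))
  have hmem : ∀ g k i, i ∈ ((List.range k).filterMap (Encodable.decode (α := ι))).filter
      (fun i => decide (q k (g, i))) ↔ q k (g, i) := by
    intro g k i
    simp only [List.mem_filter, List.mem_filterMap, List.mem_range, decide_eq_true_eq,
      and_iff_right_iff_imp]
    intro h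
    refine ⟨Encodable.encode i, lt_of_le_of_lt ?_ (bq _ _ h), Encodable.encodek i⟩
    simpa using Nat.right_le_pair (Encodable.encode g) (Encodable.encode i)
  refine ⟨fun g k => ((List.range k).filterMap (Encodable.decode (α := ι))).filter
      (fun i => decide (q k (g, i))), ?_, ?_, ?_⟩
  · exact Primrec₂.comp hR.listFilter (g := fun x : γ × ℕ => (List.range x.2).filterMap
      (Encodable.decode (α := ι))) (h := fun x : γ × ℕ => x)
      (Primrec.listFilterMap (Primrec.list_range.comp Primrec.snd)
        (Primrec.decode.comp Primrec.snd).to₂) Primrec.id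
  · intro g k k' hk i hi
    rw [hmem] at hi ⊢
    exact mq _ _ _ hk hi
  · intro g i
    simp only [hmem, eq]

/-- Iterates of an enumerable relation are uniformly enumerable. -/
theorem REPred.iterate_rel {R : α → α → Prop} (hR : REPred fun x : α × α => R x.1 x.2) (a : α) :
    ∃ D : ℕ → α → Prop, REPred (fun x : ℕ × α => D x.1 x.2) ∧ (∀ b, D 0 b ↔ b = a) ∧
      ∀ n b, D (n + 1) b ↔ ∃ c, D n c ∧ R c b := by
  obtain ⟨L, hL, mL, eL⟩ := hR.exists_primrec_list
  -- One stage bound `k` serves all iterations. Monotonicity in `k` then merges the bounds of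
  -- successive iterations.
  let I : ℕ → ℕ → List α := fun n k => Nat.rec [a] (fun _ l => l.flatMap fun b => L b k) n
  have hI : Primrec₂ I :=
    (Primrec.nat_rec' (f := fun x : ℕ × ℕ => x.1) (g := fun _ => [a])
      (h := fun (x : ℕ × ℕ) (y : ℕ × List α) => y.2.flatMap fun b => L b x.2) Primrec.fst
      (Primrec.const _) (Primrec.list_flatMap (Primrec.snd.comp Primrec.snd)
        (hL.comp Primrec.snd (Primrec.snd.comp (Primrec.fst.comp Primrec.fst))).to₂).to₂)
  have mI : ∀ n k k', k ≤ k' → I n k ⊆ I n k' := by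
    intro n k k' hk
    induction n with
    | zero => exact fun x hx => hx
    | succ n ih =>
      intro x hx
      obtain ⟨b, hb, hx⟩ := List.mem_flatMap.1 hx
      exact List.mem_flatMap.2 ⟨b, ih hb, mL _ _ _ hk hx⟩
  classical
  have hmem : PrimrecPred fun x : (ℕ × α) × ℕ => ∃ c ∈ I x.1.1 x.2, c = x.1.2 :=
    PrimrecRel.comp (PrimrecRel.exists_mem_list (R := fun (c : α) (x : (ℕ × α) × ℕ) => c = x.1.2)
      (Primrec.eq.comp Primrec.fst (Primrec.snd.comp (Primrec.fst.comp Primrec.snd))))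
      (hI.comp (Primrec.fst.comp Primrec.fst) Primrec.snd) Primrec.id
  refine ⟨fun n b => ∃ k, b ∈ I n k, ?_, ?_, ?_⟩
  · refine (REPred.of_exists_nat (q := fun (x : ℕ × α) k => ∃ c ∈ I x.1 k, c = x.2)
      hmem.computablePred).of_eq fun x => by simp
  · intro b
    simp [I]
  · intro n b
    constructor
    · rintro ⟨k, hk⟩
      obtain ⟨c, hc, hb⟩ := List.mem_flatMap.1 hk
      exact ⟨c, ⟨k, hc⟩, (eL _ _).2 ⟨k, hb⟩⟩
    · rintro ⟨c, ⟨k, hk⟩, hR⟩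
      obtain ⟨k', hk'⟩ := (eL _ _).1 hR
      exact ⟨max k k', List.mem_flatMap.2 ⟨c, mI _ _ _ (le_max_left _ _) hk,
        mL _ _ _ (le_max_right _ _) hk'⟩⟩

theorem Primrec.list_sum_map {f : α → β → ℕ} (hf : Primrec₂ f) {l : α → List β}
    (hl : Primrec l) : Primrec fun a => ((l a).map (f a)).sum := by
  refine (Primrec.list_foldr (h := fun a (x : β × ℕ) => f a x.1 + x.2) hl (Primrec.const 0)
    (Primrec.nat_add.comp (hf.comp Primrec.fst (Primrec.fst.comp Primrec.snd))
      (Primrec.snd.comp Primrec.snd)).to₂).of_eq fun a => ?_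
  induction l a with
  | nil => rfl
  | cons b t ih => simpa using ih

theorem Computable.list_sum_map {f : α → β → ℕ} (hf : Computable₂ f) {l : α → List β}
    (hl : Computable l) : Computable fun a => ((l a).map (f a)).sum := by
  have : Computable fun a => Nat.rec (motive := fun _ => ℕ) 0
      (fun i s => s + (((l a)[i]?).map (f a)).getD 0) (l a).length :=
    Computable.nat_rec (Computable.list_length.comp hl) (Computable.const 0)
      (Computable₂.comp (Primrec.nat_add.to_comp)
        (Computable.snd.comp Computable.snd)
        (Computable.option_getD (Computable.option_map
          (Computable.list_getElem?.comp (hl.comp Computable.fst)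
            (Computable.fst.comp Computable.snd))
          (hf.comp (Computable.fst.comp Computable.fst) Computable.snd).to₂)
          (Computable.const 0))).to₂
  refine this.of_eq fun a => ?_
  have key : ∀ n, Nat.rec (motive := fun _ => ℕ) 0
      (fun i s => s + (((l a)[i]?).map (f a)).getD 0) n = (((l a).take n).map (f a)).sum := by
    intro n
    induction n with
    | zero => simp
    | succ n ih =>
      simp only [ih, List.take_add_one]
      cases (l a)[n]? <;> simp
  rw [key, List.take_length]

end Computability

/-! ### Computable real numbers and their comparison. -/

section ComputableReal

variable {α β : Type*} [Primcodable α] [Primcodable β]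

/-- `g a` is, uniformly in `a`, a nonnegative real number that can be computed to any precision. -/
def ComputableReal (g : α → ℝ) : Prop :=
  ∃ (F : α → ℕ → ℕ) (B : α → ℕ), Computable₂ F ∧ Computable B ∧
    ∀ a k, |g a - (F a k : ℝ) / 2 ^ k| ≤ (B a : ℝ) / 2 ^ k

theorem ComputableReal.comp {g : β → ℝ} (hg : ComputableReal g) {f : α → β} (hf : Computable f) :
    ComputableReal fun a => g (f a) := by
  obtain ⟨F, B, hF, hB, h⟩ := hg
  exact ⟨fun a k => F (f a) k, fun a => B (f a),
    Computable₂.comp hF (hf.comp Computable.fst) Computable.snd, hB.comp hf, fun a k => h (f a) k⟩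

theorem ComputableReal.of_eq {g h : α → ℝ} (hg : ComputableReal g) (H : ∀ a, g a = h a) :
    ComputableReal h :=
  (funext H : g = h) ▸ hg

theorem ComputableReal.nat_mul {g : α → ℝ} (hg : ComputableReal g) {c : α → ℕ}
    (hc : Computable c) : ComputableReal fun a => (c a : ℝ) * g a := by
  obtain ⟨F, B, hF, hB, h⟩ := hg
  refine ⟨fun a k => c a * F a k, fun a => c a * B a,
    Primrec.nat_mul.to_comp.comp (hc.comp Computable.fst) hF,
    Primrec.nat_mul.to_comp.comp hc hB, fun a k => ?_⟩
  have : (c a : ℝ) * g a - ((c a * F a k : ℕ) : ℝ) / 2 ^ k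
      = (c a : ℝ) * (g a - (F a k : ℝ) / 2 ^ k) := by push_cast; ring
  rw [this, abs_mul, Nat.abs_cast, Nat.cast_mul, mul_div_assoc]
  exact mul_le_mul_of_nonneg_left (h a k) (Nat.cast_nonneg _)

theorem ComputableReal.add {g h : α → ℝ} (hg : ComputableReal g) (hh : ComputableReal h) :
    ComputableReal fun a => g a + h a := by
  obtain ⟨F, B, hF, hB, e₁⟩ := hg
  obtain ⟨F', B', hF', hB', e₂⟩ := hh
  refine ⟨fun a k => F a k + F' a k, fun a => B a + B' a,
    Primrec.nat_add.to_comp.comp hF hF', Primrec.nat_add.to_comp.comp hB hB', fun a k => ?_⟩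
  have e := abs_add_le (g a - (F a k : ℝ) / 2 ^ k) (h a - (F' a k : ℝ) / 2 ^ k)
  refine le_trans (le_of_eq ?_) (e.trans ((add_le_add (e₁ a k) (e₂ a k)).trans (le_of_eq ?_)))
  · congr 1; push_cast; ring
  · push_cast; ring

theorem Primrec.two_pow : Primrec fun k : ℕ => 2 ^ k :=
  (Primrec.nat_rec₁ 1 (Primrec.nat_mul.comp Primrec.snd (Primrec.const 2)).to₂).of_eq fun k => by
    induction k with
    | zero => rfl
    | succ k ih => simp only [ih, pow_succ]

theorem ComputableReal.one : ComputableReal fun _ : α => (1 : ℝ) :=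
  ⟨fun _ k => 2 ^ k, fun _ => 0, (Primrec.two_pow.comp Primrec.snd).to_comp,
    Computable.const 0, fun a k => by simp⟩

/-- The errors of the summands add up; the factor `B` in `ComputableReal` absorbs this without a
change of precision. -/
theorem ComputableReal.list_sum {g : α → β → ℝ} (hg : ComputableReal fun x : α × β => g x.1 x.2)
    {l : α → List β} (hl : Computable l) : ComputableReal fun a => ((l a).map (g a)).sum := by
  obtain ⟨F, B, hF, hB, h⟩ := hg
  refine ⟨fun a k => ((l a).map fun b => F (a, b) k).sum, fun a => ((l a).map fun b => B (a, b)).sum,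
    Computable.list_sum_map (f := fun (x : α × ℕ) b => F (x.1, b) x.2) (l := fun x => l x.1)
      (Computable₂.comp hF ((Computable.fst.comp Computable.fst).pair Computable.snd)
        (Computable.snd.comp Computable.fst)) (hl.comp Computable.fst),
    Computable.list_sum_map (f := fun a b => B (a, b)) hB hl, fun a k => ?_⟩
  dsimp only
  induction l a with
  | nil => simp
  | cons b t ih =>
    have e := abs_add_le (g a b - (F (a, b) k : ℝ) / 2 ^ k)
      ((t.map (g a)).sum - (((t.map fun b => F (a, b) k).sum : ℕ) : ℝ) / 2 ^ k)
    refine le_trans (le_of_eq ?_)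
      (e.trans ((add_le_add (h (a, b) k) ih).trans (le_of_eq ?_)))
    · congr 1; simp only [List.map_cons, List.sum_cons]; push_cast; ring
    · simp only [List.map_cons, List.sum_cons]; push_cast; ring

/-- Strict inequality between computable real numbers is semidecidable. -/
theorem ComputableReal.lt_re {g h : α → ℝ} (hg : ComputableReal g) (hh : ComputableReal h) :
    REPred fun a => g a < h a := by
  obtain ⟨F, B, hF, hB, e⟩ := hg
  obtain ⟨F', B', hF', hB', e'⟩ := hh
  have hc : ComputablePred fun x : α × ℕ => F x.1 x.2 + (B x.1 + B' x.1) < F' x.1 x.2 := by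
    have h1 : Computable fun x : α × ℕ =>
        decide (F x.1 x.2 + (B x.1 + B' x.1) < F' x.1 x.2) :=
      (Primrec.nat_lt.decide.to_comp).comp
        (Primrec.nat_add.to_comp.comp hF (Primrec.nat_add.to_comp.comp
          (hB.comp Computable.fst) (hB'.comp Computable.fst))) hF'
    exact h1.computablePred
  refine (REPred.of_exists_nat (q := fun a k => F a k + (B a + B' a) < F' a k) hc).of_eq fun a => ?_
  constructor
  · rintro ⟨k, hk⟩
    have h1 := abs_le.1 (e a k)
    have h2 := abs_le.1 (e' a k)
    have h3 : (F a k + (B a + B' a) : ℝ) < F' a k := by exact_mod_cast hk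
    have h4 := div_lt_div_of_pos_right h3 (pow_pos (two_pos : (0 : ℝ) < 2) k)
    rw [add_div, add_div] at h4
    linarith [h1.2, h2.1]
  · intro hlt
    have hpos : 0 < h a - g a := sub_pos.2 hlt
    -- `F` and `F'` may be off by `B` and `B'`, and the search asks for a further gap of `B + B'`,
    -- whence the factors 2.
    obtain ⟨k, hk⟩ := pow_unbounded_of_one_lt ((2 * B a + 2 * B' a) / (h a - g a))
      (one_lt_two : (1 : ℝ) < 2)
    refine ⟨k, ?_⟩
    rw [div_lt_iff₀ hpos] at hk
    have h2k := pow_pos (two_pos : (0 : ℝ) < 2) k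
    have h1 := (abs_le.1 (e a k)).1
    have h2 := (abs_le.1 (e' a k)).2
    have h1' : (F a k : ℝ) ≤ 2 ^ k * g a + B a := by
      have := mul_le_mul_of_nonneg_left h1 h2k.le
      field_simp at this
      linarith
    have h2' : 2 ^ k * h a - B' a ≤ (F' a k : ℝ) := by
      have := mul_le_mul_of_nonneg_left h2 h2k.le
      field_simp at this
      linarith
    have : (F a k + (B a + B' a) : ℝ) < F' a k := by nlinarith
    exact_mod_cast this

end ComputableReal

/-! ### Cylinders, rectangles, and the measure of finite unions of rectangles. -/

section Cylinders

@[simp] theorem length_pre (y : Cantor) (m : ℕ) : (pre y m).length = m := by simp [pre]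

theorem mem_cyl_iff {z : Cantor} {s : List Bool} : z ∈ cyl s ↔ pre z s.length = s := by
  constructor
  · intro h
    exact List.ext_getElem (by simp) fun i h1 h2 => by simpa [pre] using h i h2
  · intro h i hi
    have := List.getElem_of_eq h (i := i) (by simpa using hi)
    simpa [pre] using this

theorem mem_cyl_pre (z : Cantor) (m : ℕ) : z ∈ cyl (pre z m) := by
  rw [mem_cyl_iff, length_pre]

theorem take_pre (z : Cantor) (m n : ℕ) : (pre z n).take m = pre z (min m n) := by
  simp [pre, ← List.map_take, List.take_range]

theorem pre_prefix_pre (z : Cantor) {m n : ℕ} (h : m ≤ n) : pre z m <+: pre z n := by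
  rw [List.prefix_iff_eq_take, take_pre, length_pre, min_eq_left h]

theorem prefix_pre_iff {z : Cantor} {s : List Bool} {n : ℕ} :
    s <+: pre z n ↔ z ∈ cyl s ∧ s.length ≤ n := by
  constructor
  · intro h
    have hl : s.length ≤ n := by simpa using h.length_le
    rw [List.prefix_iff_eq_take, take_pre, min_eq_left hl] at h
    exact ⟨mem_cyl_iff.2 h.symm, hl⟩
  · rintro ⟨h, hl⟩
    rw [mem_cyl_iff] at h
    rw [← h]
    exact pre_prefix_pre z hl

theorem cyl_anti {s t : List Bool} (h : s <+: t) : cyl t ⊆ cyl s := by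
  intro z hz
  rw [mem_cyl_iff] at hz
  rw [← hz] at h
  exact (prefix_pre_iff.1 h).1

theorem prefix_of_mem_cyl {z : Cantor} {s t : List Bool} (hs : z ∈ cyl s) (ht : z ∈ cyl t)
    (h : s.length ≤ t.length) : s <+: t := by
  rw [← mem_cyl_iff.1 ht]
  exact prefix_pre_iff.2 ⟨hs, h⟩

theorem cyl_nonempty (s : List Bool) : (cyl s).Nonempty :=
  ⟨fun i => s.getD i false, fun i h => by simp [h]⟩

@[simp] theorem cyl_nil : cyl [] = Set.univ := by ext; simp [cyl]

theorem disjoint_cyl {s t : List Bool} (h1 : ¬ s <+: t) (h2 : ¬ t <+: s) :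
    Disjoint (cyl s) (cyl t) := by
  rw [Set.disjoint_left]
  intro z hs ht
  rcases le_total s.length t.length with h | h
  · exact h1 (prefix_of_mem_cyl hs ht h)
  · exact h2 (prefix_of_mem_cyl ht hs h)

theorem disjoint_cyl_of_length_eq {s t : List Bool} (h : s.length = t.length) (hne : s ≠ t) :
    Disjoint (cyl s) (cyl t) :=
  disjoint_cyl (fun hp => hne (hp.eq_of_length h)) fun hp => hne (hp.eq_of_length h.symm).symm

theorem isClopen_cyl (s : List Bool) : IsClopen (cyl s) := by
  have : cyl s = ⋂ i : Fin s.length, (fun x : Cantor => x i) ⁻¹' {s[i]} := by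
    ext x; simp [cyl, Fin.forall_iff]
  rw [this]
  exact isClopen_iInter_of_finite fun i => (isClopen_discrete _).preimage (continuous_apply _)

theorem isOpen_cyl (s : List Bool) : IsOpen (cyl s) := (isClopen_cyl s).isOpen

theorem isOpen_rect (p : List Bool × List Bool) : IsOpen (rect p) :=
  (isOpen_cyl _).prod (isOpen_cyl _)

theorem measurableSet_rect (p : List Bool × List Bool) : MeasurableSet (rect p) :=
  (measurableSet_cyl _).prod (measurableSet_cyl _)

/-- The cylinders given by the prefixes of `z` form a basis of neighbourhoods of `z`. -/
theorem exists_cyl_subset {z : Cantor} {U : Set Cantor} (hU : IsOpen U) (hz : z ∈ U) :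
    ∃ m, cyl (pre z m) ⊆ U := by
  obtain ⟨I, u, hu, hs⟩ := isOpen_pi_iff.1 hU z hz
  refine ⟨I.sup id + 1, fun x hx => hs ?_⟩
  intro i hi
  have hi' : i < I.sup id + 1 := Nat.lt_succ_of_le (Finset.le_sup (f := id) hi)
  have : x i = z i := by
    have := hx i (by simpa using hi')
    simpa [pre] using this
  rw [this]
  exact (hu i hi).2

theorem ne_iff_exists_disjoint_pre {y z : Cantor} (h : y ≠ z) :
    ∃ m, Disjoint (cyl (pre y m)) (cyl (pre z m)) := by
  obtain ⟨i, hi⟩ := Function.ne_iff.1 h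
  refine ⟨i + 1, disjoint_cyl_of_length_eq (by simp) fun e => hi ?_⟩
  have := List.getElem_of_eq e (i := i) (by simp)
  simpa [pre] using this

/-- The list of all binary strings of length `n`. -/
def strings : ℕ → List (List Bool)
  | 0 => [[]]
  | n + 1 => (strings n).flatMap fun s => [s ++ [false], s ++ [true]]

theorem mem_strings {n : ℕ} {s : List Bool} : s ∈ strings n ↔ s.length = n := by
  induction n generalizing s with
  | zero => simp [strings]
  | succ n ih =>
    simp only [strings, List.mem_flatMap, ih]
    constructor
    · rintro ⟨t, ht, h⟩
      simp only [List.mem_cons, List.not_mem_nil, or_false] at h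
      rcases h with rfl | rfl <;> simp [ht]
    · intro h
      refine ⟨s.dropLast, by simp [h], ?_⟩
      have hne : s ≠ [] := by rintro rfl; simp at h
      have := List.dropLast_append_getLast hne
      cases hb : s.getLast hne <;> rw [hb] at this <;> simp [this]

theorem primrec_strings : Primrec strings := by
  have : Primrec fun n : ℕ => Nat.rec (motive := fun _ => List (List Bool)) [[]]
      (fun _ l => l.flatMap fun s => [s ++ [false], s ++ [true]]) n :=
    Primrec.nat_rec₁ _ (Primrec.list_flatMap Primrec.snd
      (Primrec.list_cons.comp (Primrec.list_append.comp Primrec.snd (Primrec.const _))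
        (Primrec.list_cons.comp (Primrec.list_append.comp Primrec.snd (Primrec.const _))
          (Primrec.const []))).to₂).to₂
  refine this.of_eq fun n => ?_
  induction n with
  | zero => rfl
  | succ n ih => simp only [strings, ih]

theorem primrecRel_prefix : PrimrecRel fun s t : List Bool => s <+: t :=
  (Primrec.eq.comp Primrec.fst (Primrec.list_take.comp (Primrec.list_length.comp Primrec.fst)
    Primrec.snd)).of_eq fun _ => List.prefix_iff_eq_take.symm

open Classical in
/-- A list of pairs of strings of one common length whose rectangles partition the union of the
rectangles in `l`. -/
noncomputable def refineRect (l : List (List Bool × List Bool)) : List (List Bool × List Bool) :=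
  (((strings (l.map fun p => p.1.length + p.2.length).sum).flatMap fun s =>
    (strings (l.map fun p => p.1.length + p.2.length).sum).map fun t => (s, t))).filter
      fun q => decide (∃ p ∈ l, p.1 <+: q.1 ∧ p.2 <+: q.2)

theorem mem_refineRect {l : List (List Bool × List Bool)} {q : List Bool × List Bool} :
    q ∈ refineRect l ↔ q.1.length = (l.map fun p => p.1.length + p.2.length).sum ∧
      q.2.length = (l.map fun p => p.1.length + p.2.length).sum ∧
        ∃ p ∈ l, p.1 <+: q.1 ∧ p.2 <+: q.2 := by
  obtain ⟨s, t⟩ := q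
  simp [refineRect, mem_strings, and_assoc]

theorem primrec_refineRect : Primrec refineRect := by
  classical
  have hN : Primrec fun l : List (List Bool × List Bool) =>
      (l.map fun p => p.1.length + p.2.length).sum :=
    Primrec.list_sum_map (Primrec.nat_add.comp
      (Primrec.list_length.comp (Primrec.fst.comp Primrec.snd))
      (Primrec.list_length.comp (Primrec.snd.comp Primrec.snd))).to₂ Primrec.id
  have hR : PrimrecRel fun (q : List Bool × List Bool) (l : List (List Bool × List Bool)) =>
      ∃ p ∈ l, p.1 <+: q.1 ∧ p.2 <+: q.2 := by
    have h1 : PrimrecRel fun (p q : List Bool × List Bool) => p.1 <+: q.1 ∧ p.2 <+: q.2 :=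
      (primrecRel_prefix.comp (Primrec.fst.comp Primrec.fst) (Primrec.fst.comp Primrec.snd)).and
        (primrecRel_prefix.comp (Primrec.snd.comp Primrec.fst) (Primrec.snd.comp Primrec.snd))
    exact PrimrecRel.comp h1.exists_mem_list Primrec.snd Primrec.fst
  refine Primrec₂.comp hR.listFilter (g := fun l : List (List Bool × List Bool) =>
    ((strings (l.map fun p => p.1.length + p.2.length).sum).flatMap fun s =>
    (strings (l.map fun p => p.1.length + p.2.length).sum).map fun t => (s, t))) (h := fun l => l)
    ?_ Primrec.id
  exact Primrec.list_flatMap (primrec_strings.comp hN) (Primrec.list_map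
    (primrec_strings.comp (hN.comp Primrec.fst))
    ((Primrec.snd.comp Primrec.fst).pair Primrec.snd).to₂).to₂

theorem nodup_strings (n : ℕ) : (strings n).Nodup := by
  induction n with
  | zero => simp [strings]
  | succ n ih =>
    rw [strings, List.nodup_flatMap]
    refine ⟨fun s _ => by simp, ih.imp ?_⟩
    intro a b hab
    simp [Function.onFun, Ne.symm hab]

theorem nodup_refineRect (l : List (List Bool × List Bool)) : (refineRect l).Nodup := by
  refine List.Nodup.filter _ (List.nodup_flatMap.2 ⟨fun s _ => ?_, ?_⟩)
  · exact (nodup_strings _).map fun a b h => by simpa using h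
  · refine (nodup_strings _).imp ?_
    intro a b hab x hx hx'
    simp only [List.mem_map] at hx hx'
    obtain ⟨_, _, rfl⟩ := hx
    obtain ⟨_, _, h⟩ := hx'
    exact hab (by simpa using (congrArg Prod.fst h).symm)

theorem iUnion_refineRect (l : List (List Bool × List Bool)) :
    ⋃ q ∈ refineRect l, rect q = ⋃ p ∈ l, rect p := by
  ext ⟨x, y⟩
  simp only [Set.mem_iUnion, exists_prop, rect, Set.mem_prod]
  constructor
  · rintro ⟨q, hq, hx, hy⟩
    obtain ⟨-, -, p, hp, h1, h2⟩ := mem_refineRect.1 hq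
    exact ⟨p, hp, cyl_anti h1 hx, cyl_anti h2 hy⟩
  · rintro ⟨p, hp, hx, hy⟩
    set N := (l.map fun p => p.1.length + p.2.length).sum with hN
    have hle : p.1.length + p.2.length ≤ N :=
      List.single_le_sum (by simp) _ (List.mem_map.2 ⟨p, hp, rfl⟩)
    exact ⟨(pre x N, pre y N), mem_refineRect.2 ⟨by simp [hN], by simp [hN], p, hp,
      prefix_pre_iff.2 ⟨hx, by omega⟩, prefix_pre_iff.2 ⟨hy, by omega⟩⟩, mem_cyl_pre _ _,
      mem_cyl_pre _ _⟩

/-- Distinct rectangles whose sides all have one common length are disjoint, so the measure of the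
refined union is a plain sum. -/
theorem measureReal_iUnion_rect (P : Measure (Cantor × Cantor)) [IsFiniteMeasure P]
    (l : List (List Bool × List Bool)) :
    P.real (⋃ p ∈ l, rect p) = ((refineRect l).map fun q => P.real (rect q)).sum := by
  classical
  rw [← iUnion_refineRect, ← List.sum_toFinset _ (nodup_refineRect l),
    ← measureReal_biUnion_finset ?_ fun _ _ => measurableSet_rect _]
  · simp
  · intro p hp q hq hpq
    simp only [List.coe_toFinset, Set.mem_ofPred_eq, mem_refineRect] at hp hq
    by_cases h : p.1 = q.1
    · have h2 : p.2 ≠ q.2 := fun h2 => hpq (Prod.ext h h2)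
      exact Set.disjoint_prod.2 (Or.inr (disjoint_cyl_of_length_eq (hp.2.1.trans hq.2.1.symm) h2))
    · exact Set.disjoint_prod.2 (Or.inl (disjoint_cyl_of_length_eq (hp.1.trans hq.1.symm) h))

theorem IsComputableMeasure.computableReal_rect {P : Measure (Cantor × Cantor)}
    (hP : IsComputableMeasure ∅ rect P) : ComputableReal fun p => P.real (rect p) := by
  obtain ⟨f, hf, h⟩ := hP
  have hf' : Computable f := recursiveIn_empty_iff.1 hf
  exact ⟨fun p k => f (p, k), fun _ => 1, hf', Computable.const 1, fun p k => by simpa using h p k⟩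

/-- The measure of a finite union of rectangles is computable. -/
theorem IsComputableMeasure.computableReal_iUnion_rect {P : Measure (Cantor × Cantor)}
    [IsFiniteMeasure P] (hP : IsComputableMeasure ∅ rect P) :
    ComputableReal fun l : List (List Bool × List Bool) => P.real (⋃ p ∈ l, rect p) :=
  (ComputableReal.list_sum (hP.computableReal_rect.comp Computable.snd)
    primrec_refineRect.to_comp).of_eq fun l => (measureReal_iUnion_rect P l).symm

end Cylinders

/-! ### Minimal strings and disjoint covers. -/

section Covers

/-- The elements of `C` without a proper prefix in `C`. -/
def minimalStrings (C : Set (List Bool)) : Set (List Bool) :=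
  {t | t ∈ C ∧ ∀ s ∈ C, s <+: t → s = t}

theorem exists_minimalStrings_prefix {C : Set (List Bool)} {t : List Bool} (ht : t ∈ C) :
    ∃ s ∈ minimalStrings C, s <+: t := by
  classical
  have hex : ∃ n, ∃ s ∈ C, s <+: t ∧ s.length = n := ⟨_, t, ht, List.prefix_rfl, rfl⟩
  obtain ⟨s, hs, hst, hl⟩ := Nat.find_spec hex
  refine ⟨s, ⟨hs, fun r hr hrs => hrs.eq_of_length (le_antisymm hrs.length_le ?_)⟩, hst⟩
  rw [hl]
  exact Nat.find_min' hex ⟨r, hr, hrs.trans hst, rfl⟩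

theorem iUnion_minimalStrings (C : Set (List Bool)) :
    ⋃ t ∈ minimalStrings C, cyl t = ⋃ t ∈ C, cyl t := by
  refine subset_antisymm (Set.biUnion_subset_biUnion_left fun t ht => ht.1) ?_
  refine Set.iUnion₂_subset fun t ht => ?_
  obtain ⟨s, hs, hst⟩ := exists_minimalStrings_prefix ht
  exact (cyl_anti hst).trans (Set.subset_biUnion_of_mem (u := cyl) hs)

theorem pairwiseDisjoint_minimalStrings (C : Set (List Bool)) :
    (minimalStrings C).PairwiseDisjoint cyl := fun s hs t ht hst =>
  disjoint_cyl (fun h => hst (ht.2 s hs.1 h)) fun h => hst (hs.2 t ht.1 h).symm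

theorem measure_iUnion_cyl_eq_tsum (μ : Measure Cantor) (C : Set (List Bool)) :
    μ (⋃ t ∈ C, cyl t) = ∑' t : minimalStrings C, μ (cyl t) := by
  rw [← iUnion_minimalStrings, measure_biUnion (Set.to_countable _)
    (pairwiseDisjoint_minimalStrings C) fun _ _ => measurableSet_cyl _]

/-- The minimal cylinders are disjoint and have the same union, so it is enough to compare the
measures on them. With `ν` a restricted or weighted measure this is the Markov-type inequality
behind most test bounds below. -/
theorem measure_iUnion_cyl_mono {μ ν : Measure Cantor} {C : Set (List Bool)}
    (h : ∀ t ∈ minimalStrings C, μ (cyl t) ≤ ν (cyl t)) :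
    μ (⋃ t ∈ C, cyl t) ≤ ν (⋃ t ∈ C, cyl t) := by
  rw [measure_iUnion_cyl_eq_tsum, measure_iUnion_cyl_eq_tsum]
  exact ENNReal.tsum_le_tsum fun t => h t t.2

end Covers

/-! ### Tests and random points. -/

section Tests

variable {ι α : Type*} [Primcodable ι] [MeasurableSpace α]

theorem tsum_two_inv_pow_add (k : ℕ) : ∑' j : ℕ, ((2 : ℝ≥0∞) ^ (k + 1 + j))⁻¹ = (2 ^ k)⁻¹ := by
  have : ∀ j : ℕ, ((2 : ℝ≥0∞) ^ (k + 1 + j))⁻¹ = (2 ^ k)⁻¹ * (2⁻¹) ^ (j + 1) := by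
    intro j
    simp only [ENNReal.inv_pow, ← pow_add]
    congr 1; omega
  simp_rw [this, ENNReal.tsum_mul_left, ENNReal.tsum_geometric_add_one]
  rw [ENNReal.one_sub_inv_two, inv_inv, ENNReal.inv_mul_cancel two_ne_zero ENNReal.ofNat_ne_top,
    mul_one]

/-- A random point lies in only finitely many of the sets of a sequence, uniformly enumerable,
whose measures decrease geometrically. -/
theorem randomSet.eventually_notMem {B : ι → Set α} {μ : Measure α} {x : α}
    (hx : x ∈ randomSet ∅ B μ) {W : Set (ℕ × ι)} (hW : REPred fun p => p ∈ W) {C : ℝ≥0∞}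
    (hC : C ≠ ⊤) (h : ∀ n, μ (level B W n) ≤ C * (2 ^ n)⁻¹) :
    ∃ N, ∀ n ≥ N, x ∉ level B W n := by
  by_contra! hcon
  obtain ⟨m, hm⟩ : ∃ m : ℕ, C ≤ 2 ^ m := by
    obtain ⟨m, hm⟩ := ENNReal.exists_nat_gt hC
    exact ⟨m, hm.le.trans (by exact_mod_cast (Nat.lt_two_pow_self (n := m)).le)⟩
  refine hx (Set.mem_sUnion.2 ⟨{x}, ?_, rfl⟩)
  -- The new test consists of unions of tails. The shift by `m` absorbs `C ≤ 2 ^ m`, and the shift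
  -- by 1 pays for the geometric sum.
  refine ⟨{p | ∃ j, (p.1 + m + 1 + j, p.2) ∈ W}, ?_, fun n => ?_, fun n => ?_⟩
  · rw [isREIn_empty]
    refine REPred.exists' (p := fun q : (ℕ × ι) × ℕ => (q.1.1 + m + 1 + q.2, q.1.2) ∈ W)
      (hW.comp' (f := fun q : (ℕ × ι) × ℕ => (q.1.1 + m + 1 + q.2, q.1.2)) ?_)
    exact (Primrec.pair (Primrec.nat_add.comp (Primrec.nat_add.comp (Primrec.nat_add.comp
      (Primrec.fst.comp Primrec.fst) (Primrec.const m)) (Primrec.const 1)) Primrec.snd)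
      (Primrec.snd.comp Primrec.fst)).to_comp
  · have hsub : level B {p : ℕ × ι | ∃ j, (p.1 + m + 1 + j, p.2) ∈ W} n
        ⊆ ⋃ j, level B W (n + m + 1 + j) := by
      intro z hz
      simp only [level, Set.mem_iUnion, Set.mem_ofPred_eq, exists_prop] at hz ⊢
      obtain ⟨i, ⟨j, hj⟩, hz⟩ := hz
      exact ⟨j, i, hj, hz⟩
    calc _ ≤ μ (⋃ j, level B W (n + m + 1 + j)) := measure_mono hsub
      _ ≤ ∑' j, μ (level B W (n + m + 1 + j)) := measure_iUnion_le _
      _ ≤ ∑' j, C * (2 ^ (n + m + 1 + j))⁻¹ := ENNReal.tsum_le_tsum fun j => h _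
      _ = C * (2 ^ (n + m))⁻¹ := by rw [ENNReal.tsum_mul_left, tsum_two_inv_pow_add]
      _ ≤ 2 ^ m * (2 ^ (n + m))⁻¹ := by gcongr
      _ = (2 ^ n)⁻¹ := by
        rw [pow_add, ENNReal.mul_inv (by simp) (by simp), mul_comm, mul_assoc,
          ENNReal.inv_mul_cancel (by simp) (by simp), mul_one]
  · rintro z rfl
    obtain ⟨k, hk, hzk⟩ := hcon (n + m + 1)
    obtain ⟨j, rfl⟩ := Nat.exists_eq_add_of_le hk
    simp only [level, Set.mem_iUnion, Set.mem_ofPred_eq, exists_prop] at hzk ⊢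
    obtain ⟨i, hi, hz⟩ := hzk
    exact ⟨i, ⟨j, hi⟩, hz⟩

/-- An enumerable set is determined by the code of a program that enumerates it. -/
theorem countable_setOf_rePred {κ : Type*} [Primcodable κ] :
    {W : Set κ | REPred fun i => i ∈ W}.Countable := by
  choose! c hc using fun (W : Set κ) (hW : REPred fun i => i ∈ W) =>
    Nat.Partrec.Code.exists_code.1 hW
  refine Set.countable_iff_exists_injOn.2 ⟨fun W => Encodable.encode (c W), ?_⟩
  intro W hW V hV e
  have e' : c W = c V := Encodable.encode_injective e
  ext i
  have h1 := hc W hW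
  have h2 := hc V hV
  rw [e', h2] at h1
  have := congrFun h1 (Encodable.encode i)
  have h3 := congrArg (fun p : Part ℕ => p.Dom) this
  simpa [Part.assert] using h3.symm.to_iff

/-- Only countably many enumerable tests exist and each covers a null set. Computability of `μ`
plays no role. -/
theorem measure_compl_randomSet (B : ι → Set α) (μ : Measure α) :
    μ (randomSet ∅ B μ)ᶜ = 0 := by
  have hsub : (randomSet ∅ B μ)ᶜ ⊆ ⋃ W ∈ {W : Set (ℕ × ι) | (REPred fun i => i ∈ W) ∧
      ∀ n, μ (level B W n) ≤ ((2 : ℝ≥0∞) ^ n)⁻¹}, ⋂ n, level B W n := by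
    rw [randomSet, compl_compl]
    rintro x ⟨N, ⟨W, hW, hm, hN⟩, hx⟩
    exact Set.mem_biUnion (x := W) ⟨(isREIn_empty W).1 hW, hm⟩
      (Set.mem_iInter.2 fun n => hN n hx)
  refine measure_mono_null hsub ((measure_biUnion_null_iff
    (countable_setOf_rePred.mono fun W hW => hW.1)).2 fun W hW => ?_)
  refine le_antisymm (ge_of_tendsto' (x := atTop) (f := fun n : ℕ => ((2 : ℝ≥0∞) ^ n)⁻¹) ?_ fun n =>
    (measure_mono (Set.iInter_subset _ n)).trans (hW.2 n)) bot_le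
  simp_rw [ENNReal.inv_pow]
  exact ENNReal.tendsto_pow_atTop_nhds_zero_of_lt_one (by simp)

end Tests

/-! ### Marginals and conditional probabilities given cylinders. -/

section Marginals

variable {P : Measure (Cantor × Cantor)}

theorem snd_cyl (t : List Bool) : P.snd (cyl t) = P (rect ([], t)) := by
  rw [Measure.snd_apply (measurableSet_cyl t)]
  congr 1; ext; simp [rect]

theorem snd_real_cyl (t : List Bool) : P.snd.real (cyl t) = P.real (rect ([], t)) := by
  rw [Measure.real, snd_cyl, Measure.real]

theorem condX_apply (P : Measure (Cantor × Cantor)) (t : List Bool) {A : Set Cantor}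
    (hA : MeasurableSet A) :
    condX P t A = (P.snd (cyl t))⁻¹ * P (A ×ˢ cyl t) := by
  rw [condX, Measure.map_apply measurable_fst hA, cond_apply (measurable_snd (measurableSet_cyl t)),
    Measure.snd_apply (measurableSet_cyl t)]
  congr 2; ext; simp [and_comm]

theorem condX_nil [IsProbabilityMeasure P] : condX P [] = P.fst := by
  simp [condX, Measure.fst]

theorem isProbabilityMeasure_condX [IsFiniteMeasure P] {t : List Bool}
    (h : P.snd (cyl t) ≠ 0) : IsProbabilityMeasure (condX P t) := by
  have : P (Prod.snd ⁻¹' cyl t) ≠ 0 := by rwa [← Measure.snd_apply (measurableSet_cyl t)]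
  have := cond_isProbabilityMeasure this
  exact Measure.isProbabilityMeasure_map measurable_fst.aemeasurable

/-- A cylinder of measure zero, repeated at every level, is itself a test. -/
theorem snd_cyl_ne_zero_of_random {y : Cantor} (hy : y ∈ hippocratic P.snd) (m : ℕ) :
    P.snd (cyl (pre y m)) ≠ 0 := by
  intro h0
  refine hy (Set.mem_sUnion.2 ⟨{y}, ⟨{p | p.2 = pre y m}, ?_, fun n => ?_, fun n => ?_⟩, rfl⟩)
  · rw [isREIn_empty]
    exact (Primrec.eq.comp Primrec.snd (Primrec.const (pre y m)) : PrimrecPred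
      fun p : ℕ × List Bool => p.2 = pre y m).computablePred.to_re
  · have : level cyl {p : ℕ × List Bool | p.2 = pre y m} n = cyl (pre y m) := by simp [level]
    rw [this, h0]
    exact bot_le
  · simp [level, mem_cyl_pre]

end Marginals

/-! ### From randomness at the limit `P(· | y)` to randomness for `P(· | t)`. -/

section Transfer

variable {P : Measure (Cantor × Cantor)}

theorem iUnion_rect_map (l : List (List Bool)) (t : List Bool) :
    ⋃ p ∈ l.map fun s => (s, t), rect p = (⋃ s ∈ l, cyl s) ×ˢ cyl t := by
  ext ⟨x, y⟩
  simp only [List.mem_map, rect, Set.mem_iUnion, Set.mem_prod, exists_prop]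
  constructor
  · rintro ⟨_, ⟨s, hs, rfl⟩, hx, hy⟩; exact ⟨⟨s, hs, hx⟩, hy⟩
  · rintro ⟨⟨s, hs, hx⟩, hy⟩; exact ⟨_, ⟨s, hs, rfl⟩, hx, hy⟩

theorem measurableSet_level_cyl (W : Set (ℕ × List Bool)) (n : ℕ) :
    MeasurableSet (level cyl W n) :=
  MeasurableSet.biUnion (Set.to_countable _) fun _ _ => measurableSet_cyl _

theorem measurableSet_biUnion_cyl (l : List (List Bool)) : MeasurableSet (⋃ s ∈ l, cyl s) :=
  Finset.measurableSet_biUnion l.toFinset (f := cyl) (fun _ _ => measurableSet_cyl _) |>.congr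
    (by simp)

/-- A finite union of cylinders is the disjoint union of its finitely many minimal ones, so
convergence on cylinders suffices. -/
theorem IsCondProbAt.tendsto_biUnion {y : Cantor} {ν : Measure Cantor} (h : IsCondProbAt P y ν)
    (l : List (List Bool)) :
    Tendsto (fun m => condX P (pre y m) (⋃ s ∈ l, cyl s)) atTop (𝓝 (ν (⋃ s ∈ l, cyl s))) := by
  have hfin : (minimalStrings {s | s ∈ l}).Finite :=
    (List.finite_toSet l).subset fun t ht => ht.1
  have := hfin.fintype
  have e : ∀ μ : Measure Cantor, μ (⋃ s ∈ l, cyl s)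
      = ∑ t : minimalStrings {s | s ∈ l}, μ (cyl t) := by
    intro μ
    rw [← tsum_fintype (L := .unconditional _), ← measure_iUnion_cyl_eq_tsum]
    rfl
  simp_rw [e]
  exact tendsto_finsetSum _ fun t _ => h.2 t

theorem level_eq_iUnion_list {ι α : Type*} {B : ι → Set α} {W : Set (ℕ × ι)}
    {L : ℕ → ℕ → List ι} (hL : ∀ n i, (n, i) ∈ W ↔ ∃ k, i ∈ L n k) (n : ℕ) :
    level B W n = ⋃ k, ⋃ i ∈ L n k, B i := by
  ext z
  simp only [level, Set.mem_iUnion, Set.mem_ofPred_eq, exists_prop, hL]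
  tauto

/-- A point that is random for the conditional probability at a random `y` is random for the
conditional probabilities given the prefixes of `y`. -/
theorem hippocratic_subset_condX [IsProbabilityMeasure P] (hP : IsComputableMeasure ∅ rect P)
    {y : Cantor} (hy : y ∈ hippocratic P.snd) {ν : Measure Cantor} (hν : IsCondProbAt P y ν)
    (m : ℕ) : hippocratic ν ⊆ hippocratic (condX P (pre y m)) := by
  rintro x hx ⟨A, ⟨W, hW, hWm, hWA⟩, hxA⟩
  rw [isREIn_empty] at hW
  obtain ⟨L, hL, mL, eL⟩ := REPred.exists_primrec_list (p := fun p : ℕ × List Bool => p ∈ W) hW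
  set t₀ := pre y m with ht₀
  -- `V` at level `n` collects the extensions `t` of `t₀` for which some finite stage of `U_{2n}`
  -- has conditional probability above `2⁻ⁿ`. Passing to level `2n` leaves a factor `2⁻ⁿ` after
  -- Markov's inequality.
  let V : Set (ℕ × List Bool) := {p | t₀ <+: p.2 ∧ ∃ k, P.real (rect ([], p.2)) <
    ((2 ^ p.1 : ℕ) : ℝ) * P.real (⋃ q ∈ (L (2 * p.1) k).map fun s => (s, p.2), rect q)}
  have hV : REPred fun p => p ∈ V := by
    refine REPred.and' (PrimrecRel.comp primrecRel_prefix (Primrec.const t₀)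
      Primrec.snd).computablePred.to_re ?_
    refine REPred.exists' (p := fun p : (ℕ × List Bool) × ℕ => P.real (rect ([], p.1.2)) <
      ((2 ^ p.1.1 : ℕ) : ℝ) * P.real (⋃ q ∈ (L (2 * p.1.1) p.2).map fun s => (s, p.1.2), rect q)) ?_
    refine ComputableReal.lt_re ?_ (ComputableReal.nat_mul ?_ ?_)
    · exact hP.computableReal_rect.comp ((Primrec.const []).pair
        (Primrec.snd.comp Primrec.fst)).to_comp
    · refine hP.computableReal_iUnion_rect.comp
        (f := fun p : (ℕ × List Bool) × ℕ => (L (2 * p.1.1) p.2).map fun s => (s, p.1.2)) ?_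
      exact (Primrec.list_map (hL.comp (Primrec.nat_mul.comp (Primrec.const 2)
        (Primrec.fst.comp Primrec.fst)) Primrec.snd) (Primrec.snd.pair
          (Primrec.snd.comp (Primrec.fst.comp Primrec.fst))).to₂).to_comp
    · exact (Primrec.two_pow.comp (Primrec.fst.comp Primrec.fst)).to_comp
  have hVm : ∀ n, P.snd (level cyl V n) ≤ 1 * (2 ^ n)⁻¹ := by
    intro n
    -- Markov's inequality, with `ρ` the projection of `2ⁿ · P` restricted to `G × Δ(t₀)`: on each
    -- minimal string of `V` it dominates the marginal, and its total mass is at most `2ⁿ · 2⁻²ⁿ`.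
    set G := level cyl W (2 * n) with hG
    have hGm : MeasurableSet G := measurableSet_level_cyl _ _
    set ρ : Measure Cantor := (2 : ℝ≥0∞) ^ n • (P.restrict (G ×ˢ cyl t₀)).snd with hρ
    have h1 : P.snd (level cyl V n) ≤ ρ (level cyl V n) := by
      refine measure_iUnion_cyl_mono fun t ht => ?_
      obtain ⟨⟨hpre, k, hk⟩, -⟩ := ht
      dsimp only at hk hpre
      rw [iUnion_rect_map] at hk
      have hsub : (⋃ s ∈ L (2 * n) k, cyl s) ×ˢ cyl t ⊆ Prod.snd ⁻¹' cyl t ∩ G ×ˢ cyl t₀ := by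
        rintro ⟨a, b⟩ ⟨ha, hb⟩
        refine ⟨hb, ?_, cyl_anti hpre hb⟩
        rw [hG, level_eq_iUnion_list eL]
        exact Set.mem_iUnion_of_mem k ha
      have hr : (P.restrict (G ×ˢ cyl t₀)).snd (cyl t) = P (Prod.snd ⁻¹' cyl t ∩ G ×ˢ cyl t₀) := by
        rw [Measure.snd_apply (measurableSet_cyl t),
          Measure.restrict_apply (measurable_snd (measurableSet_cyl t))]
      rw [hρ, Measure.smul_apply, hr, smul_eq_mul]
      refine le_trans ?_ (mul_le_mul_right (measure_mono hsub) _)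
      rw [snd_cyl, ← ofReal_measureReal (μ := P), ← ofReal_measureReal (μ := P) (s := _ ×ˢ _)]
      have : (2 : ℝ≥0∞) ^ n = ENNReal.ofReal ((2 ^ n : ℕ) : ℝ) := by
        rw [ENNReal.ofReal_natCast]; norm_cast
      rw [this, ← ENNReal.ofReal_mul (Nat.cast_nonneg _)]
      exact ENNReal.ofReal_le_ofReal hk.le
    refine h1.trans ((measure_mono (Set.subset_univ _)).trans ?_)
    rw [hρ, Measure.smul_apply, Measure.snd_univ, Measure.restrict_apply_univ, smul_eq_mul]
    have h2 := hWm (2 * n)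
    rw [condX_apply P _ hGm] at h2
    have h0 := snd_cyl_ne_zero_of_random hy m
    have h3 : P (G ×ˢ cyl t₀) ≤ (2 ^ (2 * n))⁻¹ := by
      calc P (G ×ˢ cyl t₀) = P.snd (cyl t₀) * ((P.snd (cyl t₀))⁻¹ * P (G ×ˢ cyl t₀)) := by
            rw [← mul_assoc, ENNReal.mul_inv_cancel h0 (measure_ne_top _ _), one_mul]
        _ ≤ 1 * (2 ^ (2 * n))⁻¹ := by gcongr; exact prob_le_one
        _ = _ := one_mul _
    calc (2 : ℝ≥0∞) ^ n * P (G ×ˢ cyl t₀) ≤ 2 ^ n * (2 ^ (2 * n))⁻¹ := by gcongr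
      _ = 1 * (2 ^ n)⁻¹ := by
        rw [two_mul, pow_add, ENNReal.mul_inv (by simp) (by simp), ← mul_assoc,
          ENNReal.mul_inv_cancel (by simp) (by simp)]
  obtain ⟨N, hN⟩ := randomSet.eventually_notMem hy hV ENNReal.one_ne_top hVm
  -- Beyond `N` no prefix of `y` is in `V`, so every finite stage has conditional probability at
  -- most `2⁻ⁿ` given any long prefix. The bound passes to the limit in the prefix, then to the
  -- supremum over the stages.
  have hνm : ∀ n ≥ N, ν (level cyl W (2 * n)) ≤ (2 ^ n)⁻¹ := by
    intro n hn
    rw [level_eq_iUnion_list eL, Directed.measure_iUnion]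
    · refine iSup_le fun k => le_of_tendsto (hν.tendsto_biUnion _) ?_
      filter_upwards [eventually_ge_atTop m] with m' hm'
      have hny := hN n hn
      have hpos := snd_cyl_ne_zero_of_random hy m'
      have : ¬ (P.real (rect ([], pre y m')) < ((2 ^ n : ℕ) : ℝ) *
          P.real (⋃ q ∈ (L (2 * n) k).map fun s => (s, pre y m'), rect q)) := by
        intro hlt
        exact hny (Set.mem_biUnion (x := pre y m') (show (n, pre y m') ∈ V from
          ⟨pre_prefix_pre y hm', k, hlt⟩) (mem_cyl_pre _ _))
      rw [iUnion_rect_map, not_lt] at this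
      rw [condX_apply P _ (measurableSet_biUnion_cyl _), snd_cyl]
      rw [snd_cyl] at hpos
      have h4 := ENNReal.ofReal_le_ofReal this
      rw [ENNReal.ofReal_mul (Nat.cast_nonneg _), ENNReal.ofReal_natCast, ofReal_measureReal,
        ofReal_measureReal] at h4
      push_cast at h4
      rw [mul_comm, ← div_eq_mul_inv]
      refine ENNReal.div_le_of_le_mul ?_
      rw [mul_comm (_⁻¹), ← div_eq_mul_inv, ENNReal.le_div_iff_mul_le (by simp) (by simp), mul_comm]
      exact h4
    · exact directed_of_isDirected_le fun k k' hk =>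
        Set.biUnion_subset_biUnion_left fun s hs => mL _ _ _ hk hs
  -- The levels `2(n + N)` of `W` now form a test for `ν`, and `x` lies in all of them.
  obtain ⟨N', hN'⟩ := randomSet.eventually_notMem hx
    (W := {p | (2 * (p.1 + N), p.2) ∈ W}) (hW.comp' (f := fun p : ℕ × List Bool =>
      (2 * (p.1 + N), p.2)) ((Primrec.nat_mul.comp (Primrec.const 2) (Primrec.nat_add.comp
        Primrec.fst (Primrec.const N))).pair Primrec.snd).to_comp) ENNReal.one_ne_top (fun n => by
      refine (hνm (n + N) (Nat.le_add_left _ _)).trans ?_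
      rw [one_mul]
      exact ENNReal.inv_le_inv.2 (pow_le_pow_right₀ one_le_two (Nat.le_add_right _ _)))
  exact hN' N' le_rfl (hWA (2 * (N' + N)) hxA)

end Transfer

/-! ### Upcrossings and the existence of `P(· | y)`. -/

section Convergence

variable {P : Measure (Cantor × Cantor)}

theorem restrict_snd_cyl [IsFiniteMeasure P] (s t : List Bool) :
    (P.restrict (cyl s ×ˢ Set.univ)).snd (cyl t) = P (rect (s, t)) := by
  rw [Measure.snd_apply (measurableSet_cyl t),
    Measure.restrict_apply (measurable_snd (measurableSet_cyl t))]
  congr 1; ext; simp [rect, and_comm]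

/-- This is the upcrossing inequality. Let `t` be a minimal string in `C`, where the ratio `P(Δ(s) ×
Δ(t)) / P_Y(Δ(t))` is at most `p / c`. The strings of `D'` inside `Δ(t)` have ratio at least `q /
c`, and their share of `P(Δ(s) × ·)` cannot exceed that of `Δ(t)`. Hence they occupy at most the
fraction `p / q` of `Δ(t)`, and the minimal `t` are disjoint. -/
theorem measure_upcrossing_le [IsFiniteMeasure P] (s : List Bool) {c p q : ℕ}
    {D D' : List Bool → Prop}
    (hD : ∀ u, D' u → ∃ t' t, D t' ∧ t' <+: t ∧ t <+: u ∧
      (c : ℝ≥0∞) * P (rect (s, t)) ≤ p * P.snd (cyl t) ∧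
      (q : ℝ≥0∞) * P.snd (cyl u) ≤ c * P (rect (s, u))) :
    (q : ℝ≥0∞) * P.snd (⋃ u ∈ {u | D' u}, cyl u) ≤ p * P.snd (⋃ u ∈ {u | D u}, cyl u) := by
  set A := ⋃ u ∈ {u | D' u}, cyl u with hA
  set C : Set (List Bool) := {t | (c : ℝ≥0∞) * P (rect (s, t)) ≤ p * P.snd (cyl t) ∧
    ∃ t', D t' ∧ t' <+: t} with hC
  have hAC : A ⊆ ⋃ t ∈ C, cyl t := by
    refine Set.iUnion₂_subset fun u hu => ?_
    obtain ⟨t', t, h1, h2, h3, h4, -⟩ := hD u hu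
    exact (cyl_anti h3).trans (Set.subset_biUnion_of_mem (u := cyl) (show t ∈ C from ⟨h4, t', h1, h2⟩))
  have hCD : ⋃ t ∈ C, cyl t ⊆ ⋃ u ∈ {u | D u}, cyl u := by
    refine Set.iUnion₂_subset fun t ht => ?_
    obtain ⟨-, t', h1, h2⟩ := ht
    exact (cyl_anti h2).trans (Set.subset_biUnion_of_mem (u := cyl) (show t' ∈ {u | D u} from h1))
  have key : ((q : ℝ≥0∞) • P.snd.restrict A) (⋃ t ∈ C, cyl t)
      ≤ ((p : ℝ≥0∞) • P.snd) (⋃ t ∈ C, cyl t) := by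
    refine measure_iUnion_cyl_mono fun t ht => ?_
    set C₂ : Set (List Bool) := {u | t <+: u ∧ (q : ℝ≥0∞) * P.snd (cyl u) ≤ c * P (rect (s, u))}
    have hsub : cyl t ∩ A ⊆ ⋃ u ∈ C₂, cyl u := by
      rintro z ⟨hzt, hzA⟩
      simp only [hA, Set.mem_iUnion, Set.mem_ofPred_eq, exists_prop] at hzA
      obtain ⟨u, hu, hzu⟩ := hzA
      obtain ⟨t', t₁, h1, h2, h3, h4, h5⟩ := hD u hu
      refine Set.mem_biUnion (x := u) ⟨?_, h5⟩ hzu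
      have ht₁ : t₁ ∈ C := ⟨h4, t', h1, h2⟩
      have hzt₁ := cyl_anti h3 hzu
      rcases le_total t.length t₁.length with h | h
      · exact (prefix_of_mem_cyl hzt hzt₁ h).trans h3
      · rw [← ht.2 t₁ ht₁ (prefix_of_mem_cyl hzt₁ hzt h)]
        exact h3
    have hsub₂ : ⋃ u ∈ C₂, cyl u ⊆ cyl t := Set.iUnion₂_subset fun u hu => cyl_anti hu.1
    rw [Measure.smul_apply, Measure.smul_apply, Measure.restrict_apply (measurableSet_cyl t),
      smul_eq_mul, smul_eq_mul]
    calc (q : ℝ≥0∞) * P.snd (cyl t ∩ A) ≤ q * P.snd (⋃ u ∈ C₂, cyl u) := by gcongr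
      _ = ((q : ℝ≥0∞) • P.snd) (⋃ u ∈ C₂, cyl u) := rfl
      _ ≤ ((c : ℝ≥0∞) • (P.restrict (cyl s ×ˢ Set.univ)).snd) (⋃ u ∈ C₂, cyl u) := by
        refine measure_iUnion_cyl_mono fun u hu => ?_
        rw [Measure.smul_apply, Measure.smul_apply, restrict_snd_cyl]
        exact hu.1.2
      _ ≤ ((c : ℝ≥0∞) • (P.restrict (cyl s ×ˢ Set.univ)).snd) (cyl t) := measure_mono hsub₂
      _ = c * P (rect (s, t)) := by rw [Measure.smul_apply, restrict_snd_cyl]; rfl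
      _ ≤ p * P.snd (cyl t) := ht.1.1
  have hCm : MeasurableSet (⋃ t ∈ C, cyl t) :=
    MeasurableSet.biUnion (Set.to_countable _) fun _ _ => measurableSet_cyl _
  rw [Measure.smul_apply, Measure.smul_apply, Measure.restrict_apply hCm,
    Set.inter_eq_right.2 hAC, smul_eq_mul, smul_eq_mul] at key
  exact key.trans (by gcongr)

/-- Along a random sequence, the conditional probability of a cylinder does not oscillate. -/
theorem not_frequently_upcrossing [IsProbabilityMeasure P] (hP : IsComputableMeasure ∅ rect P)
    {y : Cantor} (hy : y ∈ hippocratic P.snd) (s : List Bool) {c p q : ℕ} (hpq : p < q) :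
    ¬ ((∃ᶠ m in atTop, (c : ℝ) * P.real (rect (s, pre y m)) < p * P.real (rect ([], pre y m))) ∧
      ∃ᶠ m in atTop, (q : ℝ) * P.real (rect ([], pre y m)) < c * P.real (rect (s, pre y m))) := by
  rintro ⟨hlo, hhi⟩
  let lo : List Bool → Prop := fun t => (c : ℝ) * P.real (rect (s, t)) < p * P.real (rect ([], t))
  let hi : List Bool → Prop := fun t => (q : ℝ) * P.real (rect ([], t)) < c * P.real (rect (s, t))
  have cr : ∀ (r : List Bool) (k : ℕ),
      ComputableReal fun t : List Bool => (k : ℝ) * P.real (rect (r, t)) := fun r k =>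
    (hP.computableReal_rect.comp (Primrec.pair (Primrec.const r) Primrec.id).to_comp).nat_mul
      (Computable.const k)
  have rlo : REPred lo := (cr s c).lt_re (cr [] p)
  have rhi : REPred hi := (cr [] q).lt_re (cr s c)
  have hR : REPred fun x : List Bool × List Bool =>
      ∃ t, (x.1 <+: t ∧ t <+: x.2) ∧ lo t ∧ hi x.2 := by
    refine REPred.exists' (p := fun x : (List Bool × List Bool) × List Bool =>
      (x.1.1 <+: x.2 ∧ x.2 <+: x.1.2) ∧ lo x.2 ∧ hi x.1.2) ?_
    refine REPred.and' ?_ ((rlo.comp' Computable.snd).and'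
      (rhi.comp' (Computable.snd.comp Computable.fst)))
    exact ((PrimrecRel.comp primrecRel_prefix (Primrec.fst.comp Primrec.fst) Primrec.snd).and
      (PrimrecRel.comp primrecRel_prefix Primrec.snd
        (Primrec.snd.comp Primrec.fst))).computablePred.to_re
  -- `D n` holds the strings at which `n` successive passages from a low to a high ratio have been
  -- completed.
  obtain ⟨D, hD, hD0, hDs⟩ := REPred.iterate_rel (R := fun a b => ∃ t, (a <+: t ∧ t <+: b) ∧ lo t ∧ hi b) hR []
  have hstep : ∀ n, (q : ℝ≥0∞) * P.snd (⋃ u ∈ {u | D (n + 1) u}, cyl u)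
      ≤ p * P.snd (⋃ u ∈ {u | D n u}, cyl u) := by
    intro n
    refine measure_upcrossing_le s (c := c) fun u hu => ?_
    obtain ⟨t', ht', t, ⟨h1, h2⟩, h3, h4⟩ := (hDs n u).1 hu
    have conv : ∀ a b : ℕ, ∀ v w, (a : ℝ) * P.real v ≤ b * P.real w →
        (a : ℝ≥0∞) * P v ≤ b * P w := by
      intro a b v w h
      have := ENNReal.ofReal_le_ofReal h
      rwa [ENNReal.ofReal_mul (Nat.cast_nonneg _), ENNReal.ofReal_mul (Nat.cast_nonneg _),
        ENNReal.ofReal_natCast, ENNReal.ofReal_natCast, ofReal_measureReal,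
        ofReal_measureReal] at this
    refine ⟨t', t, ht', h1, h2, ?_, ?_⟩
    · rw [snd_cyl]; exact conv _ _ _ _ h3.le
    · rw [snd_cyl]; exact conv _ _ _ _ h4.le
  have hq : (q : ℝ≥0∞) ≠ 0 := by exact_mod_cast (Nat.zero_le p).trans_lt hpq |>.ne'
  set r : ℝ≥0∞ := p / q with hr
  have hr1 : r < 1 := by
    rw [hr, ENNReal.div_lt_iff (Or.inl hq) (Or.inl (by simp)), one_mul]
    exact_mod_cast hpq
  have hpow : ∀ n, P.snd (⋃ u ∈ {u | D n u}, cyl u) ≤ r ^ n := by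
    intro n
    induction n with
    | zero => simpa using prob_le_one
    | succ n ih =>
      have h1 : P.snd (⋃ u ∈ {u | D (n + 1) u}, cyl u)
          ≤ (p * P.snd (⋃ u ∈ {u | D n u}, cyl u)) / q := by
        rw [ENNReal.le_div_iff_mul_le (Or.inl hq) (Or.inl (by simp)), mul_comm]
        exact hstep n
      refine h1.trans ?_
      rw [pow_succ, mul_comm (r ^ n), hr, ENNReal.mul_div_right_comm]
      gcongr
  obtain ⟨K, hK⟩ : ∃ K, r ^ K ≤ 2⁻¹ := by
    have := ENNReal.tendsto_pow_atTop_nhds_zero_of_lt_one hr1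
    exact (this.eventually_le_const (show (0 : ℝ≥0∞) < 2⁻¹ by simp)).exists
  have hmem : ∀ n, ∃ m, D n (pre y m) := by
    intro n
    induction n with
    | zero => exact ⟨0, (hD0 _).2 (by simp [pre])⟩
    | succ n ih =>
      obtain ⟨m, hm⟩ := ih
      obtain ⟨m₁, h1, h1'⟩ := frequently_atTop.1 hlo m
      obtain ⟨m₂, h2, h2'⟩ := frequently_atTop.1 hhi m₁
      exact ⟨m₂, (hDs _ _).2 ⟨_, hm, pre y m₁, ⟨pre_prefix_pre y h1, pre_prefix_pre y h2⟩,
        h1', h2'⟩⟩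
  -- Every `K` upcrossings at least halve the bound on the measure, so level `n` waits for `n * K`
  -- of them.
  refine hy (Set.mem_sUnion.2 ⟨{y}, ⟨{x | D (x.1 * K) x.2}, ?_, fun n => ?_, fun n => ?_⟩, rfl⟩)
  · rw [isREIn_empty]
    exact hD.comp' (f := fun x : ℕ × List Bool => (x.1 * K, x.2))
      ((Primrec.nat_mul.comp Primrec.fst (Primrec.const K)).pair Primrec.snd).to_comp
  · refine (hpow (n * K)).trans ?_
    rw [mul_comm, pow_mul, ENNReal.inv_pow]
    exact pow_le_pow_left' hK n
  · rintro z rfl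
    obtain ⟨m, hm⟩ := hmem (n * K)
    exact Set.mem_biUnion (x := pre z m) hm (mem_cyl_pre _ _)

theorem condX_real_cyl (P : Measure (Cantor × Cantor)) (s t : List Bool) :
    (condX P t).real (cyl s) = P.real (rect (s, t)) / P.real (rect ([], t)) := by
  rw [Measure.real, condX_apply P t (measurableSet_cyl s), ENNReal.toReal_mul, ENNReal.toReal_inv,
    snd_cyl, div_eq_inv_mul]
  rfl

theorem exists_tendsto_condX [IsProbabilityMeasure P] (hP : IsComputableMeasure ∅ rect P)
    {y : Cantor} (hy : y ∈ hippocratic P.snd) (s : List Bool) :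
    ∃ l : ℝ, Tendsto (fun m => (condX P (pre y m)).real (cyl s)) atTop (𝓝 l) := by
  have hprob := fun m => isProbabilityMeasure_condX (snd_cyl_ne_zero_of_random hy m)
  refine tendsto_of_no_upcrossings (s := Set.range ((↑) : ℚ → ℝ)) Rat.denseRange_cast ?_
    (isBoundedUnder_of ⟨1, fun m => measureReal_le_one⟩)
    (isBoundedUnder_of ⟨0, fun m => measureReal_nonneg⟩)
  rintro _ ⟨a, rfl⟩ _ ⟨b, rfl⟩ hab ⟨hlo, hhi⟩
  have ha : (0 : ℝ) < a := by
    obtain ⟨m, hm⟩ := hlo.exists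
    exact measureReal_nonneg.trans_lt hm
  have hpos : ∀ m, 0 < P.real (rect ([], pre y m)) := by
    intro m
    rw [← snd_real_cyl, measureReal_def]
    exact ENNReal.toReal_pos (snd_cyl_ne_zero_of_random hy m) (measure_ne_top _ _)
  have ha' : (0 : ℚ) < a := by exact_mod_cast ha
  have hb' : (0 : ℚ) < b := ha'.trans (by exact_mod_cast hab)
  have ea : (a : ℝ) = (a.num.toNat : ℝ) / a.den := by
    have : ((a.num.toNat : ℤ) : ℝ) = a.num := by
      rw [Int.toNat_of_nonneg (Rat.num_nonneg.2 ha'.le)]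
    rw [← Int.cast_natCast, this]
    exact_mod_cast (Rat.num_div_den a).symm
  have eb : (b : ℝ) = (b.num.toNat : ℝ) / b.den := by
    have : ((b.num.toNat : ℤ) : ℝ) = b.num := by
      rw [Int.toNat_of_nonneg (Rat.num_nonneg.2 hb'.le)]
    rw [← Int.cast_natCast, this]
    exact_mod_cast (Rat.num_div_den b).symm
  have hda : (0 : ℝ) < a.den := by exact_mod_cast a.pos
  have hdb : (0 : ℝ) < b.den := by exact_mod_cast b.pos
  -- The interval `(a, b)` is brought to the common denominator `c`, so that the comparisons involve
  -- natural multiples only.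
  refine not_frequently_upcrossing hP hy s (c := a.den * b.den) (p := a.num.toNat * b.den)
    (q := b.num.toNat * a.den) ?_ ⟨hlo.mono fun m hm => ?_, hhi.mono fun m hm => ?_⟩
  · rw [ea, eb, div_lt_div_iff₀ hda hdb] at hab
    exact_mod_cast hab
  · rw [condX_real_cyl, ea, div_lt_div_iff₀ (hpos m) hda] at hm
    push_cast
    nlinarith
  · rw [condX_real_cyl, eb, div_lt_div_iff₀ hdb (hpos m)] at hm
    push_cast
    nlinarith

/-- The conditional probability at a random sequence exists. -/
theorem exists_isCondProbAt [IsProbabilityMeasure P] (hP : IsComputableMeasure ∅ rect P)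
    {y : Cantor} (hy : y ∈ hippocratic P.snd) : ∃ ν, IsCondProbAt P y ν := by
  let μ : ℕ → ProbabilityMeasure Cantor := fun m =>
    ⟨condX P (pre y m), isProbabilityMeasure_condX (snd_cyl_ne_zero_of_random hy m)⟩
  -- Compactness gives a limit measure along an ultrafilter. Cylinders are clopen, so their measures
  -- converge along it too, and each value equals the limit along the whole sequence, which is known
  -- to exist.
  let U : Ultrafilter ℕ := Ultrafilter.of atTop
  let ν : ProbabilityMeasure Cantor := (U.map μ).lim
  have hlim : Tendsto μ U (𝓝 ν) := (U.map μ).le_nhds_lim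
  refine ⟨ν, inferInstance, fun s => ?_⟩
  have h1 : Tendsto (fun m => condX P (pre y m) (cyl s)) U (𝓝 ((ν : Measure Cantor) (cyl s))) :=
    ProbabilityMeasure.tendsto_measure_of_null_frontier_of_tendsto' hlim
      (by rw [(isClopen_cyl s).frontier_eq, measure_empty])
  obtain ⟨l, hl⟩ := exists_tendsto_condX hP hy s
  have h2 : Tendsto (fun m => condX P (pre y m) (cyl s)) atTop (𝓝 (ENNReal.ofReal l)) := by
    refine (ENNReal.tendsto_ofReal hl).congr fun m => ?_
    have : IsProbabilityMeasure (condX P (pre y m)) := (μ m).2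
    exact ofReal_measureReal
  rwa [tendsto_nhds_unique h1 (h2.mono_left (Ultrafilter.of_le atTop))]

end Convergence

/-! ### The universal test, and projections of random pairs. -/

section Universal

variable {P : Measure (Cantor × Cantor)}

/-- Division by `P_Y(Δ(t)) ≤ 1` only increases the measure. Thus a test for `condX P t`, put on the
strip over `Δ(t)`, is a test for `P`. -/
theorem prod_cyl_measure_le [IsProbabilityMeasure P] (t : List Bool) {A : Set Cantor}
    (hA : MeasurableSet A) : P (A ×ˢ cyl t) ≤ condX P t A := by
  rw [condX_apply P t hA]
  rcases eq_or_ne (P.snd (cyl t)) 0 with h | h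
  · have : P (A ×ˢ cyl t) = 0 := by
      rw [Measure.snd_apply (measurableSet_cyl t)] at h
      exact measure_mono_null (fun z hz => hz.2) h
    rw [this]
    exact bot_le
  · calc P (A ×ˢ cyl t) = 1 * P (A ×ˢ cyl t) := (one_mul _).symm
      _ ≤ _ := by gcongr; exact ENNReal.one_le_inv.2 prob_le_one

/-- Every point of a random pair is random for the conditional probabilities given the prefixes
of the other one. -/
theorem mem_hippocratic_condX [IsProbabilityMeasure P] {x y : Cantor}
    (h : (x, y) ∈ hippocratic₂ P) (m : ℕ) : x ∈ hippocratic (condX P (pre y m)) := by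
  rintro ⟨A, ⟨W, hW, hWm, hWA⟩, hxA⟩
  rw [isREIn_empty] at hW
  refine h (Set.mem_sUnion.2 ⟨{(x, y)}, ⟨{p | (p.1, p.2.1) ∈ W ∧ p.2.2 = pre y m}, ?_, fun n => ?_,
    fun n => ?_⟩, rfl⟩)
  · rw [isREIn_empty]
    refine (hW.comp' (f := fun p : ℕ × (List Bool × List Bool) => (p.1, p.2.1))
      (Primrec.fst.pair (Primrec.fst.comp Primrec.snd)).to_comp).and' ?_
    exact (Primrec.eq.comp (Primrec.snd.comp Primrec.snd) (Primrec.const (pre y m)) : PrimrecPred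
      fun p : ℕ × (List Bool × List Bool) => p.2.2 = pre y m).computablePred.to_re
  · have : level rect {p : ℕ × (List Bool × List Bool) | (p.1, p.2.1) ∈ W ∧ p.2.2 = pre y m} n
        ⊆ level cyl W n ×ˢ cyl (pre y m) := by
      refine Set.iUnion₂_subset ?_
      rintro ⟨s, t⟩ ⟨hs, rfl⟩
      exact Set.prod_mono (Set.subset_biUnion_of_mem (u := cyl) hs) subset_rfl
    exact (measure_mono this).trans
      ((prod_cyl_measure_le _ (measurableSet_level_cyl _ _)).trans (hWm n))
  · rintro _ rfl
    obtain ⟨s, hs, hx⟩ := Set.mem_iUnion₂.1 (hWA n hxA)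
    exact Set.mem_biUnion (x := (s, pre y m)) ⟨hs, rfl⟩ ⟨hx, mem_cyl_pre _ _⟩

/-- There is a universal test for a computable measure. -/
theorem exists_universal_test [IsProbabilityMeasure P] (hP : IsComputableMeasure ∅ rect P) :
    ∃ W : Set (ℕ × (List Bool × List Bool)), (REPred fun p => p ∈ W) ∧
      (∀ n, P (level rect W n) ≤ (2 ^ n)⁻¹) ∧
      ∀ z, z ∉ hippocratic₂ P → ∀ n, z ∈ level rect W n := by
  have hU : REPred fun p : (ℕ × ℕ) × (List Bool × List Bool) =>
      ((Denumerable.ofNat Nat.Partrec.Code p.1.1).eval (Encodable.encode (p.1.2, p.2))).Dom := by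
    refine Partrec.dom_re (Nat.Partrec.Code.eval_part.comp ((Computable.ofNat _).comp
      (Computable.fst.comp Computable.fst)) (Computable.encode.comp
      ((Computable.snd.comp Computable.fst).pair Computable.snd)))
  obtain ⟨L, hL, mL, eL⟩ := REPred.exists_primrec_list hU
  -- The program with code `e` is allotted measure `2^-(n+1+e)` and is cut off when a stage exceeds
  -- it. Reading it at level `n + e + 2`, at half that amount, makes the strict inequality in `good`
  -- hold at all stages of a genuine test.
  let F : ℕ → ℕ → ℕ → List (List Bool × List Bool) := fun n e k => L (e, n + e + 2) k
  let good : ℕ → ℕ → ℕ → Prop := fun n e k =>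
    ((2 ^ (n + 1 + e) : ℕ) : ℝ) * P.real (⋃ q ∈ F n e k, rect q) < 1
  have hF : Primrec fun x : ((ℕ × (List Bool × List Bool)) × ℕ) × ℕ => F x.1.1.1 x.1.2 x.2 :=
    hL.comp (Primrec.pair (Primrec.snd.comp Primrec.fst) (Primrec.nat_add.comp (Primrec.nat_add.comp
      (Primrec.fst.comp (Primrec.fst.comp Primrec.fst)) (Primrec.snd.comp Primrec.fst))
      (Primrec.const 2))) Primrec.snd
  refine ⟨{p | ∃ e k, p.2 ∈ F p.1 e k ∧ good p.1 e k}, ?_, fun n => ?_, ?_⟩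
  · refine REPred.exists' (p := fun x : (ℕ × (List Bool × List Bool)) × ℕ =>
      ∃ k, x.1.2 ∈ F x.1.1 x.2 k ∧ good x.1.1 x.2 k) (REPred.exists'
      (p := fun x : ((ℕ × (List Bool × List Bool)) × ℕ) × ℕ =>
        x.1.1.2 ∈ F x.1.1.1 x.1.2 x.2 ∧ good x.1.1.1 x.1.2 x.2) (REPred.and' ?_ ?_))
    · have hR : PrimrecRel fun (q : List Bool × List Bool)
          (x : ((ℕ × (List Bool × List Bool)) × ℕ) × ℕ) => q = x.1.1.2 :=
        Primrec.eq.comp Primrec.fst (Primrec.snd.comp (Primrec.fst.comp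
          (Primrec.fst.comp Primrec.snd)))
      exact ((PrimrecRel.comp hR.exists_mem_list hF Primrec.id).of_eq
        fun x => by simp).computablePred.to_re
    · refine ComputableReal.lt_re (ComputableReal.nat_mul
        (hP.computableReal_iUnion_rect.comp hF.to_comp) ?_) ComputableReal.one
      exact (Primrec.two_pow.comp (Primrec.nat_add.comp (Primrec.nat_add.comp (Primrec.fst.comp
        (Primrec.fst.comp Primrec.fst)) (Primrec.const 1)) (Primrec.snd.comp Primrec.fst))).to_comp
  · have hsub : level rect {p : ℕ × (List Bool × List Bool) |
        ∃ e k, p.2 ∈ F p.1 e k ∧ good p.1 e k} n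
        ⊆ ⋃ e, ⋃ k : {k // good n e k}, ⋃ q ∈ F n e k, rect q := by
      refine Set.iUnion₂_subset ?_
      rintro q ⟨e, k, hq, hk⟩
      exact (Set.subset_biUnion_of_mem (u := rect) (show q ∈ {q | q ∈ F n e k} from hq)).trans
        (Set.subset_iUnion_of_subset e (Set.subset_iUnion_of_subset ⟨k, hk⟩ subset_rfl))
    refine (measure_mono hsub).trans ((measure_iUnion_le _).trans ?_)
    rw [← tsum_two_inv_pow_add n]
    refine ENNReal.tsum_le_tsum fun e => ?_
    rw [Directed.measure_iUnion]
    · refine iSup_le fun k => ?_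
      have := ENNReal.ofReal_le_ofReal (le_of_lt k.2)
      rw [ENNReal.ofReal_mul (Nat.cast_nonneg _), ENNReal.ofReal_natCast,
        ofReal_measureReal (measure_ne_top _ _), ENNReal.ofReal_one, mul_comm] at this
      push_cast at this
      rwa [ENNReal.le_inv_iff_mul_le]
    · rintro ⟨k, hk⟩ ⟨k', hk'⟩
      rcases le_total k k' with h | h
      · exact ⟨⟨k', hk'⟩, Set.biUnion_subset_biUnion_left fun q hq => mL _ _ _ h hq, subset_rfl⟩
      · exact ⟨⟨k, hk⟩, subset_rfl, Set.biUnion_subset_biUnion_left fun q hq => mL _ _ _ h hq⟩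
  · intro z hz n
    rw [hippocratic₂, randomSet, Set.notMem_compl_iff] at hz
    obtain ⟨A, ⟨W, hW, hWm, hWA⟩, hzA⟩ := hz
    rw [isREIn_empty] at hW
    obtain ⟨c, hc⟩ := Nat.Partrec.Code.exists_code.1 hW
    have hdom : ∀ p, (c.eval (Encodable.encode p)).Dom ↔ p ∈ W := by
      intro p
      rw [hc]
      simp [Part.assert]
    set e := Encodable.encode c with he
    have hFW : ∀ i, (n + e + 2, i) ∈ W ↔ ∃ k, i ∈ F n e k := by
      intro i
      rw [← hdom, ← eL, he, Denumerable.ofNat_encode]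
    obtain ⟨i, hi, hzi⟩ := Set.mem_iUnion₂.1 (hWA (n + e + 2) hzA)
    obtain ⟨k, hk⟩ := (hFW i).1 hi
    refine Set.mem_biUnion (x := i) ⟨e, k, hk, ?_⟩ hzi
    have h1 : P (⋃ q ∈ F n e k, rect q) ≤ (2 ^ (n + e + 2))⁻¹ :=
      (measure_mono (Set.biUnion_subset_biUnion_left fun q hq => (hFW q).2 ⟨k, hq⟩)).trans (hWm _)
    have h2 : P.real (⋃ q ∈ F n e k, rect q) ≤ (2 ^ (n + e + 2))⁻¹ := by
      have := ENNReal.toReal_mono (by simp) h1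
      simpa [measureReal_def] using this
    have h3 : (0 : ℝ) < 2 ^ (n + 1 + e) := by positivity
    have h4 : (2 : ℝ) ^ (n + e + 2) = 2 ^ (n + 1 + e) * 2 := by rw [← pow_succ]; congr 1; omega
    show ((2 ^ (n + 1 + e) : ℕ) : ℝ) * _ < 1
    push_cast
    calc (2 : ℝ) ^ (n + 1 + e) * P.real (⋃ q ∈ F n e k, rect q)
        ≤ 2 ^ (n + 1 + e) * (2 ^ (n + e + 2))⁻¹ := by gcongr
      _ = 2⁻¹ := by rw [h4]; field_simp
      _ < 1 := by norm_num

/-- The projection of the set of random pairs contains every random sequence of the marginal. -/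
theorem exists_mem_hippocratic₂ [IsProbabilityMeasure P] (hP : IsComputableMeasure ∅ rect P)
    {x : Cantor} (hx : x ∈ hippocratic P.fst) : ∃ y, (x, y) ∈ hippocratic₂ P := by
  by_contra! hcon
  obtain ⟨W, hW, hWm, hWu⟩ := exists_universal_test hP
  obtain ⟨L, hL, mL, eL⟩ :=
    REPred.exists_primrec_list (p := fun p : ℕ × (List Bool × List Bool) => p ∈ W) hW
  -- `V` enumerates the `s` such that the whole strip `Δ(s) × Y` is seen to be covered at a finite
  -- stage. If no pair over `x` is random, compactness of `{x} × Y` puts a prefix of `x` into every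
  -- level.
  let V : Set (ℕ × List Bool) := {p | ∃ N k, ∀ t ∈ strings N, ∃ q ∈ L p.1 k, q.1 <+: p.2 ∧ q.2 <+: t}
  refine hx (Set.mem_sUnion.2 ⟨{x}, ⟨V, ?_, fun n => ?_, fun n => ?_⟩, rfl⟩)
  · rw [isREIn_empty]
    refine REPred.exists' (p := fun y : (ℕ × List Bool) × ℕ => ∃ k, ∀ t ∈ strings y.2,
      ∃ q ∈ L y.1.1 k, q.1 <+: y.1.2 ∧ q.2 <+: t) (REPred.exists'
        (p := fun y : ((ℕ × List Bool) × ℕ) × ℕ => ∀ t ∈ strings y.1.2,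
          ∃ q ∈ L y.1.1.1 y.2, q.1 <+: y.1.1.2 ∧ q.2 <+: t) ?_)
    have h1 : PrimrecRel fun (q : List Bool × List Bool)
        (z : List Bool × (((ℕ × List Bool) × ℕ) × ℕ)) => q.1 <+: z.2.1.1.2 ∧ q.2 <+: z.1 :=
      (PrimrecRel.comp primrecRel_prefix (Primrec.fst.comp Primrec.fst) (Primrec.snd.comp
        (Primrec.fst.comp (Primrec.fst.comp (Primrec.snd.comp Primrec.snd))))).and
        (PrimrecRel.comp primrecRel_prefix (Primrec.snd.comp Primrec.fst)
          (Primrec.fst.comp Primrec.snd))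
    have h2 : PrimrecRel fun (t : List Bool) (y : ((ℕ × List Bool) × ℕ) × ℕ) =>
        ∃ q ∈ L y.1.1.1 y.2, q.1 <+: y.1.1.2 ∧ q.2 <+: t :=
      PrimrecRel.comp h1.exists_mem_list (hL.comp (Primrec.fst.comp (Primrec.fst.comp
        (Primrec.fst.comp Primrec.snd))) (Primrec.snd.comp Primrec.snd)) Primrec.id
    exact (PrimrecRel.comp h2.forall_mem_list (primrec_strings.comp
      (Primrec.snd.comp Primrec.fst)) Primrec.id).computablePred.to_re
  · have hsub : level cyl V n ×ˢ Set.univ ⊆ level rect W n := by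
      rintro ⟨a, b⟩ ⟨ha, -⟩
      obtain ⟨s, ⟨N, k, h⟩, has⟩ := Set.mem_iUnion₂.1 ha
      obtain ⟨q, hq, h1, h2⟩ := h (pre b N) (mem_strings.2 (length_pre _ _))
      exact Set.mem_biUnion (x := q) ((eL n q).2 ⟨k, hq⟩)
        ⟨cyl_anti h1 has, cyl_anti h2 (mem_cyl_pre _ _)⟩
    rw [Measure.fst_apply (measurableSet_level_cyl V n), ← Set.prod_univ]
    exact (measure_mono hsub).trans (hWm n)
  · rw [Set.singleton_subset_iff]
    have hcov : ∀ y, ∃ q, (n, q) ∈ W ∧ x ∈ cyl q.1 ∧ y ∈ cyl q.2 := by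
      intro y
      obtain ⟨q, hq, h⟩ := Set.mem_iUnion₂.1 (hWu (x, y) (hcon y) n)
      exact ⟨q, hq, h⟩
    choose q hqW hqx hqy using hcov
    choose k hk using fun y => (eL n (q y)).1 (hqW y)
    obtain ⟨T, hT⟩ := isCompact_univ.elim_finite_subcover (fun y => cyl (q y).2)
      (fun y => isOpen_cyl _) fun y _ => Set.mem_iUnion.2 ⟨y, hqy y⟩
    set N := T.sup fun y => (q y).2.length with hN
    set M := T.sup fun y => (q y).1.length with hM
    refine Set.mem_biUnion (x := pre x M) ⟨N, T.sup k, fun t ht => ?_⟩ (mem_cyl_pre _ _)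
    obtain ⟨z, hz⟩ := cyl_nonempty t
    obtain ⟨y, hy, hzy⟩ := Set.mem_iUnion₂.1 (hT (Set.mem_univ z))
    refine ⟨q y, mL _ _ _ (Finset.le_sup hy) (hk y), prefix_pre_iff.2 ⟨hqx y, ?_⟩,
      prefix_of_mem_cyl hzy hz ?_⟩
    · exact Finset.le_sup (f := fun y => (q y).1.length) hy
    · rw [mem_strings.1 ht]
      exact Finset.le_sup (f := fun y => (q y).2.length) hy

end Universal

/-! ### Singular conditional probabilities have disjoint random sets. -/

section Singular

variable {P : Measure (Cantor × Cantor)}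

/-- Uniformization: an enumerable relation that is total contains the graph of a computable
function. -/
theorem REPred.exists_computable_choice {α β : Type*} [Primcodable α] [Primcodable β]
    {p : α × β → Prop} (hp : REPred p) (h : ∀ a, ∃ b, p (a, b)) :
    ∃ g : α → β, Computable g ∧ ∀ a, p (a, g a) := by
  classical
  obtain ⟨L, hL, -, eL⟩ := hp.exists_primrec_list
  have hex : ∀ a, ∃ k, (L a k).head?.isSome = true := by
    intro a
    obtain ⟨b, hb⟩ := h a
    obtain ⟨k, hk⟩ := (eL a b).1 hb
    exact ⟨k, by
      rw [List.isSome_head?]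
      simpa using List.ne_nil_of_mem hk⟩
  have hhead : Primrec fun x : α × ℕ => (L x.1 x.2).head? := Primrec.list_head?.comp hL
  have hc : Computable fun a => (L a (Nat.find (hex a))).head? :=
    hhead.to_comp.comp (Computable.id.pair (Computable.find (P := fun a k =>
      (L a k).head?.isSome = true)
      ((Primrec.primrecPred ((Primrec.option_isSome.comp hhead).of_eq fun x => by
        rw [Bool.decide_eq_true]) : PrimrecPred
        fun x : α × ℕ => (L x.1 x.2).head?.isSome = true).computablePred) hex))
  have hs := fun a => Option.isSome_iff_exists.1 (Nat.find_spec (hex a))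
  choose g hg using hs
  refine ⟨g, Computable.option_some_iff.1 (hc.of_eq hg), fun a =>
    (eL a _).2 ⟨Nat.find (hex a), List.mem_of_mem_head? (hg a)⟩⟩

/-- Singular measures are separated, up to a small error, by a finite union of cylinders. -/
theorem exists_biUnion_cyl_of_mutuallySingular {μ ν : Measure Cantor} [IsFiniteMeasure μ]
    [IsFiniteMeasure ν] (h : μ ⟂ₘ ν) {ε : ℝ≥0∞} (hε : ε ≠ 0) :
    ∃ l : List (List Bool), μ (⋃ s ∈ l, cyl s)ᶜ < ε ∧ ν (⋃ s ∈ l, cyl s) < ε := by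
  obtain ⟨S, hS, hμ, hν⟩ := h
  -- Inner regularity of `μ` gives a compact `K` that is null for `ν`, outer regularity of `ν` a
  -- small open neighbourhood of `K`, and compactness finitely many cylinders in between.
  obtain ⟨K, hKS, hK, hKm⟩ := hS.compl.exists_isCompact_sdiff_lt (measure_ne_top μ _) hε
  have hK0 : ν K < ε := by
    rw [measure_mono_null hKS hν]; exact pos_iff_ne_zero.2 hε
  obtain ⟨U, hKU, hU, hUε⟩ := K.exists_isOpen_lt_of_lt ε hK0
  choose! m hm using fun z (hz : z ∈ K) => exists_cyl_subset hU (hKU hz)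
  obtain ⟨T, hTK, hT⟩ := hK.elim_nhds_subcover (fun z => cyl (pre z (m z)))
    fun z _ => (isOpen_cyl _).mem_nhds (mem_cyl_pre _ _)
  have e : ⋃ s ∈ T.toList.map fun z => pre z (m z), cyl s = ⋃ z ∈ T, cyl (pre z (m z)) := by
    ext; simp
  refine ⟨T.toList.map fun z => pre z (m z), ?_, ?_⟩
  · rw [e]
    have hsub : (⋃ z ∈ T, cyl (pre z (m z)))ᶜ ⊆ S ∪ (Sᶜ \ K) := by
      intro z hz
      by_cases hzS : z ∈ S
      · exact Or.inl hzS
      · exact Or.inr ⟨hzS, fun hzK => hz (hT hzK)⟩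
    calc _ ≤ μ (S ∪ (Sᶜ \ K)) := measure_mono hsub
      _ ≤ μ S + μ (Sᶜ \ K) := measure_union_le _ _
      _ < ε := by rwa [hμ, zero_add]
  · rw [e]
    exact (measure_mono (Set.iUnion₂_subset fun z hz => hm z (hTK z hz))).trans_lt hUε

theorem prod_compl_cyl_real [IsFiniteMeasure P] (t : List Bool) {A : Set Cantor}
    (hA : MeasurableSet A) :
    P.real (Aᶜ ×ˢ cyl t) + P.real (A ×ˢ cyl t) = P.real (rect ([], t)) := by
  rw [← measureReal_union ?_ (hA.prod (measurableSet_cyl t)), ← Set.union_prod, Set.compl_union_self]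
  · simp [rect]
  · exact Set.disjoint_prod.2 (Or.inl disjoint_compl_left)

theorem condX_le_of_real_lt [IsProbabilityMeasure P] {t : List Bool}
    {A : Set Cantor} (hA : MeasurableSet A) {n : ℕ}
    (h : ((2 ^ n : ℕ) : ℝ) * P.real (A ×ˢ cyl t) < 1) :
    condX P t A ≤ (P.snd (cyl t))⁻¹ * (2 ^ n)⁻¹ := by
  rw [condX_apply P t hA]
  gcongr
  have := ENNReal.ofReal_le_ofReal h.le
  rw [ENNReal.ofReal_mul (Nat.cast_nonneg _), ENNReal.ofReal_natCast,
    ofReal_measureReal (measure_ne_top _ _), ENNReal.ofReal_one, mul_comm] at this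
  push_cast at this
  rwa [ENNReal.le_inv_iff_mul_le]

/-- Mutually singular conditional probabilities have no common random sequence. -/
theorem hippocratic_inter_eq_empty [IsProbabilityMeasure P] (hP : IsComputableMeasure ∅ rect P)
    {s t : List Bool} (hs : P.snd (cyl s) ≠ 0) (ht : P.snd (cyl t) ≠ 0)
    (h : condX P s ⟂ₘ condX P t) : hippocratic (condX P s) ∩ hippocratic (condX P t) = ∅ := by
  have := isProbabilityMeasure_condX hs
  have := isProbabilityMeasure_condX ht
  -- With `A` the union of the cylinders in the list, the first conjunct says `P(Aᶜ × Δ(s)) < 2⁻ⁿ`.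
  -- It is written without subtraction, so that both sides are nonnegative computable reals.
  let R : ℕ × List (List Bool) → Prop := fun x =>
    ((2 ^ x.1 : ℕ) : ℝ) * P.real (rect ([], s))
      < 1 + ((2 ^ x.1 : ℕ) : ℝ) * P.real (⋃ q ∈ x.2.map fun v => (v, s), rect q) ∧
    ((2 ^ x.1 : ℕ) : ℝ) * P.real (⋃ q ∈ x.2.map fun v => (v, t), rect q) < 1
  have h2 : Computable fun x : ℕ × List (List Bool) => 2 ^ x.1 :=
    (Primrec.two_pow.comp Primrec.fst).to_comp
  have hl : ∀ r : List Bool, ComputableReal fun x : ℕ × List (List Bool) =>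
      ((2 ^ x.1 : ℕ) : ℝ) * P.real (⋃ q ∈ x.2.map fun v => (v, r), rect q) := fun r =>
    (hP.computableReal_iUnion_rect.comp (f := fun x : ℕ × List (List Bool) =>
      x.2.map fun v => (v, r)) (Primrec.list_map Primrec.snd (Primrec.snd.pair
        (Primrec.const r)).to₂).to_comp).nat_mul h2
  have hR : REPred R :=
    (((hP.computableReal_rect.comp (Computable.const ([], s))).nat_mul h2).lt_re
      (ComputableReal.one.add (hl s))).and' ((hl t).lt_re ComputableReal.one)
  obtain ⟨g, hg, hgR⟩ := hR.exists_computable_choice (fun n => by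
    obtain ⟨l, hl1, hl2⟩ := exists_biUnion_cyl_of_mutuallySingular h
      (ε := (2 ^ n)⁻¹) (by simp)
    have key : ∀ (r : List Bool) (A : Set Cantor), MeasurableSet A →
        condX P r A < (2 ^ n)⁻¹ → ((2 ^ n : ℕ) : ℝ) * P.real (A ×ˢ cyl r) < 1 := by
      intro r A hA hlt
      have h1 := (ENNReal.toReal_lt_toReal (measure_ne_top _ _) (by simp)).2
        ((prod_cyl_measure_le r hA).trans_lt hlt)
      rw [ENNReal.toReal_inv, ENNReal.toReal_pow, ENNReal.toReal_ofNat, inv_eq_one_div,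
        lt_div_iff₀ (by positivity), mul_comm] at h1
      exact_mod_cast h1
    have hm := measurableSet_biUnion_cyl l
    refine ⟨l, ?_, ?_⟩
    · have h1 := key s _ hm.compl hl1
      have h2 := prod_compl_cyl_real (P := P) s hm
      dsimp only
      rw [iUnion_rect_map, ← h2]
      linarith
    · dsimp only
      rw [iUnion_rect_map]
      exact key t _ hm hl2)
  rw [Set.eq_empty_iff_forall_notMem]
  rintro x ⟨hxs, hxt⟩
  have lev₁ : ∀ n, level cyl {p : ℕ × List Bool | p.2 ∈ g p.1} n = ⋃ v ∈ g n, cyl v := fun n => rfl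
  -- The complement of the clopen set is enumerated by the strings incompatible with every string of
  -- `g n`. A point outside has such a prefix as soon as its length reaches that of all strings of
  -- `g n`.
  have lev₂ : ∀ n, level cyl {p : ℕ × List Bool | ∀ v ∈ g p.1, ¬ v <+: p.2 ∧ ¬ p.2 <+: v} n
      = (⋃ v ∈ g n, cyl v)ᶜ := by
    intro n
    ext z
    simp only [level, Set.mem_iUnion, Set.mem_ofPred_eq, exists_prop, Set.mem_compl_iff, not_exists,
      not_and]
    constructor
    · rintro ⟨u, hu, hzu⟩ v hv hzv
      exact Set.disjoint_left.1 (disjoint_cyl (hu v hv).1 (hu v hv).2) hzv hzu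
    · intro hz
      set N := ((g n).map List.length).sum
      refine ⟨pre z N, fun v hv => ⟨fun hp => hz v hv (prefix_pre_iff.1 hp).1, fun hp => ?_⟩,
        mem_cyl_pre _ _⟩
      have hle : v.length ≤ N := List.single_le_sum (by simp) _ (List.mem_map.2 ⟨v, hv, rfl⟩)
      have := hp.eq_of_length (le_antisymm hp.length_le (by simpa using hle))
      exact hz v hv (this ▸ mem_cyl_pre _ _)
  have hgm : ∀ n, MeasurableSet (⋃ v ∈ g n, cyl v) := fun n => measurableSet_biUnion_cyl _
  obtain ⟨N₁, hN₁⟩ := randomSet.eventually_notMem hxt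
    (W := {p : ℕ × List Bool | p.2 ∈ g p.1}) (by
      have hp : PrimrecPred fun y : List (List Bool) × List Bool => ∃ v ∈ y.1, v = y.2 :=
        PrimrecRel.exists_mem_list (R := fun v u : List Bool => v = u) Primrec.eq
      exact (hp.computablePred.to_re.comp' (f := fun p : ℕ × List Bool => (g p.1, p.2))
        ((hg.comp Computable.fst).pair Computable.snd)).of_eq fun p => by simp)
    (C := (P.snd (cyl t))⁻¹) (ENNReal.inv_ne_top.2 ht) (fun n => by
      rw [lev₁]
      refine condX_le_of_real_lt (hgm n) ?_
      have := (hgR n).2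
      dsimp only at this
      rwa [iUnion_rect_map] at this)
  obtain ⟨N₂, hN₂⟩ := randomSet.eventually_notMem hxs
    (W := {p : ℕ × List Bool | ∀ v ∈ g p.1, ¬ v <+: p.2 ∧ ¬ p.2 <+: v}) (by
      have hp : PrimrecPred fun y : List (List Bool) × List Bool =>
          ∀ v ∈ y.1, ¬ v <+: y.2 ∧ ¬ y.2 <+: v :=
        PrimrecRel.forall_mem_list (R := fun v u : List Bool => ¬ v <+: u ∧ ¬ u <+: v)
          (primrecRel_prefix.not.and (PrimrecRel.comp primrecRel_prefix
            Primrec.snd Primrec.fst).not)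
      exact hp.computablePred.to_re.comp' (f := fun p : ℕ × List Bool => (g p.1, p.2))
        ((hg.comp Computable.fst).pair Computable.snd))
    (C := (P.snd (cyl s))⁻¹) (ENNReal.inv_ne_top.2 hs) (fun n => by
      rw [lev₂]
      refine condX_le_of_real_lt (hgm n).compl ?_
      have h1 := (hgR n).1
      dsimp only at h1
      have h2 := prod_compl_cyl_real (P := P) s (hgm n)
      rw [iUnion_rect_map, ← h2] at h1
      linarith)
  -- At a common late index, `x` would have to avoid both a set and its complement.
  have h1 := hN₁ (max N₁ N₂) (le_max_left _ _)
  have h2 := hN₂ (max N₁ N₂) (le_max_right _ _)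
  rw [lev₁] at h1
  rw [lev₂] at h2
  exact h2 h1

end Singular

/-! ### Reduction of the conditions to mutual singularity. -/

section Conditions

variable {P : Measure (Cantor × Cantor)}

/-- The random set of any measure has full measure, so the two disjoint random sets separate the
measures. -/
theorem DisjointRandomCylinders.singCylinders (h : DisjointRandomCylinders P) :
    SingCylinders P := by
  intro s t hs ht hd
  refine Measure.MutuallySingular.mk (measure_compl_randomSet cyl _)
    (measure_compl_randomSet cyl _) fun x _ => ?_
  rw [← Set.compl_inter]
  intro hx
  have h' : x ∈ hippocratic (condX P s) ∩ hippocratic (condX P t) := hx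
  rw [h s t hs ht hd] at h'
  exact h'

/-- The posteriors along `x` do not depend on the second coordinate and have only one limit. A
coordinate in which `y` and `z` differ serves as the test function. -/
theorem PosteriorConsistent.disjointSections (h : PosteriorConsistent P) :
    DisjointSections P := by
  intro y z hyz
  rw [Set.eq_empty_iff_forall_notMem]
  rintro x ⟨hy, hz⟩
  obtain ⟨i, hi⟩ := Function.ne_iff.1 hyz
  let g : Cantor →ᵇ ℝ := BoundedContinuousFunction.mkOfCompact
    ⟨fun w => if w i then 1 else 0, (continuous_of_discreteTopology (f := fun b : Bool =>
      if b then (1 : ℝ) else 0)).comp (continuous_apply i)⟩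
  have e := tendsto_nhds_unique (h x y hy g) (h x z hz g)
  rw [integral_dirac, integral_dirac] at e
  apply hi
  have e' : (if y i then (1 : ℝ) else 0) = if z i then (1 : ℝ) else 0 := e
  cases hyi : y i <;> cases hzi : z i <;> simp [hyi, hzi] at e' ⊢

theorem RandomEstimator.disjointSections (h : RandomEstimator P) : DisjointSections P := by
  obtain ⟨f, hf⟩ := h
  intro y z hyz
  rw [Set.eq_empty_iff_forall_notMem]
  rintro x ⟨hy, hz⟩
  exact hyz ((hf x y hy).symm.trans (hf x z hz))

theorem isOpen_level_rect (W : Set (ℕ × (List Bool × List Bool))) (n : ℕ) :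
    IsOpen (level rect W n) :=
  isOpen_biUnion fun _ _ => isOpen_rect _

/-- The projection of the random pairs over `Δ(t)` is the natural carrier of `condX P t`. The
complements of the levels of a universal test are compact and consist of random pairs, so projecting
them instead gives a measurable carrier `B t`. -/
theorem DisjointSections.singCylinders [IsProbabilityMeasure P] (hP : IsComputableMeasure ∅ rect P)
    (h : DisjointSections P) : SingCylinders P := by
  obtain ⟨W, -, hWm, hWu⟩ := exists_universal_test hP
  let B : List Bool → Set Cantor := fun t =>
    ⋃ n, Prod.fst '' ((level rect W n)ᶜ ∩ Prod.snd ⁻¹' cyl t)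
  have hBm : ∀ t, MeasurableSet (B t) := fun t => MeasurableSet.iUnion fun n =>
    ((((isOpen_level_rect W n).isClosed_compl.inter
      ((isClopen_cyl t).isClosed.preimage continuous_snd)).isCompact).image
        continuous_fst).measurableSet
  have hB0 : ∀ t, condX P t (B t)ᶜ = 0 := by
    intro t
    rw [condX_apply P t (hBm t).compl]
    refine mul_eq_zero_of_right _ (le_antisymm (ge_of_tendsto' (x := atTop)
      (f := fun n : ℕ => ((2 : ℝ≥0∞) ^ n)⁻¹) ?_ fun n => (measure_mono ?_).trans (hWm n)) bot_le)
    · simp_rw [ENNReal.inv_pow]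
      exact ENNReal.tendsto_pow_atTop_nhds_zero_of_lt_one (by simp)
    · rintro ⟨a, b⟩ ⟨ha, hb⟩
      by_contra hab
      exact ha (Set.mem_iUnion.2 ⟨n, (a, b), ⟨hab, hb⟩, rfl⟩)
  intro s t hs ht hd
  refine Measure.MutuallySingular.mk (hB0 s) (hB0 t) fun x _ => ?_
  rw [← Set.compl_inter]
  rintro ⟨hxs, hxt⟩
  obtain ⟨n, ⟨_, y⟩, ⟨hy, hys⟩, rfl⟩ := Set.mem_iUnion.1 hxs
  obtain ⟨n', ⟨x, z⟩, ⟨hz, hzt⟩, e⟩ := Set.mem_iUnion.1 hxt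
  dsimp only at e
  subst e
  have hne : y ≠ z := by
    rintro rfl
    exact Set.disjoint_left.1 hd hys hzt
  have hmem : x ∈ randomSection P y ∩ randomSection P z :=
    ⟨by_contra fun hc => hy (hWu _ hc n), by_contra fun hc => hz (hWu _ hc n')⟩
  rw [h y z hne] at hmem
  exact hmem

theorem measurable_comp_pre {β : Type*} [MeasurableSpace β] (g : List Bool → β) (m : ℕ) :
    Measurable fun y : Cantor => g (pre y m) := by
  let _ : MeasurableSpace (List Bool) := ⊤
  have h : Measurable fun y : Cantor => pre y m := by
    refine measurable_to_countable' fun u => ?_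
    by_cases hu : u.length = m
    · have : (fun y : Cantor => pre y m) ⁻¹' {u} = cyl u := by
        ext y; simp [mem_cyl_iff, hu]
      rw [this]
      exact measurableSet_cyl u
    · have : (fun y : Cantor => pre y m) ⁻¹' {u} = ∅ := by
        ext y
        simp only [Set.mem_preimage, Set.mem_singleton_iff, Set.mem_empty_iff_false, iff_false]
        rintro rfl
        exact hu (length_pre _ _)
      rw [this]
      exact MeasurableSet.empty
  exact measurable_from_top.comp h

/-- The conditional probabilities given the prefixes of length `m` disintegrate `P` over the
cylinders of length at most `m`. -/
theorem setLIntegral_condX [IsProbabilityMeasure P] (s : List Bool) {t : List Bool} {m : ℕ}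
    (hm : t.length ≤ m) :
    ∫⁻ y in cyl t, condX P (pre y m) (cyl s) ∂P.snd = P (rect (s, t)) := by
  set ρ := P.snd.withDensity fun y => condX P (pre y m) (cyl s) with hρ
  set σ := (P.restrict (cyl s ×ˢ Set.univ)).snd with hσ
  have hcyl : ∀ u : List Bool, u.length = m → ρ (cyl u) = σ (cyl u) := by
    intro u hu
    rw [hρ, withDensity_apply _ (measurableSet_cyl u), hσ, restrict_snd_cyl]
    rw [setLIntegral_congr_fun (g := fun _ => condX P u (cyl s)) (measurableSet_cyl u)
      (fun y hy => by
        dsimp only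
        rw [mem_cyl_iff, hu] at hy
        rw [hy]), setLIntegral_const, condX_apply P u (measurableSet_cyl s)]
    rcases eq_or_ne (P.snd (cyl u)) 0 with h | h
    · rw [h, mul_zero]
      rw [Measure.snd_apply (measurableSet_cyl u)] at h
      exact (measure_mono_null (fun z hz => hz.2) h).symm
    · rw [mul_comm, ← mul_assoc, ENNReal.mul_inv_cancel h (measure_ne_top _ _), one_mul]
      rfl
  have hcov : cyl t = ⋃ u ∈ {u | u.length = m ∧ t <+: u}, cyl u := by
    refine subset_antisymm (fun z hz => ?_) (Set.iUnion₂_subset fun u hu => cyl_anti hu.2)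
    exact Set.mem_biUnion (x := pre z m) ⟨length_pre _ _, prefix_pre_iff.2 ⟨hz, hm⟩⟩
      (mem_cyl_pre _ _)
  -- Both measures agree on the strings of length `m`, and `Δ(t)` is a union of such cylinders; the
  -- comparison on minimal strings applies in both directions.
  have : ρ (cyl t) = σ (cyl t) := by
    rw [hcov]
    exact le_antisymm (measure_iUnion_cyl_mono fun u hu => (hcyl u hu.1.1).le)
      (measure_iUnion_cyl_mono fun u hu => (hcyl u hu.1.1).ge)
  rwa [hρ, withDensity_apply _ (measurableSet_cyl t), hσ, restrict_snd_cyl] at this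

/-- The conditional probabilities at points agree almost surely with the abstract conditional
distribution of the first coordinate given the second one. -/
theorem ae_condKernel_eq [IsProbabilityMeasure P] {Y' : Set Cantor} (hY : ∀ᵐ y ∂P.snd, y ∈ Y')
    {ν : Cantor → Measure Cantor} (hν : ∀ y ∈ Y', IsCondProbAt P y (ν y)) :
    ∀ᵐ y ∂P.snd, (P.map Prod.swap).condKernel y = ν y := by
  have hfst : (P.map Prod.swap).fst = P.snd := Measure.fst_map_swap
  have : IsProbabilityMeasure (P.map Prod.swap) :=
    Measure.isProbabilityMeasure_map measurable_swap.aemeasurable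
  have hle : ∀ m s, ∀ y, condX P (pre y m) (cyl s) ≤ 1 := by
    intro m s y
    rcases eq_or_ne (P.snd (cyl (pre y m))) 0 with h | h
    · rw [condX, ProbabilityTheory.cond_eq_zero_of_meas_eq_zero]
      · simp
      · rwa [← Measure.snd_apply (measurableSet_cyl _)]
    · have := isProbabilityMeasure_condX h
      exact prob_le_one
  have key : ∀ s, ∀ᵐ y ∂P.snd, (P.map Prod.swap).condKernel y (cyl s) = ν y (cyl s) := by
    intro s
    set g : Cantor → ℝ≥0∞ := fun y => (P.map Prod.swap).condKernel y (cyl s) with hg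
    have hgm : Measurable g := Kernel.measurable_coe _ (measurableSet_cyl s)
    -- The lower limit is measurable on the whole space and equals `ν y (cyl s)` on `Y'`. No
    -- measurability of `ν` in `y` is given.
    set h : Cantor → ℝ≥0∞ := fun y => liminf (fun m => condX P (pre y m) (cyl s)) atTop with hh
    have hhm : Measurable h := .liminf fun m => measurable_comp_pre (fun u => condX P u (cyl s)) m
    have hlim : ∀ᵐ y ∂P.snd, Tendsto (fun m => condX P (pre y m) (cyl s)) atTop (𝓝 (h y)) := by
      filter_upwards [hY] with y hy
      have := (hν y hy).2 s
      rw [hh]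
      dsimp only
      rwa [this.liminf_eq]
    have hset : ∀ t, ∫⁻ y in cyl t, h y ∂P.snd = P (rect (s, t)) := by
      intro t
      refine tendsto_nhds_unique (tendsto_lintegral_of_dominated_convergence
        (μ := P.snd.restrict (cyl t)) (fun _ => 1)
        (fun m => measurable_comp_pre (fun u => condX P u (cyl s)) m)
        (fun m => ae_of_all _ (hle m s)) (by simp) (ae_restrict_of_ae hlim)) ?_
      refine tendsto_const_nhds.congr' ?_
      filter_upwards [eventually_ge_atTop t.length] with m hm
      exact (setLIntegral_condX s hm).symm
    have hset' : ∀ t, ∫⁻ y in cyl t, g y ∂P.snd = P (rect (s, t)) := by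
      intro t
      have := Measure.setLIntegral_condKernel_eq_measure_prod (ρ := P.map Prod.swap)
        (measurableSet_cyl t) (measurableSet_cyl s)
      rw [hfst] at this
      rw [hg, this, Measure.map_apply measurable_swap
        ((measurableSet_cyl t).prod (measurableSet_cyl s)), Set.preimage_swap_prod]
      rfl
    have hu : ∀ f : Cantor → ℝ≥0∞, (∀ t, ∫⁻ y in cyl t, f y ∂P.snd = P (rect (s, t))) →
        ∫⁻ y, f y ∂P.snd = P (rect (s, [])) := by
      intro f hf
      have := hf []
      rwa [cyl_nil, setLIntegral_univ] at this
    -- The integrals over cylinders determine the density almost everywhere. For `h` they come from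
    -- dominated convergence, the approximating integrals being constant once `m` reaches the length
    -- of `t`.
    have e : P.snd.withDensity g = P.snd.withDensity h := by
      have : IsFiniteMeasure (P.snd.withDensity g) :=
        isFiniteMeasure_withDensity (by rw [hu g hset']; exact measure_ne_top _ _)
      refine ext_of_generate_finite _ generateFrom_cyl isPiSystem_cyl ?_ ?_
      · rintro _ ⟨t, rfl⟩
        rw [withDensity_apply _ (measurableSet_cyl t), withDensity_apply _ (measurableSet_cyl t),
          hset, hset']
      · rw [withDensity_apply _ .univ, withDensity_apply _ .univ, setLIntegral_univ,
          setLIntegral_univ, hu g hset', hu h hset]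
    have e' := (withDensity_eq_iff hgm.aemeasurable hhm.aemeasurable
      (by rw [hu g hset']; exact measure_ne_top _ _)).1 e
    filter_upwards [e', hY] with y hy hyY
    exact hy.trans ((hν y hyY).2 s).liminf_eq
  filter_upwards [ae_all_iff.2 key, hY] with y hy hyY
  have := (hν y hyY).1
  refine ext_of_generate_finite _ generateFrom_cyl isPiSystem_cyl ?_ (by simp)
  rintro _ ⟨s, rfl⟩
  exact hy s

/-- Given `Δ(t)`, the first coordinate lies almost surely in `f⁻¹(Δ(t))`: disintegrate `P` over the
second coordinate and use `f = y` for `P(· | y)`. Disjoint cylinders have disjoint preimages. -/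
theorem AlmostSureEstimator.singCylinders [IsProbabilityMeasure P] (h : AlmostSureEstimator P) :
    SingCylinders P := by
  obtain ⟨f, hf, Y', hY'm, hY', hν⟩ := h
  have hY : ∀ᵐ y ∂P.snd, y ∈ Y' := (prob_compl_eq_zero_iff hY'm).2 hY'
  choose! ν hν using hν
  have hae := ae_condKernel_eq hY fun y hy => (hν y hy).1
  have : IsProbabilityMeasure (P.map Prod.swap) :=
    Measure.isProbabilityMeasure_map measurable_swap.aemeasurable
  have hzero : ∀ t, condX P t (f ⁻¹' cyl t)ᶜ = 0 := by
    intro t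
    have hA : MeasurableSet (f ⁻¹' cyl t)ᶜ := (hf (measurableSet_cyl t)).compl
    rw [condX_apply P t hA]
    refine mul_eq_zero_of_right _ ?_
    have h1 := Measure.setLIntegral_condKernel_eq_measure_prod (ρ := P.map Prod.swap)
      (measurableSet_cyl t) hA
    rw [Measure.fst_map_swap, Measure.map_apply measurable_swap
      ((measurableSet_cyl t).prod hA), Set.preimage_swap_prod] at h1
    rw [← h1]
    refine (setLIntegral_congr_fun_ae (g := fun _ => 0) (measurableSet_cyl t) ?_).trans (by simp)
    filter_upwards [hae, hY] with y hy hyY hyt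
    rw [hy]
    refine measure_mono_null (fun x hx => ?_) (hν y hyY).2
    intro he
    exact hx (show f x ∈ cyl t from he ▸ hyt)
  intro s t _ _ hd
  refine Measure.MutuallySingular.mk (hzero s) (hzero t) fun x _ => ?_
  rw [← Set.compl_inter]
  rintro ⟨hs, ht⟩
  exact Set.disjoint_left.1 hd hs ht

end Conditions

/-! ### The use principle for oracle computations. -/

section UsePrinciple

/-- `F` computes `f` from longer and longer prefixes of the oracle `y`. -/
structure IsPrefixApprox (y : Cantor) (f : ℕ → Part ℕ) (F : List Bool → ℕ → Part ℕ) : Prop where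
  partrec : Partrec₂ (σ := ℕ) F
  mono : ∀ {t t' n v}, t <+: t' → v ∈ F t n → v ∈ F t' n
  mem_iff : ∀ {n v}, v ∈ f n ↔ ∃ m, v ∈ F (pre y m) n

/-- An unbounded search consults finitely many earlier values; this provides one oracle prefix that
suffices for all of them. -/
theorem exists_forall_lt_of_mono {Q : ℕ → ℕ → Prop} (hQ : ∀ {m m' k}, m ≤ m' → Q m k → Q m' k)
    {n : ℕ} (h : ∀ k < n, ∃ m, Q m k) : ∃ m, ∀ k < n, Q m k := by
  choose! m hm using h
  exact ⟨(Finset.range n).sup m, fun k hk => hQ (Finset.le_sup (Finset.mem_range.2 hk)) (hm k hk)⟩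

theorem IsPrefixApprox.of_partrec {y : Cantor} {f : ℕ →. ℕ} (hf : Nat.Partrec f) :
    IsPrefixApprox y f fun _ => f :=
  ⟨(Partrec.nat_iff.2 hf).comp Computable.snd, fun _ h => h, fun {_ _} => by simp⟩

theorem IsPrefixApprox.oracle (y : Cantor) :
    IsPrefixApprox y (fun n => Part.some (y n).toNat)
      fun t n => ((t[n]?).map Bool.toNat : Option ℕ) := by
  refine ⟨?_, ?_, ?_⟩
  · exact Computable.ofOption (Primrec.option_map (Primrec.list_getElem?)
      ((Primrec.dom_finite Bool.toNat).comp Primrec.snd).to₂).to_comp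
  · rintro t t' n v ⟨r, rfl⟩ h
    simp only [Part.mem_coe, Option.mem_def, Option.map_eq_some_iff] at h ⊢
    obtain ⟨b, hb, rfl⟩ := h
    exact ⟨b, by rw [List.getElem?_append_left (List.getElem?_eq_some_iff.1 hb).1]; exact hb, rfl⟩
  · intro n v
    simp only [Part.mem_some_iff, Part.mem_coe, Option.mem_def, Option.map_eq_some_iff]
    constructor
    · rintro rfl
      exact ⟨n + 1, y n, by simp [pre], rfl⟩
    · rintro ⟨m, b, hb, rfl⟩
      obtain ⟨h1, h2⟩ := List.getElem?_eq_some_iff.1 hb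
      simp only [pre, List.getElem_map, List.getElem_range] at h2
      rw [h2]

theorem IsPrefixApprox.pair {y : Cantor} {f h : ℕ → Part ℕ} {F H : List Bool → ℕ → Part ℕ}
    (hF : IsPrefixApprox y f F) (hH : IsPrefixApprox y h H) :
    IsPrefixApprox y (fun n => Nat.pair <$> f n <*> h n)
      fun t n => (F t n).bind fun a => (H t n).map (Nat.pair a) := by
  refine ⟨?_, ?_, ?_⟩
  · exact Partrec.bind hF.partrec (Partrec.map (hH.partrec.comp (Computable.fst.comp Computable.fst)
      (Computable.snd.comp Computable.fst)) (Primrec₂.natPair.to_comp.comp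
        (Computable.snd.comp Computable.fst) Computable.snd).to₂)
  · intro t t' n v ht h
    simp only [Part.mem_bind_iff, Part.mem_map_iff] at h ⊢
    obtain ⟨a, ha, b, hb, rfl⟩ := h
    exact ⟨a, hF.mono ht ha, b, hH.mono ht hb, rfl⟩
  · intro n v
    simp only [Seq.seq, Part.map_eq_map, Part.mem_bind_iff, Part.mem_map_iff,
      exists_exists_and_eq_and]
    constructor
    · rintro ⟨a, ha, b, hb, rfl⟩
      obtain ⟨m, hm⟩ := hF.mem_iff.1 ha
      obtain ⟨m', hm'⟩ := hH.mem_iff.1 hb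
      exact ⟨max m m', a, hF.mono (pre_prefix_pre y (le_max_left _ _)) hm, b,
        hH.mono (pre_prefix_pre y (le_max_right _ _)) hm', rfl⟩
    · rintro ⟨m, a, ha, b, hb, rfl⟩
      exact ⟨a, hF.mem_iff.2 ⟨m, ha⟩, b, hH.mem_iff.2 ⟨m, hb⟩, rfl⟩

theorem IsPrefixApprox.comp {y : Cantor} {f h : ℕ → Part ℕ} {F H : List Bool → ℕ → Part ℕ}
    (hF : IsPrefixApprox y f F) (hH : IsPrefixApprox y h H) :
    IsPrefixApprox y (fun n => h n >>= f) fun t n => (H t n).bind (F t) := by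
  refine ⟨?_, ?_, ?_⟩
  · exact Partrec.bind hH.partrec (hF.partrec.comp (Computable.fst.comp Computable.fst)
      Computable.snd).to₂
  · intro t t' n v ht h
    simp only [Part.mem_bind_iff] at h ⊢
    obtain ⟨a, ha, hv⟩ := h
    exact ⟨a, hH.mono ht ha, hF.mono ht hv⟩
  · intro n v
    simp only [Part.bind_eq_bind, Part.mem_bind_iff]
    constructor
    · rintro ⟨a, ha, hv⟩
      obtain ⟨m, hm⟩ := hH.mem_iff.1 ha
      obtain ⟨m', hm'⟩ := hF.mem_iff.1 hv
      exact ⟨max m m', a, hH.mono (pre_prefix_pre y (le_max_left _ _)) hm,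
        hF.mono (pre_prefix_pre y (le_max_right _ _)) hm'⟩
    · rintro ⟨m, a, ha, hv⟩
      exact ⟨a, hH.mem_iff.2 ⟨m, ha⟩, hF.mem_iff.2 ⟨m, hv⟩⟩

theorem IsPrefixApprox.prec {y : Cantor} {f h : ℕ → Part ℕ} {F H : List Bool → ℕ → Part ℕ}
    (hF : IsPrefixApprox y f F) (hH : IsPrefixApprox y h H) :
    IsPrefixApprox y (fun p =>
        let (a, n) := Nat.unpair p
        n.rec (f a) fun y IH => do
          let i ← IH
          h (Nat.pair a (Nat.pair y i)))
      fun t p => p.unpair.2.rec (F t p.unpair.1) fun k IH =>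
        IH.bind fun i => H t (Nat.pair p.unpair.1 (Nat.pair k i)) := by
  refine ⟨?_, ?_, ?_⟩
  · exact Partrec.nat_rec (f := fun x : List Bool × ℕ => x.2.unpair.2)
      (g := fun x => F x.1 x.2.unpair.1)
      (h := fun x z => H x.1 (Nat.pair x.2.unpair.1 (Nat.pair z.1 z.2)))
      (Computable.snd.comp (Computable.unpair.comp Computable.snd))
      (hF.partrec.comp Computable.fst (Computable.fst.comp
        (Computable.unpair.comp Computable.snd)))
      (hH.partrec.comp (Computable.fst.comp Computable.fst) (Primrec₂.natPair.to_comp.comp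
        (Computable.fst.comp (Computable.unpair.comp (Computable.snd.comp Computable.fst)))
        (Primrec₂.natPair.to_comp.comp (Computable.fst.comp Computable.snd)
          (Computable.snd.comp Computable.snd)))).to₂
  · intro t t' p v ht
    generalize p.unpair.2 = k
    induction k generalizing v with
    | zero => exact hF.mono ht
    | succ k ih =>
      simp only [Part.mem_bind_iff]
      rintro ⟨a, ha, hv⟩
      exact ⟨a, ih ha, hH.mono ht hv⟩
  · intro p v
    have mono : ∀ {k a v m m'}, m ≤ m' →
        v ∈ Nat.rec (motive := fun _ => Part ℕ) (F (pre y m) a) (fun k IH =>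
          IH.bind fun i => H (pre y m) (Nat.pair a (Nat.pair k i))) k →
        v ∈ Nat.rec (motive := fun _ => Part ℕ) (F (pre y m') a) (fun k IH =>
          IH.bind fun i => H (pre y m') (Nat.pair a (Nat.pair k i))) k := by
      intro k a v m m' hm
      induction k generalizing v with
      | zero => exact hF.mono (pre_prefix_pre y hm)
      | succ k ih =>
        simp only [Part.mem_bind_iff]
        rintro ⟨b, hb, hv⟩
        exact ⟨b, ih hb, hH.mono (pre_prefix_pre y hm) hv⟩
    dsimp only
    generalize p.unpair.2 = k
    generalize p.unpair.1 = a
    induction k generalizing v with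
    | zero => exact hF.mem_iff
    | succ k ih =>
      simp only [Part.bind_eq_bind, Part.mem_bind_iff]
      simp only [Part.bind_eq_bind] at ih
      constructor
      · rintro ⟨b, hb, hv⟩
        obtain ⟨m, hm⟩ := ih.1 hb
        obtain ⟨m', hm'⟩ := hH.mem_iff.1 hv
        exact ⟨max m m', b, mono (le_max_left _ _) hm,
          hH.mono (pre_prefix_pre y (le_max_right _ _)) hm'⟩
      · rintro ⟨m, b, hb, hv⟩
        exact ⟨b, ih.2 ⟨m, hb⟩, hH.mem_iff.2 ⟨m, hv⟩⟩

theorem IsPrefixApprox.rfind {y : Cantor} {f : ℕ → Part ℕ} {F : List Bool → ℕ → Part ℕ}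
    (hF : IsPrefixApprox y f F) :
    IsPrefixApprox y (fun a => Nat.rfind fun n => (fun m => m = 0) <$> f (Nat.pair a n))
      fun t a => Nat.rfind fun n => (F t (Nat.pair a n)).map fun m => decide (m = 0) := by
  refine ⟨?_, ?_, ?_⟩
  · refine Partrec.rfind (p := fun (x : List Bool × ℕ) n =>
      (F x.1 (Nat.pair x.2 n)).map fun m => decide (m = 0)) (Partrec.map
      (hF.partrec.comp (Computable.fst.comp Computable.fst) (Primrec₂.natPair.to_comp.comp
        (Computable.snd.comp Computable.fst) Computable.snd)) ?_)
    exact ((Primrec.eq.comp Primrec.snd (Primrec.const 0)).decide).to_comp.to₂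
  · intro t t' n v ht h
    replace h := Nat.mem_rfind.1 h
    refine Nat.mem_rfind.2 ?_
    simp only [Part.mem_map_iff] at h ⊢
    obtain ⟨⟨a, ha, h1⟩, h2⟩ := h
    refine ⟨⟨a, hF.mono ht ha, h1⟩, fun {k} hk => ?_⟩
    obtain ⟨b, hb, h3⟩ := h2 hk
    exact ⟨b, hF.mono ht hb, h3⟩
  · intro n v
    refine Nat.mem_rfind.trans (Iff.trans ?_ (exists_congr fun m => Nat.mem_rfind.symm))
    simp only [Part.map_eq_map, Part.mem_map_iff]
    constructor
    · rintro ⟨⟨a, ha, h1⟩, h2⟩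
      obtain ⟨m, hm⟩ := hF.mem_iff.1 ha
      obtain ⟨m', hm'⟩ := exists_forall_lt_of_mono (n := v)
        (Q := fun m k => ∃ b ∈ F (pre y m) (Nat.pair n k), decide (b = 0) = false)
        (fun hm ⟨b, hb, e⟩ => ⟨b, hF.mono (pre_prefix_pre y hm) hb, e⟩) (fun k hk => by
          obtain ⟨b, hb, e⟩ := h2 hk
          obtain ⟨m, hm⟩ := hF.mem_iff.1 hb
          exact ⟨m, b, hm, e⟩)
      refine ⟨max m m', ⟨a, hF.mono (pre_prefix_pre y (le_max_left _ _)) hm, h1⟩,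
        fun {k} hk => ?_⟩
      obtain ⟨b, hb, e⟩ := hm' k hk
      exact ⟨b, hF.mono (pre_prefix_pre y (le_max_right _ _)) hb, e⟩
    · rintro ⟨m, ⟨a, ha, h1⟩, h2⟩
      refine ⟨⟨a, hF.mem_iff.2 ⟨m, ha⟩, h1⟩, fun {k} hk => ?_⟩
      obtain ⟨b, hb, e⟩ := h2 hk
      exact ⟨b, hF.mem_iff.2 ⟨m, hb⟩, e⟩

/-- By induction on the oracle computation. Only the oracle case reads the prefix, and it is
undefined beyond its end; composite cases use monotonicity to pass to a common longer prefix. -/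
theorem Nat.RecursiveIn.exists_isPrefixApprox {y : Cantor} {f : ℕ →. ℕ}
    (hf : Nat.RecursiveIn (_root_.oracle y) f) : ∃ F, IsPrefixApprox y f F := by
  induction hf with
  | zero => exact ⟨_, .of_partrec .zero⟩
  | succ => exact ⟨_, .of_partrec .succ⟩
  | left => exact ⟨_, .of_partrec .left⟩
  | right => exact ⟨_, .of_partrec .right⟩
  | oracle g hg => rw [Set.mem_singleton_iff.1 hg]; exact ⟨_, IsPrefixApprox.oracle y⟩
  | pair _ _ ih₁ ih₂ => exact ⟨_, ih₁.choose_spec.pair ih₂.choose_spec⟩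
  | comp _ _ ih₁ ih₂ => exact ⟨_, ih₁.choose_spec.comp ih₂.choose_spec⟩
  | prec _ _ ih₁ ih₂ => exact ⟨_, ih₁.choose_spec.prec ih₂.choose_spec⟩
  | rfind _ ih => exact ⟨_, ih.choose_spec.rfind⟩

/-- The use principle: a function computable with the oracle `y` is computed by a primitive
recursive search through the prefixes of `y`. -/
theorem RecursiveIn.exists_primrec_prefix {α σ : Type*} [Primcodable α] [Primcodable σ]
    {y : Cantor} {f : α →. σ} (hf : RecursiveIn (_root_.oracle y) f) :
    ∃ φ : List Bool → α → Option σ, Primrec₂ φ ∧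
      (∀ t t' a v, t <+: t' → v ∈ φ t a → v ∈ φ t' a) ∧
      ∀ a v, v ∈ f a ↔ ∃ m, v ∈ φ (pre y m) a := by
  obtain ⟨F, hF⟩ := Nat.RecursiveIn.exists_isPrefixApprox hf
  obtain ⟨c, hc⟩ := Nat.Partrec.Code.exists_code.1 hF.partrec
  have hcF : ∀ t n v, v ∈ c.eval (Encodable.encode (t, n)) ↔ v ∈ F t n := by
    intro t n v
    rw [hc]
    simp
  -- The length of `t` is also the time bound, and all prefixes of `t` are tried as oracle. This
  -- makes the search primitive recursive and monotone in `t`.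
  let φ₀ : List Bool → ℕ → Option ℕ := fun t n => ((List.range (t.length + 1)).filterMap
    fun j => Nat.Partrec.Code.evaln t.length c (Encodable.encode (t.take j, n))).head?
  have hφ₀ : Primrec₂ φ₀ := by
    refine Primrec.list_head?.comp (Primrec.listFilterMap (Primrec.list_range.comp
      (Primrec.succ.comp (Primrec.list_length.comp Primrec.fst))) ?_)
    exact Nat.Partrec.Code.primrec_evaln.comp (((Primrec.list_length.comp
      (Primrec.fst.comp Primrec.fst)).pair (Primrec.const c)).pair (Primrec.encode.comp
        ((Primrec.list_take.comp Primrec.snd (Primrec.fst.comp Primrec.fst)).pair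
          (Primrec.snd.comp Primrec.fst))))
  have sound : ∀ t n v, v ∈ φ₀ t n → v ∈ F t n := by
    intro t n v hv
    obtain ⟨j, -, hj⟩ := List.mem_filterMap.1 (List.mem_of_mem_head? hv)
    exact hF.mono (List.take_prefix _ _) ((hcF _ _ _).1 (Nat.Partrec.Code.evaln_sound hj))
  have complete : ∀ t t' n v, t <+: t' →
      v ∈ Nat.Partrec.Code.evaln t'.length c (Encodable.encode (t, n)) → v ∈ φ₀ t' n := by
    intro t t' n v ht hv
    have hmem : v ∈ (List.range (t'.length + 1)).filterMap
        fun j => Nat.Partrec.Code.evaln t'.length c (Encodable.encode (t'.take j, n)) := by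
      refine List.mem_filterMap.2 ⟨t.length, List.mem_range.2 (Nat.lt_succ_of_le ht.length_le), ?_⟩
      rw [← List.prefix_iff_eq_take.1 ht]
      exact hv
    obtain ⟨w, hw⟩ := Option.isSome_iff_exists.1
      (by rw [List.isSome_head?]; simpa using List.ne_nil_of_mem hmem :
        (φ₀ t' n).isSome = true)
    -- The first value found may come from another prefix, but all values found belong to the
    -- single-valued `F t' n` and so coincide.
    have hvF := hF.mono ht ((hcF _ _ _).1 (Nat.Partrec.Code.evaln_sound hv))
    rw [Part.mem_unique hvF (sound _ _ _ hw)]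
    exact hw
  have mono : ∀ t t' n v, t <+: t' → v ∈ φ₀ t n → v ∈ φ₀ t' n := by
    intro t t' n v ht hv
    obtain ⟨j, -, hj⟩ := List.mem_filterMap.1 (List.mem_of_mem_head? hv)
    exact complete _ _ _ _ ((List.take_prefix _ _).trans ht)
      (Nat.Partrec.Code.evaln_mono ht.length_le hj)
  have mem : ∀ n v, (∃ m, v ∈ F (pre y m) n) ↔ ∃ m, v ∈ φ₀ (pre y m) n := by
    intro n v
    constructor
    · rintro ⟨m, hm⟩
      obtain ⟨k, hk⟩ := Nat.Partrec.Code.evaln_complete.1 ((hcF _ _ _).2 hm)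
      refine ⟨max m k, complete _ _ _ _ (pre_prefix_pre y (le_max_left m k)) ?_⟩
      rw [length_pre]
      exact Nat.Partrec.Code.evaln_mono (le_max_right _ _) hk
    · rintro ⟨m, hm⟩
      exact ⟨m, sound _ _ _ hm⟩
  refine ⟨fun t a => (φ₀ t (Encodable.encode a)).bind Encodable.decode, ?_, ?_, ?_⟩
  · exact Primrec.option_bind (hφ₀.comp Primrec.fst (Primrec.encode.comp Primrec.snd))
      (Primrec.decode.comp Primrec.snd).to₂
  · intro t t' a v ht hv
    simp only [Option.mem_def, Option.bind_eq_some_iff] at hv ⊢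
    obtain ⟨w, hw, e⟩ := hv
    exact ⟨w, mono _ _ _ _ ht hw, e⟩
  · intro a v
    have h1 : ∀ w, w ∈ (Part.bind (Encodable.decode (α := α) (Encodable.encode a) : Part α)
        fun a => (f a).map Encodable.encode) ↔ ∃ v ∈ f a, Encodable.encode v = w := by
      intro w; simp
    constructor
    · intro hv
      obtain ⟨m, hm⟩ := (mem _ _).1 (hF.mem_iff.1 ((h1 _).2 ⟨v, hv, rfl⟩))
      exact ⟨m, by simp [Option.mem_def.1 hm]⟩
    · rintro ⟨m, hm⟩
      simp only [Option.mem_def, Option.bind_eq_some_iff] at hm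
      obtain ⟨w, hw, e⟩ := hm
      obtain ⟨v', hv', rfl⟩ := (h1 w).1 (hF.mem_iff.2 ((mem _ _).2 ⟨m, hw⟩))
      rw [Encodable.encodek] at e
      exact Option.some.inj e ▸ hv'

end UsePrinciple

/-! ### Prefix-free covers and trimming of oracle tests. -/

section OracleTests

/-- The binary strings of length at most `N`. -/
def stringsUpTo (N : ℕ) : List (List Bool) := (List.range (N + 1)).flatMap strings

theorem mem_stringsUpTo {N : ℕ} {s : List Bool} : s ∈ stringsUpTo N ↔ s.length ≤ N := by
  simp [stringsUpTo, mem_strings]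

theorem nodup_stringsUpTo (N : ℕ) : (stringsUpTo N).Nodup := by
  refine List.nodup_flatMap.2 ⟨fun _ _ => nodup_strings _, List.nodup_range.imp ?_⟩
  intro a b hab s ha hb
  rw [mem_strings] at ha hb
  exact hab (ha.symm.trans hb)

theorem primrec_stringsUpTo : Primrec stringsUpTo :=
  Primrec.list_flatMap (Primrec.list_range.comp Primrec.succ)
    (primrec_strings.comp Primrec.snd).to₂

theorem length_strings (n : ℕ) : (strings n).length = 2 ^ n := by
  induction n with
  | zero => rfl
  | succ n ih =>
    rw [strings, List.length_flatMap, pow_succ, ← ih]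
    simp

/-- There are `2 ^ m` strings of length `m`, which contribute `2⁻ᵐ`. The measure of `Δ(u)` is
approximated to precision `2^-(2|u|+n+1)`; this bounds the total of the errors over all strings `u`
by `2⁻ⁿ`. -/
theorem sum_stringsUpTo_le (N : ℕ) :
    ((stringsUpTo N).map fun u => ((4 : ℝ) ^ u.length)⁻¹).sum ≤ 2 := by
  have h : ∀ m, ((strings m).map fun u => ((4 : ℝ) ^ u.length)⁻¹).sum = (2 ^ m)⁻¹ := by
    intro m
    have e : (strings m).map (fun u => ((4 : ℝ) ^ u.length)⁻¹)
        = (strings m).map fun _ => ((4 : ℝ) ^ m)⁻¹ :=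
      List.map_congr_left fun u hu => by rw [mem_strings.1 hu]
    rw [e, List.map_const', List.sum_replicate, length_strings, nsmul_eq_mul,
      show (4 : ℝ) = 2 * 2 by norm_num, mul_pow]
    push_cast
    field_simp
  have : ((stringsUpTo N).map fun u => ((4 : ℝ) ^ u.length)⁻¹).sum = 2 - (2 ^ N)⁻¹ := by
    induction N with
    | zero => simp [stringsUpTo, strings]; norm_num
    | succ N ih =>
      have e : stringsUpTo (N + 1) = stringsUpTo N ++ strings (N + 1) := by
        simp [stringsUpTo, List.range_succ]
      rw [e, List.map_append, List.sum_append, ih, h, pow_succ]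
      field_simp
      ring
  rw [this]
  have : (0 : ℝ) < (2 ^ N)⁻¹ := by positivity
  linarith

variable (ψ : List Bool → ℕ × List Bool → Option Unit)
  (φ : List Bool → List Bool × ℕ → Option ℕ)

/-- `Δ(u)` is contained in a cylinder enumerated at level `n` with the oracle prefix `t`. -/
def Covered (n : ℕ) (t u : List Bool) : Prop :=
  ∃ j ∈ List.range (u.length + 1), (ψ t (n, u.take j)).isSome = true

/-- `Δ(u)` is covered with the prefix of `t` of length `|u|`, and no prefix of `u` is covered in
this way. -/
def NewlyCovered (n : ℕ) (t u : List Bool) : Prop :=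
  Covered ψ n (t.take u.length) u ∧
    ∀ i ∈ List.range u.length, ¬ Covered ψ n (t.take i) (u.take i)

open Classical in
/-- The newly covered strings of length at most `N`. -/
noncomputable def newlyCovered (N : ℕ) (x : ℕ × List Bool) : List (List Bool) :=
  (stringsUpTo N).filter fun u => decide (NewlyCovered ψ x.1 x.2 u)

/-- The approximation to the measure of `Δ(u)` that is used at level `n`. -/
def claim (x : ℕ × List Bool) (u : List Bool) : Option ℕ := φ x.2 (u, 2 * u.length + x.1 + 1)

/-- The approximations to the measures of the newly covered strings of length at most `N` are
known from `t`, and their sum is small. -/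
def Trimmed (N n : ℕ) (t : List Bool) : Prop :=
  N ≤ t.length ∧ (∀ u ∈ newlyCovered ψ N (n, t), (claim φ (n, t) u).isSome = true) ∧
    ((newlyCovered ψ N (n, t)).map fun u =>
      ((claim φ (n, t) u).getD 0 + 2) * 2 ^ (2 * (N - u.length))).sum ≤ 8 * 2 ^ (2 * N)

variable {ψ φ}

theorem mem_newlyCovered {N : ℕ} {x : ℕ × List Bool} {u : List Bool} :
    u ∈ newlyCovered ψ N x ↔ u.length ≤ N ∧ NewlyCovered ψ x.1 x.2 u := by
  simp [newlyCovered, mem_stringsUpTo]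

theorem nodup_newlyCovered (N : ℕ) (x : ℕ × List Bool) : (newlyCovered ψ N x).Nodup :=
  (nodup_stringsUpTo N).filter _

theorem primrecPred_covered (hψ : Primrec₂ ψ) :
    PrimrecPred fun x : ℕ × List Bool × List Bool => Covered ψ x.1 x.2.1 x.2.2 := by
  have hR : PrimrecRel fun (j : ℕ) (x : ℕ × List Bool × List Bool) =>
      (ψ x.2.1 (x.1, x.2.2.take j)).isSome = true :=
    Primrec.eq.comp (Primrec.option_isSome.comp (hψ.comp
      (Primrec.fst.comp (Primrec.snd.comp Primrec.snd)) ((Primrec.fst.comp Primrec.snd).pair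
        (Primrec.list_take.comp Primrec.fst (Primrec.snd.comp (Primrec.snd.comp Primrec.snd))))))
      (Primrec.const true)
  exact PrimrecRel.comp hR.exists_mem_list (Primrec.list_range.comp (Primrec.succ.comp
    (Primrec.list_length.comp (Primrec.snd.comp Primrec.snd)))) Primrec.id

theorem primrecPred_newlyCovered (hψ : Primrec₂ ψ) :
    PrimrecPred fun x : ℕ × List Bool × List Bool => NewlyCovered ψ x.1 x.2.1 x.2.2 := by
  have hc := primrecPred_covered hψ
  have hu : Primrec fun x : ℕ × List Bool × List Bool => x.2.2 := Primrec.snd.comp Primrec.snd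
  have ht : Primrec fun x : ℕ × List Bool × List Bool => x.2.1 := Primrec.fst.comp Primrec.snd
  refine PrimrecPred.and (hc.comp (f := fun x : ℕ × List Bool × List Bool =>
    (x.1, x.2.1.take x.2.2.length, x.2.2)) (Primrec.fst.pair ((Primrec.list_take.comp
      (Primrec.list_length.comp hu) ht).pair hu))) ?_
  have hR : PrimrecRel fun (i : ℕ) (x : ℕ × List Bool × List Bool) =>
      ¬ Covered ψ x.1 (x.2.1.take i) (x.2.2.take i) :=
    (hc.comp (f := fun y : ℕ × (ℕ × List Bool × List Bool) =>
      (y.2.1, y.2.2.1.take y.1, y.2.2.2.take y.1)) ((Primrec.fst.comp Primrec.snd).pair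
        ((Primrec.list_take.comp Primrec.fst (ht.comp Primrec.snd)).pair
          (Primrec.list_take.comp Primrec.fst (hu.comp Primrec.snd))))).not
  exact PrimrecRel.comp hR.forall_mem_list (Primrec.list_range.comp
    (Primrec.list_length.comp hu)) Primrec.id

theorem primrec_newlyCovered (hψ : Primrec₂ ψ) : Primrec₂ (newlyCovered ψ) := by
  classical
  have hR : PrimrecRel fun (u : List Bool) (x : ℕ × List Bool) => NewlyCovered ψ x.1 x.2 u :=
    (primrecPred_newlyCovered hψ).comp (f := fun y : List Bool × (ℕ × List Bool) =>
      (y.2.1, y.2.2, y.1)) ((Primrec.fst.comp Primrec.snd).pair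
        ((Primrec.snd.comp Primrec.snd).pair Primrec.fst))
  exact Primrec₂.comp hR.listFilter (g := fun x : ℕ × (ℕ × List Bool) => stringsUpTo x.1)
    (h := fun x => x.2) (primrec_stringsUpTo.comp Primrec.fst) Primrec.snd

theorem primrec_claim (hφ : Primrec₂ φ) : Primrec₂ (claim φ) :=
  hφ.comp (Primrec.snd.comp Primrec.fst) (Primrec.snd.pair (Primrec.nat_add.comp
    (Primrec.nat_add.comp (Primrec.nat_mul.comp (Primrec.const 2)
      (Primrec.list_length.comp Primrec.snd)) (Primrec.fst.comp Primrec.fst)) (Primrec.const 1)))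

theorem primrecPred_trimmed (hψ : Primrec₂ ψ) (hφ : Primrec₂ φ) :
    PrimrecPred fun x : ℕ × ℕ × List Bool => Trimmed ψ φ x.1 x.2.1 x.2.2 := by
  have hc := primrec_claim hφ
  have hl : Primrec fun x : ℕ × ℕ × List Bool => newlyCovered ψ x.1 (x.2.1, x.2.2) :=
    (primrec_newlyCovered hψ).comp Primrec.fst Primrec.snd
  refine PrimrecPred.and (Primrec.nat_le.comp Primrec.fst (Primrec.list_length.comp
    (Primrec.snd.comp Primrec.snd))) (PrimrecPred.and ?_ (Primrec.nat_le.comp ?_ ?_))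
  · have hR : PrimrecRel fun (u : List Bool) (x : ℕ × ℕ × List Bool) =>
        (claim φ (x.2.1, x.2.2) u).isSome = true :=
      Primrec.eq.comp (Primrec.option_isSome.comp (hc.comp (Primrec.snd.comp Primrec.snd)
        Primrec.fst)) (Primrec.const true)
    exact PrimrecRel.comp hR.forall_mem_list hl Primrec.id
  · refine Primrec.list_sum_map (f := fun (x : ℕ × ℕ × List Bool) u =>
      ((claim φ (x.2.1, x.2.2) u).getD 0 + 2) * 2 ^ (2 * (x.1 - u.length)))
      (Primrec.nat_mul.comp ?_ ?_) hl
    · exact Primrec.nat_add.comp (Primrec.option_getD.comp (hc.comp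
        (Primrec.snd.comp Primrec.fst) Primrec.snd) (Primrec.const 0)) (Primrec.const 2)
    · exact Primrec.two_pow.comp (Primrec.nat_mul.comp (Primrec.const 2)
        (Primrec.nat_sub.comp (Primrec.fst.comp Primrec.fst)
          (Primrec.list_length.comp Primrec.snd)))
  · exact Primrec.nat_mul.comp (Primrec.const 8) (Primrec.two_pow.comp
      (Primrec.nat_mul.comp (Primrec.const 2) Primrec.fst))

/-- The oracle is consulted only up to the length of `u`. Hence whether `u` is newly covered depends
on the second coordinate itself, and not on how long a prefix of it is available. -/
theorem newlyCovered_congr {n : ℕ} {t t' u : List Bool}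
    (h : t.take u.length = t'.take u.length) :
    NewlyCovered ψ n t u ↔ NewlyCovered ψ n t' u := by
  have : ∀ i ∈ List.range u.length, t.take i = t'.take i := by
    intro i hi
    have := congrArg (List.take i) h
    rwa [List.take_take, List.take_take, min_eq_left (List.mem_range.1 hi).le] at this
  unfold NewlyCovered
  rw [h]
  refine and_congr_right fun _ => forall₂_congr fun i hi => ?_
  rw [this i hi]

theorem take_eq_of_mem_cyl {z : Cantor} {t : List Bool} (h : z ∈ cyl t) {i : ℕ}
    (hi : i ≤ t.length) : t.take i = pre z i := by
  rw [← mem_cyl_iff.1 h, take_pre, min_eq_left hi]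

theorem NewlyCovered.iff_pre {n : ℕ} {z : Cantor} {t u : List Bool} (h : z ∈ cyl t)
    (hu : u.length ≤ t.length) : NewlyCovered ψ n t u ↔ NewlyCovered ψ n (pre z u.length) u :=
  newlyCovered_congr (by rw [take_eq_of_mem_cyl h hu, take_pre, min_self])

/-- Different newly covered strings define disjoint cylinders. -/
theorem NewlyCovered.disjoint {n : ℕ} {t u v : List Bool} (hu : NewlyCovered ψ n t u)
    (hv : NewlyCovered ψ n t v) (h : u ≠ v) : Disjoint (cyl u) (cyl v) := by
  have key : ∀ {u v : List Bool}, NewlyCovered ψ n t u → NewlyCovered ψ n t v → u ≠ v →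
      ¬ u <+: v := by
    intro u v hu hv h hp
    have hlt : u.length < v.length :=
      lt_of_le_of_ne hp.length_le fun e => h (hp.eq_of_length e)
    have := hv.2 u.length (List.mem_range.2 hlt)
    rw [← List.prefix_iff_eq_take.1 hp] at this
    exact this hu.1
  exact disjoint_cyl (key hu hv h) (key hv hu h.symm)

end OracleTests

/-! ### The measure of the trimmed test. -/

section OracleTestBound

variable {P : Measure (Cantor × Cantor)} {ψ : List Bool → ℕ × List Bool → Option Unit}
  {φ : List Bool → List Bool × ℕ → Option ℕ}

variable (P ψ φ) in
/-- The test on pairs obtained from an oracle test: `Δ(u) × Δ(t)` is enumerated when `u` is newly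
covered along `t`, and `P(Δ(u) | t)` is below a claimed bound, where the claimed bounds have a
small sum. -/
def trimmedTest : Set (ℕ × (List Bool × List Bool)) :=
  {p | NewlyCovered ψ p.1 p.2.2 p.2.1 ∧ Trimmed ψ φ p.2.1.length p.1 p.2.2 ∧
    ((2 ^ (2 * p.2.1.length + p.1 + 1) : ℕ) : ℝ) * P.real (rect p.2) <
      (((claim φ (p.1, p.2.2) p.2.1).getD 0 + 2 : ℕ) : ℝ) * P.real (rect ([], p.2.2))}

theorem rePred_trimmedTest (hP : IsComputableMeasure ∅ rect P) (hψ : Primrec₂ ψ)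
    (hφ : Primrec₂ φ) : REPred fun p => p ∈ trimmedTest P ψ φ := by
  have hu : Primrec fun p : ℕ × (List Bool × List Bool) => p.2.1 := Primrec.fst.comp Primrec.snd
  have ht : Primrec fun p : ℕ × (List Bool × List Bool) => p.2.2 := Primrec.snd.comp Primrec.snd
  have hl := Primrec.list_length.comp hu
  refine REPred.and' ((primrecPred_newlyCovered hψ).comp (f := fun p : ℕ × (List Bool × List Bool) =>
    (p.1, p.2.2, p.2.1)) (Primrec.fst.pair (ht.pair hu))).computablePred.to_re (REPred.and'
      ((primrecPred_trimmed hψ hφ).comp (f := fun p : ℕ × (List Bool × List Bool) =>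
        (p.2.1.length, p.1, p.2.2)) (hl.pair (Primrec.fst.pair ht))).computablePred.to_re ?_)
  refine ComputableReal.lt_re (ComputableReal.nat_mul ?_ ?_) (ComputableReal.nat_mul ?_ ?_)
  · exact hP.computableReal_rect.comp Computable.snd
  · exact (Primrec.two_pow.comp (Primrec.nat_add.comp (Primrec.nat_add.comp (Primrec.nat_mul.comp
      (Primrec.const 2) hl) Primrec.fst) (Primrec.const 1))).to_comp
  · exact hP.computableReal_rect.comp ((Primrec.const []).pair ht).to_comp
  · exact (Primrec.nat_add.comp (Primrec.option_getD.comp ((primrec_claim hφ).comp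
      (Primrec.fst.pair ht) hu) (Primrec.const 0)) (Primrec.const 2)).to_comp

variable (φ) in
/-- The claimed bound for the measure of `Δ(u)`. -/
noncomputable def claimBound (n : ℕ) (t u : List Bool) : ℝ≥0∞ :=
  ((claim φ (n, t) u).getD 0 + 2 : ℕ) * ((2 : ℝ≥0∞) ^ (2 * u.length + n + 1))⁻¹

/-- Two prefixes of one sequence are comparable, and a claim once made is kept on extensions. -/
theorem claim_eq_of_mem_cyl
    (mono : ∀ t t' a v, t <+: t' → v ∈ φ t a → v ∈ φ t' a) {n : ℕ} {t t' u : List Bool}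
    {z : Cantor} (hz : z ∈ cyl t) (hz' : z ∈ cyl t') (h : (claim φ (n, t) u).isSome = true)
    (h' : (claim φ (n, t') u).isSome = true) : claim φ (n, t) u = claim φ (n, t') u := by
  obtain ⟨v, hv⟩ := Option.isSome_iff_exists.1 h
  obtain ⟨w, hw⟩ := Option.isSome_iff_exists.1 h'
  rcases le_total t.length t'.length with hl | hl
  · have := mono _ _ _ v (prefix_of_mem_cyl hz hz' hl) hv
    rw [hv]; exact this.symm
  · have := mono _ _ _ w (prefix_of_mem_cyl hz' hz hl) hw
    rw [hw]; exact this

theorem Trimmed.isSome_claim {n : ℕ} {t u : List Bool} (h : Trimmed ψ φ u.length n t)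
    (hu : NewlyCovered ψ n t u) : (claim φ (n, t) u).isSome = true :=
  h.2.1 u (mem_newlyCovered.2 ⟨le_rfl, hu⟩)

/-- The trimming condition of the longest string in `S` already controls the others: along `z` they
are newly covered as well, no longer, and carry the same claims. Its bound `8 · 2^(2N)`, in units of
`2^-(2N+n+1)`, is `4 · 2⁻ⁿ`. -/
theorem sum_claimBound_le (mono : ∀ t t' a v, t <+: t' → v ∈ φ t a → v ∈ φ t' a) {n : ℕ}
    {z : Cantor} (S : Finset (List Bool)) (τ : List Bool → List Bool)
    (h : ∀ u ∈ S, NewlyCovered ψ n (τ u) u ∧ Trimmed ψ φ u.length n (τ u) ∧ z ∈ cyl (τ u)) :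
    ∑ u ∈ S, claimBound φ n (τ u) u ≤ 4 * (2 ^ n)⁻¹ := by
  classical
  rcases S.eq_empty_or_nonempty with rfl | hS
  · simp
  obtain ⟨v, hv, hmax⟩ := S.exists_max_image List.length hS
  obtain ⟨-, hT, hzv⟩ := h v hv
  set N := v.length
  have hmem : ∀ u ∈ S, u ∈ newlyCovered ψ N (n, τ v) := by
    intro u hu
    obtain ⟨h1, h2, h3⟩ := h u hu
    exact mem_newlyCovered.2 ⟨hmax u hu, (NewlyCovered.iff_pre hzv ((hmax u hu).trans hT.1)).2
      ((NewlyCovered.iff_pre h3 h2.1).1 h1)⟩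
  have hterm : ∀ u ∈ S, claimBound φ n (τ u) u = (((claim φ (n, τ v) u).getD 0 + 2) *
      2 ^ (2 * (N - u.length)) : ℕ) * ((2 : ℝ≥0∞) ^ (2 * N + n + 1))⁻¹ := by
    intro u hu
    obtain ⟨h1, h2, h3⟩ := h u hu
    rw [claimBound, claim_eq_of_mem_cyl mono h3 hzv (h2.isSome_claim h1) (hT.2.1 u (hmem u hu)),
      show 2 * N + n + 1 = (2 * u.length + n + 1) + 2 * (N - u.length) by have := hmax u hu; omega,
      pow_add _ (2 * u.length + n + 1), ENNReal.mul_inv (by simp) (by simp)]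
    push_cast
    rw [mul_mul_mul_comm, mul_assoc, mul_comm ((2 : ℝ≥0∞) ^ (2 * (N - u.length))), ← mul_assoc,
      ← mul_assoc, mul_assoc _ (_⁻¹), ENNReal.inv_mul_cancel (by simp) (by simp), mul_one]
  rw [Finset.sum_congr rfl hterm, ← Finset.sum_mul, ← Nat.cast_sum]
  have hsum : ∑ u ∈ S, ((claim φ (n, τ v) u).getD 0 + 2) * 2 ^ (2 * (N - u.length))
      ≤ 8 * 2 ^ (2 * N) := by
    refine le_trans ?_ hT.2.2
    rw [← List.sum_toFinset _ (nodup_newlyCovered _ _)]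
    exact Finset.sum_le_sum_of_subset fun u hu => List.mem_toFinset.2 (hmem u hu)
  calc _ ≤ ((8 * 2 ^ (2 * N) : ℕ) : ℝ≥0∞) * ((2 : ℝ≥0∞) ^ (2 * N + n + 1))⁻¹ := by gcongr
    _ = 4 * (2 ^ n)⁻¹ := by
      rw [show 2 * N + n + 1 = 2 * N + (1 + n) by ring, pow_add, pow_add,
        ENNReal.mul_inv (by simp) (by simp), ENNReal.mul_inv (by simp) (by simp)]
      push_cast
      have e1 : (2 : ℝ≥0∞) ^ (2 * N) * (2 ^ (2 * N))⁻¹ = 1 :=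
        ENNReal.mul_inv_cancel (by simp) (by simp)
      have e2 : (2 : ℝ≥0∞) * (2 ^ 1)⁻¹ = 1 := by
        rw [pow_one, ENNReal.mul_inv_cancel (by simp) (by simp)]
      calc (8 : ℝ≥0∞) * 2 ^ (2 * N) * ((2 ^ (2 * N))⁻¹ * ((2 ^ 1)⁻¹ * (2 ^ n)⁻¹))
          = 4 * (2 ^ n)⁻¹ * (2 ^ (2 * N) * (2 ^ (2 * N))⁻¹) * (2 * (2 ^ 1)⁻¹) := by
            generalize (2 ^ (2 * N) : ℝ≥0∞)⁻¹ = a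
            generalize (2 ^ 1 : ℝ≥0∞)⁻¹ = b
            generalize (2 ^ n : ℝ≥0∞)⁻¹ = c
            ring
        _ = 4 * (2 ^ n)⁻¹ := by rw [e1, e2, mul_one, mul_one]

/-- For fixed `u`, the accepted `t` satisfy `P(Δ(u) | t) ≤ claimBound` when their marginal is
positive; the part of the test over `Δ(u)` is thus bounded by an integral in the second coordinate.
Summing over `u` under the integral leaves the pointwise sum of `sum_claimBound_le`. -/
theorem measure_trimmedTest_le [IsProbabilityMeasure P]
    (mono : ∀ t t' a v, t <+: t' → v ∈ φ t a → v ∈ φ t' a) (n : ℕ) :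
    P (level rect (trimmedTest P ψ φ) n) ≤ 4 * (2 ^ n)⁻¹ := by
  classical
  let C : List Bool → Set (List Bool) := fun u => {t | (n, (u, t)) ∈ trimmedTest P ψ φ}
  -- All accepted `t` containing `z` give the same claim for `u`, so the supremum has at most one
  -- nonzero value. It is zero if there is no such `t`.
  let G : List Bool → Cantor → ℝ≥0∞ := fun u z =>
    ⨆ t ∈ C u, (cyl t).indicator (fun _ => claimBound φ n t u) z
  have hG : ∀ u, Measurable (G u) := fun u =>
    Measurable.biSup _ (Set.to_countable _) fun t _ =>
      measurable_const.indicator (measurableSet_cyl t)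
  have hsub : level rect (trimmedTest P ψ φ) n ⊆ ⋃ u, cyl u ×ˢ ⋃ t ∈ C u, cyl t := by
    rintro ⟨a, b⟩ hab
    simp only [level, Set.mem_iUnion, exists_prop, rect] at hab
    obtain ⟨⟨u, t⟩, hV, ha, hb⟩ := hab
    exact Set.mem_iUnion.2 ⟨u, ha, Set.mem_biUnion (x := t) hV hb⟩
  have hu : ∀ u, P (cyl u ×ˢ ⋃ t ∈ C u, cyl t) ≤ ∫⁻ z, G u z ∂P.snd := by
    intro u
    have hm : MeasurableSet (⋃ t ∈ C u, cyl t) :=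
      MeasurableSet.biUnion (Set.to_countable _) fun _ _ => measurableSet_cyl _
    have e : P (cyl u ×ˢ ⋃ t ∈ C u, cyl t)
        = (P.restrict (cyl u ×ˢ Set.univ)).snd (⋃ t ∈ C u, cyl t) := by
      rw [Measure.snd_apply hm, Measure.restrict_apply (measurable_snd hm)]
      congr 1; ext; simp [and_comm]
    rw [e]
    refine (measure_iUnion_cyl_mono (ν := P.snd.withDensity (G u)) fun t ht => ?_).trans
      ((measure_mono (Set.subset_univ _)).trans (by simp [withDensity_apply]))
    rw [restrict_snd_cyl, withDensity_apply _ (measurableSet_cyl t)]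
    have h1 : P (rect (u, t)) ≤ claimBound φ n t u * P.snd (cyl t) := by
      have := ht.1.2.2
      dsimp only at this
      rw [snd_cyl, ← ofReal_measureReal (μ := P), ← ofReal_measureReal (μ := P), claimBound,
        ← ENNReal.ofReal_natCast, ← ENNReal.ofReal_ofNat, ← ENNReal.ofReal_pow (by norm_num),
        ← ENNReal.ofReal_inv_of_pos (by positivity), ← ENNReal.ofReal_mul (by positivity),
        ← ENNReal.ofReal_mul (by positivity)]
      refine ENNReal.ofReal_le_ofReal ?_
      rw [mul_right_comm, ← div_eq_mul_inv, le_div_iff₀ (by positivity), mul_comm]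
      push_cast at this ⊢
      exact this.le
    refine h1.trans ?_
    rw [← setLIntegral_const]
    refine setLIntegral_mono (hG u) fun z hz => ?_
    refine le_trans ?_ (le_iSup₂ (f := fun t (_ : t ∈ C u) =>
      (cyl t).indicator (fun _ => claimBound φ n t u) z) t ht.1)
    rw [Set.indicator_of_mem hz]
  have hsum : ∀ z, ∑' u, G u z ≤ 4 * (2 ^ n)⁻¹ := by
    intro z
    rw [ENNReal.tsum_eq_iSup_sum]
    refine iSup_le fun S => ?_
    have hz : ∀ u, (∃ t ∈ C u, z ∈ cyl t) ∨ G u z = 0 := by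
      intro u
      by_cases h : ∃ t ∈ C u, z ∈ cyl t
      · exact Or.inl h
      · push Not at h
        exact Or.inr (by simpa [G] using fun t ht hzt => absurd hzt (h t ht))
    choose! τ hτ hzτ using fun u (h : ∃ t ∈ C u, z ∈ cyl t) => h
    calc ∑ u ∈ S, G u z = ∑ u ∈ S with ∃ t ∈ C u, z ∈ cyl t, G u z :=
          (Finset.sum_filter_of_ne fun u _ h => (hz u).resolve_right h).symm
      _ ≤ ∑ u ∈ S with ∃ t ∈ C u, z ∈ cyl t, claimBound φ n (τ u) u := by
          refine Finset.sum_le_sum fun u hu => iSup₂_le fun t ht => ?_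
          have hu := (Finset.mem_filter.1 hu).2
          by_cases hzt : z ∈ cyl t
          · rw [Set.indicator_of_mem hzt, claimBound, claimBound,
              claim_eq_of_mem_cyl mono hzt (hzτ u hu) (ht.2.1.isSome_claim ht.1)
                ((hτ u hu).2.1.isSome_claim (hτ u hu).1)]
          · rw [Set.indicator_of_notMem hzt]; exact bot_le
      _ ≤ 4 * (2 ^ n)⁻¹ := sum_claimBound_le (ψ := ψ) (z := z) mono _ τ fun u hu => by
          have hu := (Finset.mem_filter.1 hu).2
          exact ⟨(hτ u hu).1, (hτ u hu).2.1, hzτ u hu⟩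
  calc P (level rect (trimmedTest P ψ φ) n)
      ≤ ∑' u, P (cyl u ×ˢ ⋃ t ∈ C u, cyl t) := (measure_mono hsub).trans (measure_iUnion_le _)
    _ ≤ ∑' u, ∫⁻ z, G u z ∂P.snd := ENNReal.tsum_le_tsum hu
    _ = ∫⁻ z, ∑' u, G u z ∂P.snd := (lintegral_tsum fun u => (hG u).aemeasurable).symm
    _ ≤ ∫⁻ _, 4 * (2 ^ n)⁻¹ ∂P.snd := lintegral_mono hsum
    _ = 4 * (2 ^ n)⁻¹ := by simp

end OracleTestBound

/-! ### The trimmed test loses nothing along the true oracle. -/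

section OracleTestMembership

variable {P : Measure (Cantor × Cantor)} {ψ : List Bool → ℕ × List Bool → Option Unit}
  {φ : List Bool → List Bool × ℕ → Option ℕ} {y : Cantor} {W : Set (ℕ × List Bool)}
  {ν : Measure Cantor} {f : List Bool × ℕ → ℕ}

/-- Prefixes of `x` and `y` are lengthened together until the oracle use and the enumerated cylinder
are both within the common length; the least such length is newly covered. -/
theorem exists_newlyCovered_of_mem_level
    (mono : ∀ t t' a v, t <+: t' → v ∈ ψ t a → v ∈ ψ t' a)
    (hW : ∀ a, a ∈ W ↔ ∃ m, (ψ (pre y m) a).isSome = true) {n : ℕ} {x : Cantor}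
    (hx : x ∈ level cyl W n) : ∃ i, NewlyCovered ψ n (pre y i) (pre x i) := by
  classical
  have hex : ∃ i, Covered ψ n (pre y i) (pre x i) := by
    simp only [level, Set.mem_iUnion, Set.mem_ofPred_eq, exists_prop] at hx
    obtain ⟨s, hs, hxs⟩ := hx
    obtain ⟨m, hm⟩ := (hW _).1 hs
    obtain ⟨v, hv⟩ := Option.isSome_iff_exists.1 hm
    refine ⟨max m s.length, s.length, ?_, ?_⟩
    · rw [length_pre]; exact List.mem_range.2 (Nat.lt_succ_of_le (le_max_right _ _))
    · rw [take_pre, min_eq_left (le_max_right _ _), mem_cyl_iff.1 hxs]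
      exact Option.isSome_iff_exists.2
        ⟨v, mono _ _ _ _ (pre_prefix_pre y (le_max_left _ _)) hv⟩
  refine ⟨Nat.find hex, ?_, fun i hi => ?_⟩
  · rw [take_pre, length_pre, min_self]; exact Nat.find_spec hex
  · rw [length_pre, List.mem_range] at hi
    rw [take_pre, take_pre, min_eq_left hi.le]
    exact Nat.find_min hex hi

theorem NewlyCovered.cyl_subset_level
    (hW : ∀ a, a ∈ W ↔ ∃ m, (ψ (pre y m) a).isSome = true) {n m : ℕ} {u : List Bool}
    (h : NewlyCovered ψ n (pre y m) u) : cyl u ⊆ level cyl W n := by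
  obtain ⟨⟨j, -, hj⟩, -⟩ := h
  rw [take_pre] at hj
  exact (cyl_anti (List.take_prefix j u)).trans
    (Set.subset_biUnion_of_mem (u := cyl) (x := u.take j) ((hW _).2 ⟨_, hj⟩))

/-- The newly covered cylinders are disjoint subsets of the level, so their true measures sum to at
most `2⁻ⁿ`. Each claimed bound exceeds the true measure by at most 3 units: 1 for the approximation
error and 2 added by hand. With the weights `4^-|u|` the excess sums to at most `3 · 2⁻ⁿ`, for a
total of `4 · 2⁻ⁿ`. -/
theorem sum_newlyCovered_le [IsProbabilityMeasure ν]
    (hW : ∀ a, a ∈ W ↔ ∃ m, (ψ (pre y m) a).isSome = true) {n : ℕ}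
    (hν : ν (level cyl W n) ≤ (2 ^ n)⁻¹)
    (hf : ∀ s k, |ν.real (cyl s) - (f (s, k) : ℝ) / 2 ^ k| ≤ 1 / 2 ^ k) (N m : ℕ) :
    ((newlyCovered ψ N (n, pre y m)).map fun u =>
      (f (u, 2 * u.length + n + 1) + 2) * 2 ^ (2 * (N - u.length))).sum ≤ 8 * 2 ^ (2 * N) := by
  classical
  set l := newlyCovered ψ N (n, pre y m) with hl
  have hnd : l.Nodup := nodup_newlyCovered _ _
  rw [← List.sum_toFinset _ hnd]
  have h1 : ∑ u ∈ l.toFinset, ν.real (cyl u) ≤ (2 ^ n)⁻¹ := by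
    rw [← measureReal_biUnion_finset (f := cyl) (fun u hu v hv huv => ?_)
      fun _ _ => measurableSet_cyl _]
    · refine (measureReal_mono (μ := ν) (s₂ := level cyl W n) ?_ (by finiteness)).trans ?_
      · exact Set.iUnion₂_subset fun u hu => NewlyCovered.cyl_subset_level hW
          (mem_newlyCovered.1 (List.mem_toFinset.1 hu)).2
      · refine (ENNReal.toReal_mono (by simp) hν).trans_eq ?_
        simp
    · exact NewlyCovered.disjoint (mem_newlyCovered.1 (List.mem_toFinset.1 hu)).2
        (mem_newlyCovered.1 (List.mem_toFinset.1 hv)).2 huv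
  have h2 : ∑ u ∈ l.toFinset, ((4 : ℝ) ^ u.length)⁻¹ ≤ 2 := by
    refine le_trans ?_ (sum_stringsUpTo_le N)
    rw [← List.sum_toFinset _ (nodup_stringsUpTo N)]
    refine Finset.sum_le_sum_of_subset_of_nonneg (fun u hu => ?_) fun _ _ _ => by positivity
    exact List.mem_toFinset.2 (mem_stringsUpTo.2 (mem_newlyCovered.1 (List.mem_toFinset.1 hu)).1)
  have h3 : ∀ u ∈ l.toFinset, (((f (u, 2 * u.length + n + 1) + 2) *
      2 ^ (2 * (N - u.length)) : ℕ) : ℝ) ≤ 2 ^ (2 * N + n + 1) * ν.real (cyl u)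
        + 3 * 2 ^ (2 * N) * ((4 : ℝ) ^ u.length)⁻¹ := by
    intro u hu
    have hN := (mem_newlyCovered.1 (List.mem_toFinset.1 hu)).1
    have := (abs_le.1 (hf u (2 * u.length + n + 1))).1
    have e : (2 : ℝ) ^ (2 * N + n + 1) = 2 ^ (2 * u.length + n + 1) * 2 ^ (2 * (N - u.length)) := by
      rw [← pow_add]; congr 1; omega
    have e' : (2 : ℝ) ^ (2 * N) * ((4 : ℝ) ^ u.length)⁻¹ = 2 ^ (2 * (N - u.length)) := by
      rw [show (4 : ℝ) = 2 ^ 2 by norm_num, ← pow_mul, ← div_eq_mul_inv, div_eq_iff (by positivity),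
        ← pow_add]
      congr 1; omega
    rw [mul_assoc, e', e]
    set K : ℝ := 2 ^ (2 * u.length + n + 1) with hK
    have hKpos : 0 < K := by positivity
    have h4 : (f (u, 2 * u.length + n + 1) : ℝ) ≤ K * ν.real (cyl u) + 1 := by
      have h5 : (f (u, 2 * u.length + n + 1) : ℝ) / K ≤ ν.real (cyl u) + 1 / K := by linarith
      rw [div_le_iff₀ hKpos] at h5
      calc _ ≤ _ := h5
        _ = _ := by field_simp
    push_cast
    calc _ ≤ (K * ν.real (cyl u) + 1 + 2) * (2 : ℝ) ^ (2 * (N - u.length)) := by gcongr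
      _ = _ := by ring
  have h5 : ((∑ u ∈ l.toFinset, (f (u, 2 * u.length + n + 1) + 2) *
      2 ^ (2 * (N - u.length)) : ℕ) : ℝ) ≤ ((8 * 2 ^ (2 * N) : ℕ) : ℝ) := by
    rw [Nat.cast_sum]
    calc _ ≤ _ := Finset.sum_le_sum h3
      _ = 2 ^ (2 * N + n + 1) * ∑ u ∈ l.toFinset, ν.real (cyl u)
        + 3 * 2 ^ (2 * N) * ∑ u ∈ l.toFinset, ((4 : ℝ) ^ u.length)⁻¹ := by
          rw [Finset.sum_add_distrib, Finset.mul_sum, Finset.mul_sum]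
      _ ≤ 2 ^ (2 * N + n + 1) * (2 ^ n)⁻¹ + 3 * 2 ^ (2 * N) * 2 := by gcongr
      _ = _ := by
        rw [pow_succ, pow_add]; push_cast; field_simp; ring
  exact_mod_cast h5

/-- Only finitely many strings have length at most `N`, so a long prefix of `y` yields the correct
approximation for all of them at once. -/
theorem eventually_trimmed [IsProbabilityMeasure ν]
    (mono : ∀ t t' a v, t <+: t' → v ∈ φ t a → v ∈ φ t' a)
    (hφ : ∀ a, ∃ m, f a ∈ φ (pre y m) a)
    (hW : ∀ a, a ∈ W ↔ ∃ m, (ψ (pre y m) a).isSome = true) {n : ℕ}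
    (hν : ν (level cyl W n) ≤ (2 ^ n)⁻¹)
    (hf : ∀ s k, |ν.real (cyl s) - (f (s, k) : ℝ) / 2 ^ k| ≤ 1 / 2 ^ k) (N : ℕ) :
    ∀ᶠ m in atTop, Trimmed ψ φ N n (pre y m) ∧ ∀ u ∈ newlyCovered ψ N (n, pre y m),
      claim φ (n, pre y m) u = some (f (u, 2 * u.length + n + 1)) := by
  have h1 : ∀ᶠ m in atTop, ∀ u ∈ {u | u ∈ stringsUpTo N},
      claim φ (n, pre y m) u = some (f (u, 2 * u.length + n + 1)) := by
    refine (eventually_all_finite (List.finite_toSet (stringsUpTo N))).2 fun u _ => ?_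
    obtain ⟨m₀, hm₀⟩ := hφ (u, 2 * u.length + n + 1)
    filter_upwards [eventually_ge_atTop m₀] with m hm
    exact mono _ _ _ _ (pre_prefix_pre y hm) hm₀
  filter_upwards [h1, eventually_ge_atTop N] with m hm hN
  have hc : ∀ u ∈ newlyCovered ψ N (n, pre y m),
      claim φ (n, pre y m) u = some (f (u, 2 * u.length + n + 1)) := fun u hu =>
    hm u (mem_stringsUpTo.2 (mem_newlyCovered.1 hu).1)
  refine ⟨⟨by rwa [length_pre], fun u hu => by rw [hc u hu]; rfl, ?_⟩, hc⟩
  rw [List.map_congr_left (g := fun u => (f (u, 2 * u.length + n + 1) + 2) *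
    2 ^ (2 * (N - u.length))) fun u hu => by rw [hc u hu]; rfl]
  exact sum_newlyCovered_le hW hν hf N m

theorem mem_level_trimmedTest [IsProbabilityMeasure P] (hy : y ∈ hippocratic P.snd)
    (hν : IsCondProbAt P y ν)
    (monoψ : ∀ t t' a v, t <+: t' → v ∈ ψ t a → v ∈ ψ t' a)
    (mono : ∀ t t' a v, t <+: t' → v ∈ φ t a → v ∈ φ t' a)
    (hφ : ∀ a, ∃ m, f a ∈ φ (pre y m) a)
    (hW : ∀ a, a ∈ W ↔ ∃ m, (ψ (pre y m) a).isSome = true) {n : ℕ}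
    (hνW : ν (level cyl W n) ≤ (2 ^ n)⁻¹)
    (hf : ∀ s k, |ν.real (cyl s) - (f (s, k) : ℝ) / 2 ^ k| ≤ 1 / 2 ^ k) {x : Cantor}
    (hx : x ∈ level cyl W n) : (x, y) ∈ level rect (trimmedTest P ψ φ) n := by
  have := hν.1
  obtain ⟨i, hi⟩ := exists_newlyCovered_of_mem_level monoψ hW hx
  set u := pre x i with hu
  have hlen : u.length = i := length_pre x i
  have hpos : (0 : ℝ) < 2 ^ (2 * u.length + n + 1) := by positivity
  -- Adding 2 to the approximation, where 1 would cover the error, makes the inequality strict. It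
  -- is therefore inherited by `P(Δ(u) | t)` for long prefixes `t` of `y`.
  have hlt : ν.real (cyl u) <
      ((f (u, 2 * u.length + n + 1) + 2 : ℕ) : ℝ) / 2 ^ (2 * u.length + n + 1) := by
    have := (abs_le.1 (hf u (2 * u.length + n + 1))).2
    rw [lt_div_iff₀ hpos]
    have h1 : ν.real (cyl u) ≤ ((f (u, 2 * u.length + n + 1) : ℝ) + 1) /
        2 ^ (2 * u.length + n + 1) := by rw [add_div]; linarith
    rw [le_div_iff₀ hpos] at h1
    push_cast
    linarith
  have hlim : Tendsto (fun m => (condX P (pre y m)).real (cyl u)) atTop (𝓝 (ν.real (cyl u))) :=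
    (ENNReal.tendsto_toReal (measure_ne_top ν _)).comp (hν.2 u)
  obtain ⟨m, ⟨hT, hc⟩, hm, hl⟩ := ((eventually_trimmed mono hφ hW hνW hf u.length).and
    ((eventually_ge_atTop i).and (hlim.eventually_lt_const hlt))).exists
  have hnew : NewlyCovered ψ n (pre y m) u :=
    (NewlyCovered.iff_pre (mem_cyl_pre y m) (by rwa [hlen, length_pre])).2 (by rwa [hlen])
  refine Set.mem_biUnion (x := (u, pre y m)) ⟨hnew, hT, ?_⟩ ⟨mem_cyl_pre x i, mem_cyl_pre y m⟩
  have hPpos : 0 < P.real (rect ([], pre y m)) := by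
    rw [← snd_real_cyl]
    exact ENNReal.toReal_pos (snd_cyl_ne_zero_of_random hy m) (by finiteness)
  rw [condX_real_cyl, div_lt_div_iff₀ hPpos hpos] at hl
  dsimp only
  rw [hc u (mem_newlyCovered.2 ⟨le_rfl, hnew⟩), Option.getD_some]
  push_cast at hl ⊢
  linarith

end OracleTestMembership

/-- The sections of the random pairs are random relative to the oracle, if the conditional
probability is computable relative to the oracle. -/
theorem randomSection_subset_hippocraticIn {P : Measure (Cantor × Cantor)} [IsProbabilityMeasure P]
    (hP : IsComputableMeasure ∅ rect P) {y : Cantor} (hy : y ∈ hippocratic P.snd)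
    {ν : Measure Cantor} (hν : IsCondProbAt P y ν)
    (hc : IsComputableMeasure (oracle y) cyl ν) : randomSection P y ⊆ hippocraticIn y ν := by
  rintro x hx ⟨A, ⟨W, hW, hWm, hWA⟩, hxA⟩
  obtain ⟨f, hf, hfν⟩ := hc
  obtain ⟨ψ, hψ, monoψ, eψ⟩ := RecursiveIn.exists_primrec_prefix hW
  obtain ⟨φ, hφ, mono, eφ⟩ := RecursiveIn.exists_primrec_prefix hf
  have hWψ : ∀ a, a ∈ W ↔ ∃ m, (ψ (pre y m) a).isSome = true := by
    intro a
    have := eψ a ()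
    simp only [Option.isSome_iff_exists]
    refine Iff.trans ?_ (this.trans (exists_congr fun m => ⟨fun h => ⟨_, h⟩, fun ⟨_, h⟩ => h⟩))
    simp [Part.assert]
  have hφf : ∀ a, ∃ m, f a ∈ φ (pre y m) a := fun a => (eφ a _).1 (Part.mem_some _)
  obtain ⟨N, hN⟩ := randomSet.eventually_notMem hx (rePred_trimmedTest hP hψ hφ)
    (C := 4) (by simp) (measure_trimmedTest_le mono)
  exact hN N le_rfl (mem_level_trimmedTest hy hν monoψ mono hφf hWψ (hWm N) hfν (hWA N hxA))

/-! ### The main theorem. -/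

section MainTheorem

variable {P : Measure (Cantor × Cantor)} [IsProbabilityMeasure P]

/-- `condX P t` is the zero measure if `Δ(t)` has marginal zero. That it has no random sequences
shows that prefixes of the second coordinate of a random pair have positive marginal. -/
theorem hippocratic_zero : hippocratic 0 = ∅ := by
  refine Set.eq_empty_of_forall_notMem fun x hx => hx (Set.mem_sUnion.2 ⟨Set.univ,
    ⟨Set.univ, ?_, fun n => by simp, fun n z _ => ?_⟩, Set.mem_univ x⟩)
  · rw [isREIn_empty]
    exact (Primrec.eq.comp (Primrec.const 0) (Primrec.const 0) : PrimrecPred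
      fun _ : ℕ × List Bool => 0 = 0).computablePred.to_re.of_eq fun _ => by simp
  · exact Set.mem_biUnion (x := ([] : List Bool)) (Set.mem_univ _) (by simp [cyl])

/-- A random sequence for the conditional probability at `y` is the first coordinate of a random
pair, and its second coordinate is `y` if the conditional probabilities are singular. -/
theorem hippocratic_subset_randomSection (hP : IsComputableMeasure ∅ rect P)
    (hsing : SingCylinders P) {y : Cantor} (hy : y ∈ hippocratic P.snd) {ν : Measure Cantor}
    (hν : IsCondProbAt P y ν) : hippocratic ν ⊆ randomSection P y := by
  intro x hx
  have hx0 := hippocratic_subset_condX hP hy hν 0 hx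
  rw [show pre y 0 = [] from rfl, condX_nil] at hx0
  obtain ⟨z, hz⟩ := exists_mem_hippocratic₂ hP hx0
  rcases eq_or_ne y z with rfl | hyz
  · exact hz
  obtain ⟨m, hm⟩ := ne_iff_exists_disjoint_pre hyz
  have hxz := mem_hippocratic_condX hz m
  have hz0 : P.snd (cyl (pre z m)) ≠ 0 := by
    intro h0
    rw [condX, cond_eq_zero_of_meas_eq_zero (by
      rwa [← Measure.snd_apply (measurableSet_cyl _)]), Measure.map_zero, hippocratic_zero] at hxz
    exact hxz
  have := hippocratic_inter_eq_empty hP (snd_cyl_ne_zero_of_random hy m) hz0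
    (hsing _ _ (snd_cyl_ne_zero_of_random hy m) hz0 hm)
  exact absurd (this ▸ ⟨hippocratic_subset_condX hP hy hν m hx, hxz⟩ : x ∈ (∅ : Set Cantor))
    (Set.notMem_empty x)

theorem hippocraticIn_subset (y : Cantor) (ν : Measure Cantor) :
    hippocraticIn y ν ⊆ hippocratic ν := by
  rintro x hx ⟨A, ⟨W, hW, hWA⟩, hxA⟩
  exact hx ⟨A, ⟨W, RecursiveIn.mono (Set.empty_subset _) hW, hWA⟩, hxA⟩

end MainTheorem

theorem mainTheorem1 (P : Measure (Cantor × Cantor)) [IsProbabilityMeasure P]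
    (hP : IsComputableMeasure ∅ rect P)
    (hsing : SingCylinders P ∨ DisjointRandomCylinders P ∨ PosteriorConsistent P ∨
      DisjointSections P ∨ RandomEstimator P ∨ AlmostSureEstimator P)
    (y : Cantor) (hy : y ∈ hippocratic P.snd) :
    ∃ ν : Measure Cantor, IsCondProbAt P y ν ∧
      hippocratic ν ⊆ randomSection P y ∧
      (IsComputableMeasure (oracle y) cyl ν →
        randomSection P y = hippocratic ν ∧ hippocratic ν = hippocraticIn y ν) := by
  -- Conditions 3 and 5 pass through the disjointness of sections, condition 4.
  have hS : SingCylinders P := by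
    rcases hsing with h | h | h | h | h | h
    · exact h
    · exact h.singCylinders
    · exact h.disjointSections.singCylinders hP
    · exact h.singCylinders hP
    · exact h.disjointSections.singCylinders hP
    · exact h.singCylinders
  obtain ⟨ν, hν⟩ := exists_isCondProbAt hP hy
  have h1 := hippocratic_subset_randomSection hP hS hy hν
  have h2 := hippocraticIn_subset y ν
  refine ⟨ν, hν, h1, fun hc => ?_⟩
  have h3 := randomSection_subset_hippocraticIn hP hy hν hc
  -- Three inclusions close a cycle: `R^{ν,y} ⊆ R^ν ⊆ R^P_y ⊆ R^{ν,y}`.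
  exact ⟨(h3.trans h2).antisymm h1, (h1.trans h3).antisymm h2⟩
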